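/- **Conventions.** A graded Lie algebra $\mathfrak h=\bigoplus_{i\in\mathbb Z}\mathfrak h_i$ over $\mathbb R$ satisfies $[x,y]=-(-1)^{|x||y|}[y,x]$ and $[x,[y,z]]=[[x,y],z]+(-1)^{|x||y|}[y,[x,z]]$. A *V-algebra* $(\mathfrak h,\mathfrak a,\Pi_{\mathfrak a})$ is a graded Lie algebra $\mathfrak h$ with an abelian graded subalgebra $\mathfrak a$ and a degree-preserving linear projection $\Pi_{\mathfrak a}\colon\mathfrak h\to\mathfrak a$ such that $\Pi_{\mathfrak a}[x,y]=\Pi_{\mathfrak a}[\Pi_{\mathfrak a}x,y]+\Pi_{\mathfrak a}[x,\Pi_{\mathfrak a}y]$. An *adapted Maurer–Cartan element* is $E=\hat E+[P,\cdot]$ (with this decomposition fixed), where $\hat E$ is a derivation of degree $1$ with $\Pi_{\mathfrak a}\hat E\,\Pi_{\mathfrak a}=\Pi_{\mathfrak a}\hat E$, $P\in\mathfrak h_1$, and $E\circ E=0$. Its *higher derived brackets* are $D^0_E=\Pi_{\mathfrak a}P$ and $D^n_E(x_1,\dots,x_n)=\Pi_{\mathfrak a}[[\cdots[E x_1,x_2],\cdots],x_n]$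 for $n\ge1$, $x_i\in\mathfrak a$. An *$L_\infty$-algebra* structure on a graded vector space $V$ is a family of linear maps $m^n\colon S^n(V)\to V[1]$, $n\ge 0$ (graded symmetric, degree $1$), whose Jacobiators $$J^n(x_1,\dots,x_n)=\sum_{r+s=n}\ \sum_{\sigma\ (r,s)\text{-shuffle}}\pm\, m^{s+1}\bigl(m^r(x_{\sigma(1)},\dots,x_{\sigma(r)}),x_{\sigma(r+1)},\dots,x_{\sigma(n)}\bigr),$$ $\pm$ the Koszul sign, vanish for all $n\ge1$. An *$L_\infty$-morphism* $(V,m)\to(W,m')$ is a family of degree-$0$ maps $f^n\colon S^n(V)\to W$, $n\ge1$, such that for all $n\ge 0$ $$\sum_{r+s=n}\sum_{\sigma}\pm f^{s+1}\bigl(m^r(x_{\sigma(1)},\dots),x_{\sigma(r+1)},\dots\bigr)=\sum_{\sigma\in\Sigma_n}\sum_{k}\sum_{l_1+\cdots+l_k=n}\frac{\pm1}{k!\,l_1!\cdots l_k!}\,m'^k\bigl(f^{l_1}(x_{\sigma(1)},\dots),\dots,f^{l_k}(\dots,x_{\sigma(n)})\bigr)$$ (left: sum over $(r,s)$-shuffles;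 right: all $l_j\ge1$). The composition $g\circ f$ is given by the right-hand side with $g^k$ in place of $m'^k$; an *$L_\infty$-isomorphism* is an $L_\infty$-morphism with a two-sided inverse $L_\infty$-morphism. **Theorem.** Let $(\mathfrak h,\mathfrak a,\Pi_{\mathfrak a})$ be a real V-algebra, where $\mathfrak h$ is a topological vector space and $\Pi_{\mathfrak a}$ is continuous, and let $I=[0,1]$. Let $(m_t)_{t\in I}$ be degree-$0$ derivations of $\mathfrak h$ with $\Pi_{\mathfrak a}m_t\Pi_{\mathfrak a}=\Pi_{\mathfrak a}m_t$, and let $(\phi_t)_{t\in I}$ be automorphisms of the graded Lie algebra $\mathfrak h$ with $$\phi_0=\mathrm{id},\qquad \tfrac{d}{dt}\phi_t(z)=m_t(\phi_t(z))\quad(z\in\mathfrak h,\ t\in I).$$ Assume uniqueness for the Cauchy problem on $\mathfrak a$: whenever $s\in I$ and $\lambda\colon I\to\mathfrak a$ is a differentiable curve, homogeneous of some fixed degree, with $\frac{d}{dt}\lambda_t=\Pi_{\mathfrak a}m_t\lambda_t$ on $I$ and $\lambda_s=0$, then $\lambda_t=0$ for all $t\in I$. For an adapted Maurer–Cartan element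 $E=\hat E+[P,\cdot]$ put $E_t=\phi_t\hat E\phi_t^{-1}+[\phi_tP,\cdot]$, and let $\mathfrak a_t$ be $\mathfrak a$ with the operations $D^n_{E_t}$, $n\ge0$. Then all $\mathfrak a_t$, $t\in I$, are $L_\infty$-algebras, and they are naturally $L_\infty$-isomorphic: for $s,t\in I$ there is a family $U_{s,t}=(U_{s,t}^n)_{n\ge1}$, which does not depend on $E$ and is given by the recursion ($\psi=\phi_t\phi_s^{-1}$, all $\mu_j\ge1$) $$U^n(x_1,\dots,x_n)=\sum_{\sigma\in\Sigma_n}\sum_{k\ge0}\ \sum_{\mu_1+\cdots+\mu_k=n-1}\frac{\pm1}{n\,k!\,\mu_1!\cdots\mu_k!}\,\Pi_{\mathfrak a}\bigl[\bigl[\cdots\bigl[\psi(x_{\sigma(1)}),U^{\mu_1}(x_{\sigma(2)},\dots)\bigr],\cdots\bigr],U^{\mu_k}(\dots,x_{\sigma(n)})\bigr]$$ (so $U^1=\Pi_{\mathfrak a}\psi|_{\mathfrak a}$), such that for every adapted Maurer–Cartan element $E$ the family $U_{s,t}$ is an $L_\infty$-isomorphism $\mathfrak a_s\to\mathfrak a_t$.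 Moreover, if the Jacobiator with $n=0$ of $E$ vanishes, i.e. $D^1_E(D^0_E)=0$, then so does that of every $E_t$. -/

import Mathlib

/-! ### Families of operations on graded vector spaces

A graded vector space is a real vector space `V` together with a grading `𝓥 : ℤ → Submodule ℝ V`;
its homogeneous elements of degree `i` are the elements of `𝓥 i`.
A family of `n`-ary operations is a function `f : ∀ n, (Fin n → V) → W`. -/

/-- The Koszul sign of the permutation `σ` for entries of degrees `d`, that is, the sign `ε` with
`x₁ ⋯ xₙ = ε x_{σ(1)} ⋯ x_{σ(n)}` in the graded symmetric algebra: every pair of entries whose order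
is changed contributes the factor `(-1) ^ (product of the two degrees)`. -/
noncomputable def koszulSign {n : ℕ} (d : Fin n → ℤ) (σ : Equiv.Perm (Fin n)) : ℝ :=
  ∏ i : Fin n, ∏ j : Fin n, if i < j ∧ σ j < σ i then (-1 : ℝ) ^ (d (σ i) * d (σ j)) else 1

/-- `σ` is an `(r, n - r)`-shuffle: it is increasing on the first `r` and on the last `n - r`
positions. -/
def IsShuffle {n : ℕ} (r : ℕ) (σ : Equiv.Perm (Fin n)) : Prop :=
  ∀ i j : Fin n, i < j → ((j : ℕ) < r ∨ r ≤ (i : ℕ)) → σ i < σ j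

section Families

variable {V W X : Type*} [AddCommGroup V] [Module ℝ V] [AddCommGroup W] [Module ℝ W]
  [AddCommGroup X] [Module ℝ X]

/-- The family `f` consists of graded symmetric multilinear maps of degree `k`, that is, of linear
maps `Sⁿ(V) → W[k]`, `n ≥ 0`. -/
structure IsGradedSymmetricFamily (𝓥 : ℤ → Submodule ℝ V) (𝓦 : ℤ → Submodule ℝ W) (k : ℤ)
    (f : ∀ n : ℕ, (Fin n → V) → W) : Prop where
  multilinear : ∀ n, ∃ F : MultilinearMap ℝ (fun _ : Fin n => V) W, ∀ x, F x = f n x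
  degree : ∀ (n : ℕ) (d : Fin n → ℤ) (x : Fin n → V), (∀ i, x i ∈ 𝓥 (d i)) →
    f n x ∈ 𝓦 (∑ i, d i + k)
  symm : ∀ (n : ℕ) (d : Fin n → ℤ) (x : Fin n → V), (∀ i, x i ∈ 𝓥 (d i)) →
    ∀ σ : Equiv.Perm (Fin n), f n x = koszulSign d σ • f n (x ∘ σ)

/-- The insertion of `m` into `f`, evaluated on elements `x₁, …, xₙ` of degrees `d₁, …, dₙ`:
`∑_{r+s=n} ∑_{σ ∈ (r,s)-shuffles} ± f^{s+1}(m^r(x_{σ(1)}, …, x_{σ(r)}), x_{σ(r+1)}, …, x_{σ(n)})`. -/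
noncomputable def insertion (f : ∀ n : ℕ, (Fin n → V) → W) (m : ∀ n : ℕ, (Fin n → V) → V)
    {n : ℕ} (d : Fin n → ℤ) (x : Fin n → V) : W :=
  open scoped Classical in
  ∑ r : Fin (n + 1), ∑ σ : Equiv.Perm (Fin n) with IsShuffle (r : ℕ) σ,
    koszulSign d σ •
      f (n - r + 1) (Fin.cons (m r fun i => x (σ ⟨i, by omega⟩))
        (fun j : Fin (n - r) => x (σ ⟨r + j, by omega⟩)))

/-- The composition of two families `f = (f^l)_{l ≥ 1}` and `g = (g^k)_k`, evaluated on elements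
`x₁, …, xₙ` of degrees `d₁, …, dₙ`:
`∑_σ ∑_k ∑_{l₁+⋯+lₖ=n} ± 1/(k! l₁! ⋯ lₖ!) g^k(f^{l₁}(x_{σ(1)}, …, x_{σ(l₁)}), …, f^{lₖ}(…, x_{σ(n)}))`,
all `lᵢ ≥ 1`. -/
noncomputable def familyComp (g : ∀ n : ℕ, (Fin n → W) → X) (f : ∀ n : ℕ, (Fin n → V) → W)
    {n : ℕ} (d : Fin n → ℤ) (x : Fin n → V) : X :=
  ∑ c : Composition n, ∑ σ : Equiv.Perm (Fin n),
    (koszulSign d σ / ((c.length.factorial : ℝ) * ∏ j, ((c.blocksFun j).factorial : ℝ))) •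
      g c.length fun j => f (c.blocksFun j) fun i => x (σ (c.embedding j i))

/-- The identity morphism: the identity in arity one, zero in every other arity. -/
def idFamily : ∀ n : ℕ, (Fin n → V) → V
  | 1, x => x 0
  | _, _ => 0

/-- The (possibly curved) `L∞`-algebras: families of linear maps `m^n : Sⁿ(V) → V[1]`, `n ≥ 0`,
whose Jacobiators `J^n : Sⁿ(V) → V[2]`, `n ≥ 1`, vanish. -/
structure IsLInftyAlgebra (𝓥 : ℤ → Submodule ℝ V) (m : ∀ n : ℕ, (Fin n → V) → V) : Prop where
  family : IsGradedSymmetricFamily 𝓥 𝓥 1 m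
  jacobi : ∀ (n : ℕ) (d : Fin n → ℤ) (x : Fin n → V), 1 ≤ n → (∀ i, x i ∈ 𝓥 (d i)) →
    insertion m m d x = 0

/-- `L∞`-morphisms from `(V, m)` to `(W, m')`, given by their Taylor coefficients
`f^n : Sⁿ(V) → W`, `n ≥ 1`, of degree `0` (and `f^0 = 0`): the coalgebra morphism `S(V) → S(W)` with
these coefficients intertwines the coderivations with coefficients `m` and `m'`. -/
structure IsLInftyMorphism (𝓥 : ℤ → Submodule ℝ V) (𝓦 : ℤ → Submodule ℝ W)
    (m : ∀ n : ℕ, (Fin n → V) → V) (m' : ∀ n : ℕ, (Fin n → W) → W)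
    (f : ∀ n : ℕ, (Fin n → V) → W) : Prop where
  family : IsGradedSymmetricFamily 𝓥 𝓦 0 f
  zero_ary : ∀ x, f 0 x = 0
  comm : ∀ (n : ℕ) (d : Fin n → ℤ) (x : Fin n → V), (∀ i, x i ∈ 𝓥 (d i)) →
    insertion f m d x = familyComp m' f d x

/-- `f` is an isomorphism from the `L∞`-algebra `(V, m)` onto the `L∞`-algebra `(W, m')`: it is an
`L∞`-morphism with a two-sided inverse `L∞`-morphism. -/
structure IsLInftyIso (𝓥 : ℤ → Submodule ℝ V) (𝓦 : ℤ → Submodule ℝ W)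
    (m : ∀ n : ℕ, (Fin n → V) → V) (m' : ∀ n : ℕ, (Fin n → W) → W)
    (f : ∀ n : ℕ, (Fin n → V) → W) : Prop where
  source : IsLInftyAlgebra 𝓥 m
  target : IsLInftyAlgebra 𝓦 m'
  morphism : IsLInftyMorphism 𝓥 𝓦 m m' f
  inverse : ∃ g : ∀ n : ℕ, (Fin n → W) → V, IsLInftyMorphism 𝓦 𝓥 m' m g ∧
    (∀ (n : ℕ) (d : Fin n → ℤ) (x : Fin n → V), (∀ i, x i ∈ 𝓥 (d i)) →
      familyComp g f d x = idFamily n x) ∧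
    (∀ (n : ℕ) (d : Fin n → ℤ) (y : Fin n → W), (∀ i, y i ∈ 𝓦 (d i)) →
      familyComp f g d y = idFamily n y)

end Families

/-! ### Graded Lie algebras and V-algebras -/

section VAlgebras

variable {H : Type*} [AddCommGroup H] [Module ℝ H]

/-- A graded Lie algebra structure on `H = ⨁ 𝓗 i`, with the Koszul signs in skew-symmetry and in the
Jacobi identity. (Mathlib has graded Lie algebras only in the sense of ordinary Lie algebras with a
grading.) -/
structure KoszulGradedLieAlgebra (𝓗 : ℤ → Submodule ℝ H) where
  internal : DirectSum.IsInternal 𝓗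
  /-- the bracket -/
  br : H →ₗ[ℝ] H →ₗ[ℝ] H
  br_mem : ∀ i j x y, x ∈ 𝓗 i → y ∈ 𝓗 j → br x y ∈ 𝓗 (i + j)
  skew : ∀ i j x y, x ∈ 𝓗 i → y ∈ 𝓗 j → br x y = -((-1 : ℝ) ^ (i * j) • br y x)
  jacobi : ∀ i j x y z, x ∈ 𝓗 i → y ∈ 𝓗 j →
    br x (br y z) = br (br x y) z + (-1 : ℝ) ^ (i * j) • br y (br x z)

/-- `D` is a derivation of degree `n`. -/
structure KoszulGradedLieAlgebra.IsDerivation {𝓗 : ℤ → Submodule ℝ H} (L : KoszulGradedLieAlgebra 𝓗) (n : ℤ)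
    (D : H →ₗ[ℝ] H) : Prop where
  degree : ∀ i x, x ∈ 𝓗 i → D x ∈ 𝓗 (i + n)
  leibniz : ∀ i x y, x ∈ 𝓗 i → D (L.br x y) = L.br (D x) y + (-1 : ℝ) ^ (n * i) • L.br x (D y)

/-- `Φ` is an automorphism of the graded Lie algebra. -/
structure KoszulGradedLieAlgebra.IsAutomorphism {𝓗 : ℤ → Submodule ℝ H} (L : KoszulGradedLieAlgebra 𝓗)
    (Φ : H ≃ₗ[ℝ] H) : Prop where
  degree : ∀ i x, x ∈ 𝓗 i → Φ x ∈ 𝓗 i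
  map_br : ∀ x y, Φ (L.br x y) = L.br (Φ x) (Φ y)

/-- A V-algebra: a graded Lie algebra with an abelian graded subalgebra `a` and a (degree preserving)
projection onto it that satisfies `Π[x,y] = Π[Πx,y] + Π[x,Πy]`. That `a` is a graded subspace follows
from `proj_mem` and `proj_coe`. -/
structure VAlgebra (𝓗 : ℤ → Submodule ℝ H) extends KoszulGradedLieAlgebra 𝓗 where
  /-- the abelian subalgebra -/
  a : Submodule ℝ H
  /-- the projection -/
  proj : H →ₗ[ℝ] a
  proj_coe : ∀ x : a, proj (x : H) = x
  proj_mem : ∀ i x, x ∈ 𝓗 i → (proj x : H) ∈ 𝓗 i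
  abelian : ∀ x y : a, br (x : H) (y : H) = 0
  proj_br : ∀ x y : H, proj (br x y) = proj (br (proj x : H) y) + proj (br x (proj y : H))

namespace VAlgebra

variable {𝓗 : ℤ → Submodule ℝ H} (A : VAlgebra 𝓗)

/-- The grading of `a`. -/
def grading (i : ℤ) : Submodule ℝ A.a := (𝓗 i).comap A.a.subtype

/-- `a` is the direct sum of its graded components. -/
theorem grading_isInternal : DirectSum.IsInternal A.grading := by
  rw [DirectSum.isInternal_submodule_iff_iSupIndep_and_iSup_eq_top]
  have h𝓗 := (DirectSum.isInternal_submodule_iff_iSupIndep_and_iSup_eq_top 𝓗).1 A.internal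
  refine ⟨?_, ?_⟩
  · have h1 := h𝓗.1
    rw [iSupIndep_def] at h1 ⊢
    intro i
    rw [Submodule.disjoint_def]
    intro x hx hx'
    have h2 := (Submodule.disjoint_def.1 (h1 i)) (x : H) hx
    have h3 : (x : H) ∈ ⨆ j, ⨆ (_ : j ≠ i), 𝓗 j := by
      have h4 : (⨆ j, ⨆ (_ : j ≠ i), A.grading j) ≤
          (⨆ j, ⨆ (_ : j ≠ i), 𝓗 j).comap A.a.subtype := by
        refine iSup₂_le fun j hj => Submodule.comap_mono ?_
        exact le_iSup₂ (f := fun j (_ : j ≠ i) => 𝓗 j) j hj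
      exact h4 hx'
    exact Subtype.ext (h2 h3)
  · rw [eq_top_iff]
    have h5 : (⊤ : Submodule ℝ H) ≤ (⨆ i, A.grading i).comap A.proj := by
      rw [← h𝓗.2]
      refine iSup_le fun i x hx => ?_
      exact Submodule.mem_iSup_of_mem i (A.proj_mem i x hx)
    intro x _
    have h6 := h5 (Submodule.mem_top (x := (x : H)))
    rw [Submodule.mem_comap, A.proj_coe] at h6
    exact h6

/-- The iterated bracket `[[…[y, x₁], …], xₙ]`. -/
def nested : ∀ n : ℕ, H → (Fin n → H) → H
  | 0, y, _ => y
  | n + 1, y, x => nested n (A.br y (x 0)) fun i => x i.succ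

/-- The higher derived brackets of `E = Ehat + [P, ·]` with its chosen decomposition:
`D⁰ = Π P` and `Dⁿ(x₁, …, xₙ) = Π [[…[E x₁, x₂], …], xₙ]` for `n ≥ 1`. -/
def derivedBrackets (Ehat : H →ₗ[ℝ] H) (P : H) : ∀ n : ℕ, (Fin n → A.a) → A.a
  | 0, _ => A.proj P
  | n + 1, x => A.proj (A.nested n ((Ehat + A.br P) (x 0)) fun i => x i.succ)

/-- `E = Ehat + [P, ·]` is a Maurer–Cartan element in the graded Lie algebra of adapted derivations:
`Ehat` is a derivation of degree `1` with `Π Ehat Π = Π Ehat`, the element `P` has degree `1`, and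
`½[E, E] = E ∘ E = 0`. -/
structure IsAdaptedMaurerCartan (Ehat : H →ₗ[ℝ] H) (P : H) : Prop where
  derivation : A.IsDerivation 1 Ehat
  adapted : ∀ x, A.proj (Ehat (A.proj x : H)) = A.proj (Ehat x)
  degree : P ∈ 𝓗 1
  square : (Ehat + A.br P) ∘ₗ (Ehat + A.br P) = 0

/-- The derived brackets of `Φ ∘ Ehat ∘ Φ⁻¹ + [Φ P, ·]`. -/
def transportedBrackets (Ehat : H →ₗ[ℝ] H) (P : H) (Φ : H ≃ₗ[ℝ] H) :
    ∀ n : ℕ, (Fin n → A.a) → A.a :=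
  A.derivedBrackets (Φ.toLinearMap ∘ₗ Ehat ∘ₗ Φ.symm.toLinearMap) (Φ P)

/-- The family `U` satisfies, on homogeneous elements, the recursion
`U^n(x₁, …, xₙ) = ∑_σ ∑_k ∑_{μ₁+⋯+μₖ=n-1} ± 1/(n k! μ₁! ⋯ μₖ!)
  Π[[…[ψ x_{σ(1)}, U^{μ₁}(x_{σ(2)}, …)], …], U^{μₖ}(…, x_{σ(n)})]` for `n ≥ 1`, with all `μᵢ ≥ 1`;
in particular `U¹ = Π ψ`. -/
def SatisfiesRecursion (ψ : H ≃ₗ[ℝ] H) (U : ∀ n : ℕ, (Fin n → A.a) → A.a) : Prop :=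
  ∀ (n : ℕ) (d : Fin (n + 1) → ℤ) (x : Fin (n + 1) → A.a), (∀ i, x i ∈ A.grading (d i)) →
    U (n + 1) x = ∑ c : Composition n, ∑ σ : Equiv.Perm (Fin (n + 1)),
      (koszulSign d σ /
          ((n + 1 : ℝ) * (c.length.factorial : ℝ) * ∏ j, ((c.blocksFun j).factorial : ℝ))) •
        A.proj (A.nested c.length (ψ (x (σ 0)))
          fun j => (U (c.blocksFun j) fun i => x (σ (c.embedding j i).succ) : A.a))

end VAlgebra

end VAlgebras

/-!
The mechanism of the proof is a reformulation of all identities between multibrackets as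
differential equations in the graded Lie algebra with graded commutative coefficients. For a word
`x₁, …, xₙ` of homogeneous elements of degrees `d₁, …, dₙ`, let `θ_i` be generators of degree `-d_i`
and of square zero; an element of `𝔥` with coefficients in the `θ_i` is encoded by its coefficients,
a function `Finset ι → H`, and `KoszulGradedLieAlgebra.conv` is the bracket. The element
`X = ∑ x_i ⊗ θ_i` has degree `0`, the values of a family `U` on the subwords of `x₁, …, xₙ` are the
coefficients of `u = ∑ 1/k! U^k(X, …, X)`, and the Euler derivation `D` (`euler`) multiplies the
coefficient at `S` by `|S|`. The equations below determine their solutions by induction on `|S|`.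

*The kernel of the projection.* For `ψ = φ_t φ_s⁻¹` and `Π z = 0` the curve `τ ↦ Π φ_τ φ_s⁻¹ z`
solves the Cauchy problem on `𝔞` and vanishes at `τ = s`. Hence `ψ` and `ψ⁻¹` preserve the kernel of
`Π` (`VAlgebra.preservesKernel_of_flow`). Everything else is algebra and uses only this property of
the automorphism `ψ`. In particular all `E_t` are adapted Maurer–Cartan elements, and the curvature
`Ê P + ½[P, P]`, whose projection is the Jacobiator without arguments, stays in the kernel of
`Π` if it starts there.

*The recursion* says that `D u = Π e^{[·, u]} ψ X` (`VAlgebra.SatisfiesRecursion.isTransported`).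
The gauge operator `G = e^{[·, u]} ψ e^{-[·, X]}` is an automorphism with
`D (G z) = G (D z) - [G z, G X - Π G X]`. As the kernel of `Π` is a subalgebra, this equation shows that `G` preserves it
(`pr_gauge_eq_zero`). It follows that the recursion, which treats all arguments alike, can be
resolved for each of them: for every weighted Euler derivation `D_w` one has
`D_w u = Π e^{[·, u]} ψ D_w X` (`euler_weight`), that is, the derivative of the transport in the
direction `Y` is `Π e^{[·, u]} ψ Y` (`SatisfiesRecursion.insertion_eq`).

*The morphism property.* Before the projection, the derived brackets of `E` form a series `p` with
constant term `P` and `D p = Ê X + [p, X]`. The equation `E ∘ E = 0` forces `Ê p + ½[p, p]` to be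
constant, and its projection generates the Jacobiators (`pr_square_apply_eq_zero`). For the
conjugate element the series `p'`, evaluated on `u`, satisfies `D p' = Ê' D u + [p', D u]`.
Comparing the equations for `G p` and for `p'` gives `Π G p = Π p'` (`pr_expAd_pr`), which is the
morphism identity.

*The inverse.* Composing with the family `W` of `ψ⁻¹` amounts to evaluating `W` on the word of all
values of `U` and gluing the result along `θ_j ↦ ∏_{i ∈ b j} θ_i` (`familyComp_eq_glue`). The
composition then solves `D w = Π e^{[·, w]} ψ⁻¹ D u`, an equation that `X` solves too
(`eq_source_of_ode`). The Koszul signs and factorials of the statement are matched with these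
formulas by counting permutations that give the same ordered partition of the word
(`sum_composition_perm`, `insertion_eq_sum`).
-/

section

open Finset

/-! ### Koszul signs of ordered decompositions of a finite set -/

section Signs

variable {ι : Type*} [LinearOrder ι] (d : ι → ℤ)

/-- The sign by which `x_a x_b` differs from the increasing product of `x_a` and `x_b`, for entries
of degrees `d a` and `d b`. -/
noncomputable def pairSign (a b : ι) : ℝ := if b < a then (-1 : ℝ) ^ (d a * d b) else 1

/-- The Koszul sign that sorts the concatenation of the increasing words in `A` and in `B`. -/
noncomputable def blockSign (A B : Finset ι) : ℝ := ∏ a ∈ A, ∏ b ∈ B, pairSign d a b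

/-- The total degree of the entries with index in `A`. -/
def degSum (A : Finset ι) : ℤ := ∑ a ∈ A, d a

theorem negOne_zpow_congr {a b : ℤ} (c : ℤ) (h : a - b = 2 * c) : (-1 : ℝ) ^ a = (-1 : ℝ) ^ b := by
  have : a = b + 2 * c := by omega
  rw [this, zpow_add₀ (by norm_num), zpow_mul]
  simp

theorem negOne_zpow_mul_self (a : ℤ) : (-1 : ℝ) ^ a * (-1 : ℝ) ^ a = 1 := by
  rw [← zpow_add₀ (by norm_num), negOne_zpow_congr (b := 0) a (by ring), zpow_zero]

theorem negOne_zpow_mul (a b : ℤ) : (-1 : ℝ) ^ a * (-1 : ℝ) ^ b = (-1 : ℝ) ^ (a + b) :=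
  (zpow_add₀ (by norm_num) a b).symm

theorem pairSign_mul_self (a b : ι) : pairSign d a b * pairSign d a b = 1 := by
  unfold pairSign
  split_ifs
  · exact negOne_zpow_mul_self _
  · simp

theorem pairSign_swap {a b : ι} (h : a ≠ b) :
    pairSign d a b = (-1 : ℝ) ^ (d a * d b) * pairSign d b a := by
  unfold pairSign
  rcases lt_or_gt_of_ne h with h' | h'
  · rw [if_neg h'.not_gt, if_pos h', mul_comm (d b), negOne_zpow_mul_self]
  · rw [if_pos h', if_neg h'.not_gt, mul_one]

theorem degSum_union {A B : Finset ι} (h : Disjoint A B) :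
    degSum d (A ∪ B) = degSum d A + degSum d B := sum_union h

theorem degSum_sdiff {A S : Finset ι} (h : A ⊆ S) :
    degSum d A + degSum d (S \ A) = degSum d S := by
  rw [← degSum_union d disjoint_sdiff, union_sdiff_of_subset h]

@[simp] theorem degSum_empty {ι : Type*} (d : ι → ℤ) : degSum d ∅ = 0 := rfl

@[simp] theorem degSum_singleton {ι : Type*} (d : ι → ℤ) (i : ι) : degSum d {i} = d i :=
  sum_singleton _ _

@[simp] theorem blockSign_empty_left (B : Finset ι) : blockSign d ∅ B = 1 := rfl

@[simp] theorem blockSign_empty_right (A : Finset ι) : blockSign d A ∅ = 1 := by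
  simp [blockSign]

theorem blockSign_union_left {A B : Finset ι} (h : Disjoint A B) (C : Finset ι) :
    blockSign d (A ∪ B) C = blockSign d A C * blockSign d B C := prod_union h

theorem blockSign_union_right (A : Finset ι) {B C : Finset ι} (h : Disjoint B C) :
    blockSign d A (B ∪ C) = blockSign d A B * blockSign d A C := by
  simp only [blockSign, prod_union h, prod_mul_distrib]

theorem blockSign_mul_self (A B : Finset ι) : blockSign d A B * blockSign d A B = 1 := by
  simp only [blockSign, ← prod_mul_distrib, pairSign_mul_self, prod_const_one]

theorem blockSign_swap {A B : Finset ι} (h : Disjoint A B) :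
    blockSign d A B = (-1 : ℝ) ^ (degSum d A * degSum d B) * blockSign d B A := by
  have key : ∀ f : ι × ι → ℤ, ∀ s : Finset (ι × ι),
      ∏ p ∈ s, (-1 : ℝ) ^ f p = (-1 : ℝ) ^ (∑ p ∈ s, f p) := by
    intro f s
    induction s using Finset.induction_on with
    | empty => simp
    | insert a s ha ih => rw [prod_insert ha, sum_insert ha, ih, negOne_zpow_mul]
  have h1 : blockSign d B A = ∏ a ∈ A, ∏ b ∈ B, pairSign d b a := prod_comm
  rw [h1, degSum, degSum, sum_mul_sum, ← sum_product', ← key, blockSign, ← prod_product',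
    ← prod_product', ← prod_mul_distrib]
  refine prod_congr rfl fun p hp => ?_
  rw [mem_product] at hp
  exact pairSign_swap d (disjoint_iff_ne.1 h _ hp.1 _ hp.2)

end Signs

section Reindexing

variable {ι M : Type*} [DecidableEq ι] [AddCommMonoid M]

theorem sum_powerset_compl (S : Finset ι) (Φ : Finset ι → Finset ι → M) :
    ∑ A ∈ S.powerset, Φ A (S \ A) = ∑ A ∈ S.powerset, Φ (S \ A) A := by
  refine sum_nbij' (fun A => S \ A) (fun A => S \ A) ?_ ?_ ?_ ?_ ?_
  · intro A _; simp
  · intro A _; simp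
  · intro A hA; simpa using mem_powerset.1 hA
  · intro A hA; simpa using mem_powerset.1 hA
  · intro A hA
    rw [Finset.sdiff_sdiff_eq_self (mem_powerset.1 hA)]

/-- Decompositions of a finite set into three parts, chosen from the left or from the right. -/
theorem sum_powerset_assoc (S : Finset ι) (Φ : Finset ι → Finset ι → Finset ι → M) :
    ∑ T ∈ S.powerset, ∑ A ∈ T.powerset, Φ A (T \ A) (S \ T) =
      ∑ A ∈ S.powerset, ∑ B ∈ (S \ A).powerset, Φ A B ((S \ A) \ B) := by
  rw [sum_sigma', sum_sigma']
  refine sum_bij' (fun x _ => (⟨x.2, x.1 \ x.2⟩ : Σ _ : Finset ι, Finset ι))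
    (fun x _ => (⟨x.1 ∪ x.2, x.1⟩ : Σ _ : Finset ι, Finset ι)) ?_ ?_ ?_ ?_ ?_
  · rintro ⟨T, A⟩ h
    simp only [mem_sigma, mem_powerset] at h ⊢
    exact ⟨h.2.trans h.1, sdiff_subset_sdiff h.1 subset_rfl⟩
  · rintro ⟨A, B⟩ h
    simp only [mem_sigma, mem_powerset] at h ⊢
    exact ⟨union_subset h.1 (h.2.trans sdiff_subset), subset_union_left⟩
  · rintro ⟨T, A⟩ h
    simp only [mem_sigma, mem_powerset] at h ⊢
    rw [union_sdiff_of_subset h.2]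
  · rintro ⟨A, B⟩ h
    simp only [mem_sigma, mem_powerset] at h ⊢
    rw [union_sdiff_cancel_left (disjoint_sdiff.mono_right h.2)]
  · rintro ⟨T, A⟩ h
    simp only [mem_sigma, mem_powerset] at h ⊢
    congr 1
    ext i
    have := @h.2 i
    simp only [mem_sdiff]
    tauto

end Reindexing

theorem DirectSum.IsInternal.induction_homogeneous {R M κ : Type*} [DecidableEq κ] [Semiring R]
    [AddCommMonoid M] [Module R M] {𝓜 : κ → Submodule R M} (h𝓜 : DirectSum.IsInternal 𝓜)
    {p : M → Prop} (h0 : p 0) (hadd : ∀ x y, p x → p y → p (x + y))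
    (h : ∀ i, ∀ x ∈ 𝓜 i, p x) (x : M) : p x := by
  have hx : x ∈ ⨆ i, 𝓜 i := by
    rw [h𝓜.submodule_iSup_eq_top]
    trivial
  exact Submodule.iSup_induction 𝓜 (motive := p) hx h h0 hadd

/-! ### The graded Lie algebra with graded commutative coefficients -/

namespace KoszulGradedLieAlgebra

variable {H : Type*} [AddCommGroup H] [Module ℝ H] {𝓗 : ℤ → Submodule ℝ H}
  (L : KoszulGradedLieAlgebra 𝓗)

/-- The Jacobi identity for right multiplications. The degree of `g` does not enter, so `g` need not
be homogeneous. -/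
theorem jacobi_right {i j : ℤ} {u v : H} (hu : u ∈ 𝓗 i) (hv : v ∈ 𝓗 j) (g : H) :
    L.br (L.br g u) v = L.br g (L.br u v) + (-1 : ℝ) ^ (i * j) • L.br (L.br g v) u := by
  refine L.internal.induction_homogeneous (p := fun g => L.br (L.br g u) v =
    L.br g (L.br u v) + (-1 : ℝ) ^ (i * j) • L.br (L.br g v) u) (by simp) ?_ ?_ g
  · intro x y hx hy
    simp only [map_add, LinearMap.add_apply, hx, hy, smul_add]
    abel
  · intro k g hg
    rw [L.jacobi k i g u v hg hu, L.skew i (k + j) u _ hu (L.br_mem k j g v hg hv)]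
    rw [smul_neg, smul_smul, negOne_zpow_mul,
      negOne_zpow_congr (b := i * j) (k * i) (by ring)]
    abel

/-- The family `f` has total degree `i`, where the element with coefficient `f S` at `θ_S` is
thought of as `∑ f S ⊗ θ_S` with generators `θ_j` of degree `-d j`. -/
def IsHomogeneous {ι : Type*} (𝓗 : ℤ → Submodule ℝ H) (d : ι → ℤ) (i : ℤ) (f : Finset ι → H) :
    Prop :=
  ∀ S, f S ∈ 𝓗 (degSum d S + i)

variable {ι : Type*} [LinearOrder ι] (d : ι → ℤ)

/-- The bracket of two families `f, g` of coefficients indexed by the subsets of `ι`. A family `f`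
stands for `∑ f S ⊗ θ_S` in the tensor product of the graded Lie algebra with the graded commutative
algebra on generators `θ_i` of degree `-d i` and square zero, where `θ_S` is the product of the
`θ_i`, `i ∈ S`, in decreasing order. Moving `θ_A` past the coefficients of `g` requires the total
degree `j` of `g`, which is an argument of its own because `g` is not assumed homogeneous. -/
noncomputable def conv (j : ℤ) :
    (Finset ι → H) →ₗ[ℝ] (Finset ι → H) →ₗ[ℝ] (Finset ι → H) :=
  LinearMap.mk₂ ℝ
    (fun f g S => ∑ A ∈ S.powerset,
      (blockSign d A (S \ A) * (-1 : ℝ) ^ (degSum d A * j)) • L.br (f A) (g (S \ A)))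
    (by intros; ext S; simp [sum_add_distrib])
    (by
      intro c f g
      ext S
      simp only [Pi.smul_apply, map_smul, LinearMap.smul_apply, smul_sum]
      exact sum_congr rfl fun _ _ => smul_comm _ _ _)
    (by intros; ext S; simp [sum_add_distrib])
    (by
      intro c f g
      ext S
      simp only [Pi.smul_apply, map_smul, smul_sum]
      exact sum_congr rfl fun _ _ => smul_comm _ _ _)

theorem conv_apply (j : ℤ) (f g : Finset ι → H) (S : Finset ι) :
    L.conv d j f g S = ∑ A ∈ S.powerset,
      (blockSign d A (S \ A) * (-1 : ℝ) ^ (degSum d A * j)) • L.br (f A) (g (S \ A)) := rfl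

theorem conv_zero_apply (f g : Finset ι → H) (S : Finset ι) :
    L.conv d 0 f g S = ∑ A ∈ S.powerset, blockSign d A (S \ A) • L.br (f A) (g (S \ A)) := by
  simp [conv_apply]

theorem conv_mem {i j : ℤ} {f g : Finset ι → H} (hf : IsHomogeneous 𝓗 d i f)
    (hg : IsHomogeneous 𝓗 d j g) : IsHomogeneous 𝓗 d (i + j) (L.conv d j f g) := by
  intro S
  rw [conv_apply]
  refine Submodule.sum_mem _ fun A hA => Submodule.smul_mem _ _ ?_
  have h := L.br_mem _ _ _ _ (hf A) (hg (S \ A))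
  rw [mem_powerset] at hA
  rw [← degSum_sdiff d hA]
  convert h using 2
  ring

theorem conv_skew {i j : ℤ} {f g : Finset ι → H} (hf : IsHomogeneous 𝓗 d i f)
    (hg : IsHomogeneous 𝓗 d j g) :
    L.conv d j f g = -((-1 : ℝ) ^ (i * j) • L.conv d i g f) := by
  ext S
  rw [Pi.neg_apply, Pi.smul_apply, conv_apply, conv_apply, smul_sum, ← sum_neg_distrib,
    sum_powerset_compl S fun A B =>
      (blockSign d A B * (-1 : ℝ) ^ (degSum d A * j)) • L.br (f A) (g B)]
  refine sum_congr rfl fun A hA => ?_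
  rw [L.skew _ _ _ _ (hf (S \ A)) (hg A), smul_neg, smul_smul, smul_smul,
    blockSign_swap d (sdiff_disjoint : Disjoint (S \ A) A)]
  congr 2
  rw [mul_comm _ (blockSign d A (S \ A)), mul_assoc, mul_assoc, negOne_zpow_mul, negOne_zpow_mul,
    mul_comm _ (blockSign d A (S \ A) * _), mul_assoc, negOne_zpow_mul]
  congr 1
  refine negOne_zpow_congr (degSum d (S \ A) * degSum d A + degSum d (S \ A) * j) ?_
  ring

/-- The Jacobi identity for right multiplications; `g` need not be homogeneous. -/
theorem conv_jacobi {j k : ℤ} (g : Finset ι → H) {u v : Finset ι → H}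
    (hu : IsHomogeneous 𝓗 d j u) (hv : IsHomogeneous 𝓗 d k v) :
    L.conv d k (L.conv d j g u) v =
      L.conv d (j + k) g (L.conv d k u v) +
        (-1 : ℝ) ^ (j * k) • L.conv d j (L.conv d k g v) u := by
  ext S
  have e1 : ∀ (j k : ℤ) (u v : Finset ι → H), L.conv d k (L.conv d j g u) v S =
      ∑ A ∈ S.powerset, ∑ B ∈ (S \ A).powerset,
        (blockSign d (A ∪ B) ((S \ A) \ B) * (-1 : ℝ) ^ (degSum d (A ∪ B) * k) *
          (blockSign d A B * (-1 : ℝ) ^ (degSum d A * j))) •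
            L.br (L.br (g A) (u B)) (v ((S \ A) \ B)) := by
    intro j k u v
    rw [← sum_powerset_assoc S fun A B C =>
      (blockSign d (A ∪ B) C * (-1 : ℝ) ^ (degSum d (A ∪ B) * k) *
          (blockSign d A B * (-1 : ℝ) ^ (degSum d A * j))) •
            L.br (L.br (g A) (u B)) (v C), conv_apply]
    refine sum_congr rfl fun T _ => ?_
    rw [conv_apply, map_sum, LinearMap.sum_apply, smul_sum]
    refine sum_congr rfl fun A hA => ?_
    rw [union_sdiff_of_subset (mem_powerset.1 hA), map_smul, LinearMap.smul_apply, smul_smul]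
  have e2 : ∀ A ∈ S.powerset, ∑ B ∈ (S \ A).powerset,
        (blockSign d (A ∪ B) ((S \ A) \ B) * (-1 : ℝ) ^ (degSum d (A ∪ B) * j) *
          (blockSign d A B * (-1 : ℝ) ^ (degSum d A * k))) •
            L.br (L.br (g A) (v B)) (u ((S \ A) \ B)) = ∑ B ∈ (S \ A).powerset,
        (blockSign d (A ∪ (S \ A) \ B) B * (-1 : ℝ) ^ (degSum d (A ∪ (S \ A) \ B) * j) *
          (blockSign d A ((S \ A) \ B) * (-1 : ℝ) ^ (degSum d A * k))) •
            L.br (L.br (g A) (v ((S \ A) \ B))) (u B) := by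
    intro A _
    exact sum_powerset_compl (S \ A) fun B C =>
      (blockSign d (A ∪ B) C * (-1 : ℝ) ^ (degSum d (A ∪ B) * j) *
          (blockSign d A B * (-1 : ℝ) ^ (degSum d A * k))) •
            L.br (L.br (g A) (v B)) (u C)
  rw [Pi.add_apply, Pi.smul_apply, e1 j k u v, e1 k j v u, sum_congr rfl e2, conv_apply, smul_sum,
    ← sum_add_distrib]
  refine sum_congr rfl fun A hA => ?_
  rw [conv_apply, map_sum, smul_sum, smul_sum, ← sum_add_distrib]
  refine sum_congr rfl fun B hB => ?_
  rw [mem_powerset] at hA hB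
  obtain ⟨C, hC⟩ : ∃ C, (S \ A) \ B = C := ⟨_, rfl⟩
  have hAB : Disjoint A B := disjoint_sdiff.mono_right hB
  have hBC : Disjoint B C := hC ▸ disjoint_sdiff
  have hAC : Disjoint A C := hC ▸ disjoint_sdiff.mono_right sdiff_subset
  have hS : S \ A = B ∪ C := by rw [← hC, union_sdiff_of_subset hB]
  rw [hC, hS, L.jacobi_right (hu B) (hv C), map_smul, smul_add, smul_smul, smul_smul, smul_smul,
    blockSign_union_left d hAB, blockSign_union_left d hAC, blockSign_union_right d A hBC,
    degSum_union d hAB, degSum_union d hAC, blockSign_swap d hBC.symm]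
  congr 2
  · simp only [add_mul, mul_add, ← negOne_zpow_mul]
    ring
  · have h2 : ∀ p q r : ℝ, ∀ a b c e a' b' c' e' : ℤ, ∀ t : ℤ,
        a + b + c - (a' + b' + c' + e') = 2 * t →
        p * q * (-1) ^ a * (r * (-1) ^ b) * (-1) ^ c =
        (-1) ^ a' * (r * ((-1) ^ b' * q) * (-1) ^ c' * (p * (-1) ^ e')) := by
      intro p q r a b c e a' b' c' e' t ht
      have h3 := negOne_zpow_congr t ht
      rw [← negOne_zpow_mul, ← negOne_zpow_mul, ← negOne_zpow_mul, ← negOne_zpow_mul,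
        ← negOne_zpow_mul] at h3
      linear_combination (p * q * r) * h3
    rw [h2 _ _ _ _ _ _ 0 _ _ _ _ (degSum d B * k)]
    ring

end KoszulGradedLieAlgebra

/-! ### Exponentials of inner derivations -/

/-- A double sum over a square, sorted by antidiagonals, if the summands beyond the middle
antidiagonal vanish. -/
theorem sum_range_product_eq_sum_antidiagonal {M : Type*} [AddCommMonoid M] (N : ℕ)
    (a : ℕ → ℕ → M) (ha : ∀ i j, N < i + j → a i j = 0) :
    ∑ i ∈ range (N + 1), ∑ j ∈ range (N + 1), a i j =
      ∑ k ∈ range (N + 1), ∑ p ∈ antidiagonal k, a p.1 p.2 := by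
  rw [← sum_product', ← sum_filter_add_sum_filter_not (range (N + 1) ×ˢ range (N + 1))
    (fun p => p.1 + p.2 ∈ range (N + 1))]
  rw [sum_eq_zero (s := filter (fun p : ℕ × ℕ => p.1 + p.2 ∉ range (N + 1)) _)
    (fun p hp => ha _ _ (by simp only [mem_filter, mem_range] at hp; omega)), add_zero,
    ← sum_fiberwise_of_maps_to (g := fun p : ℕ × ℕ => p.1 + p.2) (t := range (N + 1))]
  · refine sum_congr rfl fun k hk => sum_congr ?_ fun _ _ => rfl
    ext ⟨i, j⟩
    simp only [mem_filter, mem_product, mem_range, HasAntidiagonal.mem_antidiagonal] at hk ⊢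
    omega
  · intro p hp
    exact (mem_filter.1 hp).2

theorem inv_factorial_add_mul_choose (a b : ℕ) :
    ((a + b).factorial : ℝ)⁻¹ * ((a + b).choose a : ℝ) =
      (a.factorial : ℝ)⁻¹ * (b.factorial : ℝ)⁻¹ := by
  have h := Nat.choose_mul_factorial_mul_factorial (Nat.le_add_right a b)
  rw [Nat.add_sub_cancel_left] at h
  have h' : ((a + b).choose a : ℝ) * a.factorial * b.factorial = (a + b).factorial := by
    exact_mod_cast h
  have := Nat.factorial_ne_zero a
  have := Nat.factorial_ne_zero b
  have := Nat.factorial_ne_zero (a + b)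
  field_simp
  linarith

/-- The family `f` vanishes on sets with less than `m` elements. -/
def VanishesBelow {ι H : Type*} [Zero H] (m : ℕ) (f : Finset ι → H) : Prop :=
  ∀ S : Finset ι, S.card < m → f S = 0

theorem vanishesBelow_zero {ι H : Type*} [Zero H] (f : Finset ι → H) : VanishesBelow 0 f :=
  fun _ h => absurd h (Nat.not_lt_zero _)

theorem vanishesBelow_one {ι H : Type*} [Zero H] {f : Finset ι → H} (h : f ∅ = 0) :
    VanishesBelow 1 f := fun S hS => by
  rw [card_eq_zero.1 (Nat.lt_one_iff.1 hS), h]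

theorem eq_zero_of_forall_ssubset {ι H : Type*} [Zero H] {f : Finset ι → H}
    (h : ∀ S, (∀ A, A ⊂ S → f A = 0) → f S = 0) : f = 0 :=
  funext fun S => Finset.strongInduction (p := fun S => f S = 0) h S

section Euler

variable {ι : Type*} {H : Type*} [AddCommGroup H] [Module ℝ H]

/-- The derivation that multiplies the coefficient of `θ_S` with the weight of `S`. For the weights
`w = 1` it is the Euler derivation, multiplication by the polynomial degree `|S|`. -/
noncomputable def euler (w : ι → ℝ) : (Finset ι → H) →ₗ[ℝ] (Finset ι → H) where
  toFun f S := (∑ i ∈ S, w i) • f S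
  map_add' f g := by ext; simp
  map_smul' c f := by
    ext S
    exact smul_comm _ _ _

theorem euler_apply (w : ι → ℝ) (f : Finset ι → H) (S : Finset ι) :
    euler w f S = (∑ i ∈ S, w i) • f S := rfl

@[simp] theorem euler_empty (w : ι → ℝ) (f : Finset ι → H) : euler w f ∅ = 0 := by
  simp [euler_apply]

theorem euler_one_apply (f : Finset ι → H) (S : Finset ι) :
    euler (fun _ => 1) f S = (S.card : ℝ) • f S := by
  simp [euler_apply]

theorem euler_comm (v w : ι → ℝ) (f : Finset ι → H) :
    euler v (euler w f) = euler w (euler v f) := by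
  ext S
  simp only [euler_apply]
  rw [smul_comm]

theorem euler_compLeft (w : ι → ℝ) (φ : H →ₗ[ℝ] H) (f : Finset ι → H) :
    euler w (φ.compLeft (Finset ι) f) = φ.compLeft (Finset ι) (euler w f) := by
  ext S
  simp [euler_apply]

/-- Uniqueness for differential equations of the Euler derivation, by induction on the size of `S`.
-/
theorem eq_zero_of_euler_one {v : Finset ι → H} (h0 : v ∅ = 0)
    (h : ∀ S, (∀ A, A ⊂ S → v A = 0) → euler (fun _ => 1) v S = 0) : v = 0 := by
  refine eq_zero_of_forall_ssubset fun S hS => ?_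
  rcases S.eq_empty_or_nonempty with rfl | hne
  · exact h0
  · have := h S hS
    rw [euler_one_apply, smul_eq_zero] at this
    exact this.resolve_left (by exact_mod_cast hne.card_pos.ne')

end Euler

namespace KoszulGradedLieAlgebra

variable {H : Type*} [AddCommGroup H] [Module ℝ H] {𝓗 : ℤ → Submodule ℝ H}

section Homogeneous

variable {ι : Type*} {d : ι → ℤ}

theorem IsHomogeneous.neg {i : ℤ} {f : Finset ι → H} (hf : IsHomogeneous 𝓗 d i f) :
    IsHomogeneous 𝓗 d i (-f) := fun S => Submodule.neg_mem _ (hf S)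

theorem IsHomogeneous.euler {i : ℤ} {f : Finset ι → H} (w : ι → ℝ)
    (hf : IsHomogeneous 𝓗 d i f) : IsHomogeneous 𝓗 d i (euler w f) :=
  fun S => Submodule.smul_mem _ _ (hf S)

theorem IsHomogeneous.compLeft {i k : ℤ} {f : Finset ι → H} {φ : H →ₗ[ℝ] H}
    (hφ : ∀ i x, x ∈ 𝓗 i → φ x ∈ 𝓗 (i + k)) (hf : IsHomogeneous 𝓗 d i f) :
    IsHomogeneous 𝓗 d (i + k) (φ.compLeft (Finset ι) f) := fun S => by
  rw [← add_assoc]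
  exact hφ _ _ (hf S)

end Homogeneous

variable (L : KoszulGradedLieAlgebra 𝓗) {ι : Type*} [LinearOrder ι] (d : ι → ℤ)

theorem conv_vanishesBelow {m n : ℕ} (j : ℤ) {f g : Finset ι → H} (hf : VanishesBelow m f)
    (hg : VanishesBelow n g) : VanishesBelow (m + n) (L.conv d j f g) := by
  intro S hS
  rw [conv_apply]
  refine sum_eq_zero fun A hA => ?_
  rw [mem_powerset] at hA
  have hc := card_sdiff_add_card_eq_card hA
  by_cases h : A.card < m
  · simp [hf A h]
  · simp [hg (S \ A) (by omega)]

theorem conv_eq_zero_of_left (j : ℤ) {f g : Finset ι → H} {S : Finset ι}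
    (hf : ∀ A, A ⊂ S → f A = 0) (hg : g ∅ = 0) : L.conv d j f g S = 0 := by
  rw [conv_apply]
  refine sum_eq_zero fun A hA => ?_
  rcases (mem_powerset.1 hA).eq_or_ssubset with rfl | h
  · simp [hg]
  · simp [hf A h]

theorem conv_eq_zero_of_right (j : ℤ) {f g : Finset ι → H} {S : Finset ι}
    (hg : ∀ A, A ⊂ S → g A = 0) (hf : f ∅ = 0) : L.conv d j f g S = 0 := by
  rw [conv_apply, sum_powerset_compl S fun A B =>
      (blockSign d A B * (-1 : ℝ) ^ (degSum d A * j)) • L.br (f A) (g B)]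
  refine sum_eq_zero fun A hA => ?_
  rcases (mem_powerset.1 hA).eq_or_ssubset with rfl | h
  · simp [hf]
  · simp [hg A h]

@[simp] theorem conv_empty (j : ℤ) (f g : Finset ι → H) :
    L.conv d j f g ∅ = L.br (f ∅) (g ∅) := by
  simp [conv_apply]

theorem euler_conv (w : ι → ℝ) (j : ℤ) (f g : Finset ι → H) :
    euler w (L.conv d j f g) = L.conv d j (euler w f) g + L.conv d j f (euler w g) := by
  ext S
  rw [Pi.add_apply, euler_apply, conv_apply, conv_apply, conv_apply, smul_sum, ← sum_add_distrib]
  refine sum_congr rfl fun A hA => ?_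
  rw [mem_powerset] at hA
  rw [euler_apply, euler_apply, map_smul, map_smul, LinearMap.smul_apply, ← sum_sdiff hA]
  module

theorem compLeft_conv {φ : H →ₗ[ℝ] H} (hφ : ∀ x y, φ (L.br x y) = L.br (φ x) (φ y)) (j : ℤ)
    (f g : Finset ι → H) : φ.compLeft (Finset ι) (L.conv d j f g) =
      L.conv d j (φ.compLeft (Finset ι) f) (φ.compLeft (Finset ι) g) := by
  ext S
  simp [conv_apply, hφ]

theorem derivation_conv {D : H →ₗ[ℝ] H} (hD : L.IsDerivation 1 D) {i : ℤ} (j : ℤ)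
    {f : Finset ι → H} (hf : IsHomogeneous 𝓗 d i f) (g : Finset ι → H) :
    D.compLeft (Finset ι) (L.conv d j f g) = L.conv d j (D.compLeft (Finset ι) f) g +
      (-1 : ℝ) ^ i • L.conv d (j + 1) f (D.compLeft (Finset ι) g) := by
  ext S
  simp only [LinearMap.compLeft_apply, Function.comp_apply, conv_apply, Pi.add_apply,
    Pi.smul_apply, map_sum, map_smul, smul_sum, ← sum_add_distrib]
  refine sum_congr rfl fun A _ => ?_
  rw [hD.leibniz _ _ _ (hf A), smul_add, smul_smul, smul_smul, mul_assoc, negOne_zpow_mul,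
    mul_left_comm, negOne_zpow_mul]
  congr 4
  ring

/-- Right multiplication `f ↦ [f, u]`. -/
noncomputable def adRight (u : Finset ι → H) : Module.End ℝ (Finset ι → H) :=
  (L.conv d 0).flip u

theorem adRight_apply (u f : Finset ι → H) : L.adRight d u f = L.conv d 0 f u := rfl

theorem adRight_pow_vanishesBelow {u : Finset ι → H} (hu : u ∅ = 0) (k : ℕ) {m : ℕ}
    {f : Finset ι → H} (hf : VanishesBelow m f) :
    VanishesBelow (m + k) ((L.adRight d u ^ k) f) := by
  induction k with
  | zero => simpa using hf
  | succ k ih =>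
    rw [pow_succ', Module.End.mul_apply, adRight_apply, ← add_assoc]
    exact L.conv_vanishesBelow d 0 ih (vanishesBelow_one hu)

theorem adRight_pow_homogeneous {i : ℤ} {u f : Finset ι → H} (hu : IsHomogeneous 𝓗 d 0 u)
    (hf : IsHomogeneous 𝓗 d i f) (k : ℕ) :
    IsHomogeneous 𝓗 d i ((L.adRight d u ^ k) f) := by
  induction k with
  | zero => simpa using hf
  | succ k ih =>
    rw [pow_succ', Module.End.mul_apply, adRight_apply]
    simpa using L.conv_mem d ih hu

theorem adRight_commute {u v : Finset ι → H} (hu : IsHomogeneous 𝓗 d 0 u)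
    (hv : IsHomogeneous 𝓗 d 0 v) (huv : L.conv d 0 u v = 0) :
    Commute (L.adRight d u) (L.adRight d v) := by
  refine LinearMap.ext fun g => ?_
  have h := L.conv_jacobi d g hu hv
  rw [huv] at h
  simp only [Module.End.mul_apply, adRight_apply]
  simpa using h.symm

theorem adRight_pow_conv {j : ℤ} {u g : Finset ι → H} (hu : IsHomogeneous 𝓗 d 0 u)
    (hg : IsHomogeneous 𝓗 d j g) (f : Finset ι → H) (k : ℕ) :
    (L.adRight d u ^ k) (L.conv d j f g) = ∑ p ∈ antidiagonal k,
      k.choose p.1 • L.conv d j ((L.adRight d u ^ p.1) f) ((L.adRight d u ^ p.2) g) := by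
  induction k with
  | zero => simp
  | succ k ih =>
    rw [sum_antidiagonal_choose_succ_nsmul (fun a b =>
      L.conv d j ((L.adRight d u ^ a) f) ((L.adRight d u ^ b) g)) k, pow_succ',
      Module.End.mul_apply, ih, map_sum, ← sum_add_distrib]
    refine sum_congr rfl fun p hp => ?_
    have h := L.conv_jacobi d ((L.adRight d u ^ p.1) f) (L.adRight_pow_homogeneous d hu hg p.2) hu
    rw [mul_zero, zpow_zero, one_smul, add_zero] at h
    rw [map_nsmul, adRight_apply, h, smul_add, pow_succ', pow_succ', Module.End.mul_apply,
      Module.End.mul_apply, adRight_apply, adRight_apply,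
      Nat.choose_symm_of_eq_add (HasAntidiagonal.mem_antidiagonal.1 hp).symm]

/-- The derivative of a power of a right multiplication that commutes with its derivative. -/
theorem euler_adRight_pow {w : ι → ℝ} {u : Finset ι → H}
    (h : Commute (L.adRight d u) (L.adRight d (euler w u))) (f : Finset ι → H) (k : ℕ) :
    euler w ((L.adRight d u ^ (k + 1)) f) = (L.adRight d u ^ (k + 1)) (euler w f) +
      (k + 1 : ℝ) • L.adRight d (euler w u) ((L.adRight d u ^ k) f) := by
  induction k with
  | zero => simp [adRight_apply, euler_conv]
  | succ k ih =>
    rw [pow_succ', Module.End.mul_apply, adRight_apply, euler_conv, ih, ← adRight_apply,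
      ← adRight_apply, map_add, map_smul, ← Module.End.mul_apply (L.adRight d u) (_ ^ (k + 1)),
      ← pow_succ', ← Module.End.mul_apply (L.adRight d u) (L.adRight d (euler w u)), h.eq,
      Module.End.mul_apply (L.adRight d (euler w u)), ← Module.End.mul_apply _ (_ ^ k), ← pow_succ']
    push_cast
    module

variable [Fintype ι]

/-- The operator `e^{[·, u]} : f ↦ ∑ 1/k! [[…[f, u], …], u]`. It is only used for `u ∅ = 0`, where
`u` is nilpotent and the terms with `k` larger than the size of `ι` vanish. -/
noncomputable def expAd (u : Finset ι → H) : Module.End ℝ (Finset ι → H) :=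
  ∑ k ∈ range (Fintype.card ι + 1), (k.factorial : ℝ)⁻¹ • L.adRight d u ^ k

theorem adRight_pow_eq_zero {u : Finset ι → H} (hu : u ∅ = 0) {k : ℕ}
    (hk : Fintype.card ι < k) : L.adRight d u ^ k = 0 := by
  refine LinearMap.ext fun f => funext fun S => ?_
  rw [L.adRight_pow_vanishesBelow d hu k (vanishesBelow_zero f) S
    (by have := card_le_univ S; omega)]
  rfl

theorem expAd_apply_apply {u : Finset ι → H} (hu : u ∅ = 0) (f : Finset ι → H) {S : Finset ι}
    {N : ℕ} (hN : S.card ≤ N) : L.expAd d u f S =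
      ∑ k ∈ range (N + 1), (k.factorial : ℝ)⁻¹ • (L.adRight d u ^ k) f S := by
  have key : ∀ N, S.card ≤ N → ∑ k ∈ range (N + 1), (k.factorial : ℝ)⁻¹ • (L.adRight d u ^ k) f S =
      ∑ k ∈ range (S.card + 1), (k.factorial : ℝ)⁻¹ • (L.adRight d u ^ k) f S := by
    intro N hN
    refine (sum_subset (range_subset_range.2 (by omega)) fun k _ hk => ?_).symm
    rw [mem_range] at hk
    rw [L.adRight_pow_vanishesBelow d hu k (vanishesBelow_zero f) S (by omega), smul_zero]
  rw [key N hN, ← key (Fintype.card ι) (card_le_univ S)]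
  simp [expAd, LinearMap.sum_apply]

theorem expAd_empty {u : Finset ι → H} (hu : u ∅ = 0) (f : Finset ι → H) :
    L.expAd d u f ∅ = f ∅ := by
  rw [L.expAd_apply_apply d hu f (N := 0) (by simp)]
  simp

theorem expAd_homogeneous {i : ℤ} {u f : Finset ι → H} (hu : IsHomogeneous 𝓗 d 0 u)
    (hf : IsHomogeneous 𝓗 d i f) : IsHomogeneous 𝓗 d i (L.expAd d u f) := by
  intro S
  rw [expAd, LinearMap.sum_apply, Finset.sum_apply]
  exact Submodule.sum_mem _ fun k _ =>
    Submodule.smul_mem _ _ (L.adRight_pow_homogeneous d hu hf k S)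

theorem expAd_of_adRight_eq_zero {u f : Finset ι → H} (h : L.conv d 0 f u = 0) :
    L.expAd d u f = f := by
  rw [expAd, sum_range_succ', LinearMap.add_apply, LinearMap.sum_apply, sum_eq_zero]
  · simp
  · intro k _
    rw [LinearMap.smul_apply, pow_succ, Module.End.mul_apply, adRight_apply, h, map_zero,
      smul_zero]

theorem expAd_mul_expAd_neg {u : Finset ι → H} (hu : u ∅ = 0) (f : Finset ι → H) :
    L.expAd d u (L.expAd d (-u) f) = f := by
  have hneg : L.adRight d (-u) = (-1 : ℝ) • L.adRight d u := by
    rw [adRight, ← neg_one_smul ℝ u, map_smul]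
    rfl
  have hadd : L.adRight d u + (-1 : ℝ) • L.adRight d u = 0 := by module
  rw [← Module.End.mul_apply]
  suffices h : L.expAd d u * L.expAd d (-u) = 1 by rw [h]; rfl
  rw [expAd, expAd, hneg, sum_mul_sum, sum_range_product_eq_sum_antidiagonal]
  · rw [sum_range_succ', sum_eq_zero]
    · simp
    · intro k _
      have h := ((Commute.refl (L.adRight d u)).smul_right (-1 : ℝ)).add_pow' (k + 1)
      rw [hadd, zero_pow (Nat.succ_ne_zero k)] at h
      have h2 := congrArg (fun T => ((k + 1).factorial : ℝ)⁻¹ • T) h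
      simp only [smul_zero, smul_sum] at h2
      rw [h2]
      refine sum_congr rfl fun p hp => ?_
      rw [smul_mul_smul_comm, ← Nat.cast_smul_eq_nsmul ℝ, smul_smul]
      congr 1
      rw [HasAntidiagonal.mem_antidiagonal] at hp
      rw [← hp, inv_factorial_add_mul_choose]
  · intro i j hij
    rw [smul_mul_smul_comm, smul_pow, mul_smul_comm, ← pow_add, L.adRight_pow_eq_zero d hu hij,
      smul_zero, smul_zero]

theorem expAd_neg_mul_expAd {u : Finset ι → H} (hu : u ∅ = 0) (f : Finset ι → H) :
    L.expAd d (-u) (L.expAd d u f) = f := by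
  have h := L.expAd_mul_expAd_neg d (u := -u) (by simp [hu]) f
  rwa [neg_neg] at h

/-- The exponential of an inner derivation is an automorphism. -/
theorem expAd_conv {j : ℤ} {u g : Finset ι → H} (hu : IsHomogeneous 𝓗 d 0 u) (hu0 : u ∅ = 0)
    (hg : IsHomogeneous 𝓗 d j g) (f : Finset ι → H) :
    L.expAd d u (L.conv d j f g) = L.conv d j (L.expAd d u f) (L.expAd d u g) := by
  have h1 : L.conv d j (L.expAd d u f) (L.expAd d u g) =
      ∑ a ∈ range (Fintype.card ι + 1), ∑ b ∈ range (Fintype.card ι + 1),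
        ((a.factorial : ℝ)⁻¹ * (b.factorial : ℝ)⁻¹) •
          L.conv d j ((L.adRight d u ^ a) f) ((L.adRight d u ^ b) g) := by
    simp only [expAd, LinearMap.sum_apply, map_sum, LinearMap.smul_apply, map_smul, smul_smul,
      smul_sum]
    rw [sum_comm]
    simp only [mul_comm]
  rw [h1, sum_range_product_eq_sum_antidiagonal]
  · rw [expAd, LinearMap.sum_apply]
    refine sum_congr rfl fun k _ => ?_
    rw [LinearMap.smul_apply, L.adRight_pow_conv d hu hg, smul_sum]
    refine sum_congr rfl fun p hp => ?_
    rw [← Nat.cast_smul_eq_nsmul ℝ, smul_smul]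
    congr 1
    rw [HasAntidiagonal.mem_antidiagonal] at hp
    rw [← hp, inv_factorial_add_mul_choose]
  · intro a b hab
    ext S
    rw [Pi.smul_apply, L.conv_vanishesBelow d j (L.adRight_pow_vanishesBelow d hu0 a
      (vanishesBelow_zero f)) (L.adRight_pow_vanishesBelow d hu0 b (vanishesBelow_zero g)) S
      (by have := card_le_univ S; omega), smul_zero]
    rfl

/-- The derivative of the exponential of an inner derivation that commutes with its derivative. -/
theorem euler_expAd {w : ι → ℝ} {u : Finset ι → H} (hu : u ∅ = 0)
    (h : Commute (L.adRight d u) (L.adRight d (euler w u))) (f : Finset ι → H) :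
    euler w (L.expAd d u f) =
      L.expAd d u (euler w f) + L.conv d 0 (L.expAd d u f) (euler w u) := by
  set N := Fintype.card ι with hN
  have e1 : L.expAd d u (euler w f) = ∑ k ∈ range N,
      ((k + 1).factorial : ℝ)⁻¹ • (L.adRight d u ^ (k + 1)) (euler w f) + euler w f := by
    rw [expAd, sum_range_succ', LinearMap.add_apply, LinearMap.sum_apply]
    simp [hN]
  have e2 : L.conv d 0 (L.expAd d u f) (euler w u) = ∑ k ∈ range N,
      (k.factorial : ℝ)⁻¹ • L.adRight d (euler w u) ((L.adRight d u ^ k) f) := by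
    rw [← adRight_apply, expAd, LinearMap.sum_apply, map_sum, sum_range_succ, LinearMap.smul_apply,
      map_smul]
    have : L.adRight d (euler w u) ((L.adRight d u ^ N) f) = 0 := by
      ext S
      exact L.conv_vanishesBelow d 0 (L.adRight_pow_vanishesBelow d hu N (vanishesBelow_zero f))
        (vanishesBelow_one (euler_empty w u)) S (by have := card_le_univ S; omega)
    rw [← hN, this, smul_zero, add_zero]
    simp
  rw [e1, e2, expAd, sum_range_succ', LinearMap.add_apply, map_add, LinearMap.sum_apply, map_sum,
    add_right_comm, ← sum_add_distrib]
  congr 1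
  · refine sum_congr rfl fun k _ => ?_
    rw [LinearMap.smul_apply, map_smul, L.euler_adRight_pow d h, smul_add, smul_smul]
    congr 2
    rw [Nat.factorial_succ]
    push_cast
    field_simp
  · simp

end KoszulGradedLieAlgebra

/-! ### Differential equations in the V-algebra with graded commutative coefficients -/

namespace KoszulGradedLieAlgebra

variable {H : Type*} [AddCommGroup H] [Module ℝ H] {𝓗 : ℤ → Submodule ℝ H}
  (L : KoszulGradedLieAlgebra 𝓗) {ι : Type*} [LinearOrder ι] (d : ι → ℤ)

theorem conv_self {f : Finset ι → H} (hf : IsHomogeneous 𝓗 d 0 f) : L.conv d 0 f f = 0 := by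
  have h := L.conv_skew d hf hf
  rw [mul_zero, zpow_zero, one_smul, eq_neg_iff_add_eq_zero, ← two_smul ℝ] at h
  exact (smul_eq_zero.1 h).resolve_left two_ne_zero

theorem conv_single_empty (y : H) (f : Finset ι → H) :
    L.conv d 0 (Pi.single ∅ y) f = (L.br y).compLeft (Finset ι) f := by
  ext S
  rw [conv_zero_apply, sum_eq_single ∅]
  · simp
  · intro A _ hA
    simp [Pi.single_eq_of_ne hA]
  · simp

theorem conv_compLeft_of_comm {Ehat : H →ₗ[ℝ] H} (hE : L.IsDerivation 1 Ehat)
    {u v : Finset ι → H} (hu : IsHomogeneous 𝓗 d 0 u) (hv : IsHomogeneous 𝓗 d 0 v) :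
    Ehat.compLeft (Finset ι) (L.conv d 0 v u) =
      L.conv d 0 (Ehat.compLeft (Finset ι) v) u - L.conv d 0 (Ehat.compLeft (Finset ι) u) v := by
  have hEu : IsHomogeneous 𝓗 d 1 (Ehat.compLeft (Finset ι) u) := by
    have := hu.compLeft hE.degree
    rwa [zero_add] at this
  rw [L.derivation_conv d hE 0 hv, zpow_zero, one_smul, zero_add, L.conv_skew d hv hEu, zero_mul,
    zpow_zero, one_smul, sub_eq_add_neg]

variable [Fintype ι]

theorem expAd_apply_of_forall_ssubset {u f : Finset ι → H} (hu : u ∅ = 0) {S : Finset ι}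
    (hf : ∀ A, A ⊂ S → f A = 0) : L.expAd d u f S = f S := by
  have key : ∀ k, (∀ A, A ⊂ S → (L.adRight d u ^ k) f A = 0) ∧
      (L.adRight d u ^ (k + 1)) f S = 0 := by
    intro k
    induction k with
    | zero => exact ⟨by simpa using hf, L.conv_eq_zero_of_left d 0 (by simpa using hf) hu⟩
    | succ k ih =>
      have h : ∀ A, A ⊂ S → (L.adRight d u ^ (k + 1)) f A = 0 := by
        intro A hA
        rw [pow_succ', Module.End.mul_apply, adRight_apply]
        exact L.conv_eq_zero_of_left d 0 (fun B hB => ih.1 B (hB.trans hA)) hu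
      refine ⟨h, ?_⟩
      rw [pow_succ', Module.End.mul_apply, adRight_apply]
      exact L.conv_eq_zero_of_left d 0 h hu
  rw [L.expAd_apply_apply d hu f le_rfl, sum_range_succ', sum_eq_zero]
  · simp
  · intro k _
    rw [(key k).2, smul_zero]

/-- As `u` has no constant term and `f` has none either, the coefficient of `e^{[·, u]} f` at `S`
depends only on the coefficients of `u` at proper subsets of `S`. -/
theorem expAd_apply_congr {u v f : Finset ι → H} (hu : u ∅ = 0) (hv : v ∅ = 0) (hf : f ∅ = 0)
    {S : Finset ι} (h : ∀ A, A ⊂ S → u A = v A) : L.expAd d u f S = L.expAd d v f S := by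
  have key : ∀ k, ∀ B, B ⊆ S → (L.adRight d u ^ k) f B = (L.adRight d v ^ k) f B := by
    intro k
    induction k with
    | zero => simp
    | succ k ih =>
      intro B hB
      rw [pow_succ', Module.End.mul_apply, adRight_apply, pow_succ', Module.End.mul_apply,
        adRight_apply, conv_zero_apply, conv_zero_apply]
      refine sum_congr rfl fun A hA => ?_
      rw [mem_powerset] at hA
      rw [ih A (hA.trans hB)]
      rcases A.eq_empty_or_nonempty with rfl | hne
      · rw [L.adRight_pow_vanishesBelow d hv k (vanishesBelow_one hf) ∅ (by simp)]
        simp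
      · rw [h (B \ A) ((sdiff_ssubset hA hne).trans_subset hB)]
  rw [L.expAd_apply_apply d hu f le_rfl, L.expAd_apply_apply d hv f le_rfl]
  exact sum_congr rfl fun k _ => by rw [key k S subset_rfl]

end KoszulGradedLieAlgebra

namespace VAlgebra

open KoszulGradedLieAlgebra

variable {H : Type*} [AddCommGroup H] [Module ℝ H] {𝓗 : ℤ → Submodule ℝ H} (A : VAlgebra 𝓗)

/-- The projection onto `a`, as an endomorphism. -/
def projEnd : H →ₗ[ℝ] H := A.a.subtype ∘ₗ A.proj

theorem projEnd_apply (x : H) : A.projEnd x = A.proj x := rfl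

theorem projEnd_eq_zero {x : H} : A.projEnd x = 0 ↔ A.proj x = 0 := by
  simp [projEnd_apply]

/-- The automorphism `ψ` of the graded Lie algebra and its inverse preserve the kernel of the
projection. -/
structure PreservesKernel (ψ : H ≃ₗ[ℝ] H) : Prop where
  aut : A.IsAutomorphism ψ
  ker : ∀ z, A.proj z = 0 → A.proj (ψ z) = 0
  ker_symm : ∀ z, A.proj z = 0 → A.proj (ψ.symm z) = 0

section Families

variable {ι : Type*}

/-- The projection onto `a`, applied to all coefficients. -/
def pr : (Finset ι → H) →ₗ[ℝ] (Finset ι → H) := A.projEnd.compLeft (Finset ι)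

theorem pr_apply (f : Finset ι → H) (S : Finset ι) : A.pr f S = A.proj (f S) := rfl

@[simp] theorem pr_pr (f : Finset ι → H) : A.pr (A.pr f) = A.pr f := by
  ext S
  simp [pr_apply, A.proj_coe]

theorem pr_coe (f : Finset ι → A.a) : A.pr (fun S => (f S : H)) = fun S => (f S : H) := by
  ext S
  simp [pr_apply, A.proj_coe]

theorem euler_pr (w : ι → ℝ) (f : Finset ι → H) : euler w (A.pr f) = A.pr (euler w f) :=
  euler_compLeft _ _ _

theorem pr_homogeneous {d : ι → ℤ} {i : ℤ} {f : Finset ι → H} (hf : IsHomogeneous 𝓗 d i f) :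
    IsHomogeneous 𝓗 d i (A.pr f) := fun S => A.proj_mem _ _ (hf S)

variable {A} in
theorem PreservesKernel.homogeneous {ψ : H ≃ₗ[ℝ] H} (hψ : A.PreservesKernel ψ) {d : ι → ℤ}
    {i : ℤ} {z : Finset ι → H}
    (hz : IsHomogeneous 𝓗 d i z) : IsHomogeneous 𝓗 d i (ψ.toLinearMap.compLeft (Finset ι) z) :=
  fun S => hψ.aut.degree _ _ (hz S)

end Families

variable {ι : Type*} [LinearOrder ι] (d : ι → ℤ)

theorem pr_conv (j : ℤ) (f g : Finset ι → H) :
    A.pr (A.conv d j f g) = A.pr (A.conv d j (A.pr f) g) + A.pr (A.conv d j f (A.pr g)) := by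
  ext S
  simp only [pr_apply, conv_apply, map_sum, map_smul, Pi.add_apply, ← Submodule.coe_add,
    ← sum_add_distrib]
  congr 1
  refine sum_congr rfl fun B _ => ?_
  rw [A.proj_br, smul_add]

theorem conv_eq_zero_of_pr (j : ℤ) {f g : Finset ι → H} (hf : A.pr f = f) (hg : A.pr g = g) :
    A.conv d j f g = 0 := by
  ext S
  rw [← hf, ← hg, conv_apply]
  exact sum_eq_zero fun B _ => by rw [pr_apply, pr_apply, A.abelian, smul_zero]

variable [Fintype ι]

/-- The element `u` of `a` with graded commutative coefficients is the image of `X = ∑ x_i ⊗ θ_i`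
under the transport along `ψ`: it solves the differential equation `D u = Π e^{[·, u]} ψ X`, where
`D` is the Euler derivation, and has no constant term. -/
structure IsTransported (ψ : H ≃ₗ[ℝ] H) (X u : Finset ι → H) : Prop where
  hom_source : IsHomogeneous 𝓗 d 0 X
  pr_source : A.pr X = X
  euler_source : euler (fun _ => 1) X = X
  hom : IsHomogeneous 𝓗 d 0 u
  pr_eq : A.pr u = u
  empty : u ∅ = 0
  ode : euler (fun _ => 1) u = A.pr (A.expAd d u (ψ.toLinearMap.compLeft (Finset ι) X))

/-- The operator `e^{[·, u]} ∘ ψ ∘ e^{-[·, X]}`, an automorphism of the graded Lie algebra with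
graded commutative coefficients. -/
noncomputable def gauge (ψ : H ≃ₗ[ℝ] H) (X u : Finset ι → H) (z : Finset ι → H) :
    Finset ι → H :=
  A.expAd d u (ψ.toLinearMap.compLeft (Finset ι) (A.expAd d (-X) z))

theorem gauge_add (ψ : H ≃ₗ[ℝ] H) (X u y z : Finset ι → H) :
    A.gauge d ψ X u (y + z) = A.gauge d ψ X u y + A.gauge d ψ X u z := by
  simp only [gauge, map_add]

theorem gauge_sub (ψ : H ≃ₗ[ℝ] H) (X u y z : Finset ι → H) :
    A.gauge d ψ X u (y - z) = A.gauge d ψ X u y - A.gauge d ψ X u z := by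
  simp only [gauge, map_sub]

theorem gauge_smul (ψ : H ≃ₗ[ℝ] H) (X u : Finset ι → H) (c : ℝ) (z : Finset ι → H) :
    A.gauge d ψ X u (c • z) = c • A.gauge d ψ X u z := by
  simp only [gauge, map_smul]

theorem gauge_sum {κ : Type*} (ψ : H ≃ₗ[ℝ] H) (X u : Finset ι → H) (s : Finset κ)
    (z : κ → Finset ι → H) :
    A.gauge d ψ X u (∑ k ∈ s, z k) = ∑ k ∈ s, A.gauge d ψ X u (z k) := by
  simp only [gauge, map_sum]

variable {A d} {ψ : H ≃ₗ[ℝ] H} {X u : Finset ι → H}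

namespace IsTransported

theorem source_empty (T : A.IsTransported d ψ X u) : X ∅ = 0 := by
  rw [← T.euler_source, euler_empty]

theorem gauge_hom (T : A.IsTransported d ψ X u) (hψ : A.PreservesKernel ψ) {i : ℤ}
    {z : Finset ι → H} (hz : IsHomogeneous 𝓗 d i z) :
    IsHomogeneous 𝓗 d i (A.gauge d ψ X u z) :=
  A.expAd_homogeneous d T.hom (hψ.homogeneous (A.expAd_homogeneous d T.hom_source.neg hz))

theorem gauge_conv (T : A.IsTransported d ψ X u) (hψ : A.PreservesKernel ψ) {j : ℤ}
    (y : Finset ι → H) {z : Finset ι → H} (hz : IsHomogeneous 𝓗 d j z) :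
    A.gauge d ψ X u (A.conv d j y z) = A.conv d j (A.gauge d ψ X u y) (A.gauge d ψ X u z) := by
  have hz' := A.expAd_homogeneous d T.hom_source.neg hz
  rw [gauge, A.expAd_conv d T.hom_source.neg (by simp [T.source_empty]) hz,
    A.compLeft_conv d hψ.aut.map_br, A.expAd_conv d T.hom T.empty (hψ.homogeneous hz')]
  rfl

/-- The leading term of the gauge operator is `ψ`. -/
theorem gauge_apply_of_forall_ssubset (T : A.IsTransported d ψ X u) {z : Finset ι → H}
    {S : Finset ι} (hz : ∀ B, B ⊂ S → z B = 0) : A.gauge d ψ X u z S = ψ (z S) := by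
  have h : ∀ B, B ⊆ S → A.expAd d (-X) z B = z B := fun B hB =>
    A.expAd_apply_of_forall_ssubset d (by simp [T.source_empty])
      fun C hC => hz C (hC.trans_subset hB)
  rw [gauge, A.expAd_apply_of_forall_ssubset d T.empty]
  · simp [h S subset_rfl]
  · intro B hB
    simp [h B hB.subset, hz B hB]

theorem gauge_source (T : A.IsTransported d ψ X u) :
    A.gauge d ψ X u X = A.expAd d u (ψ.toLinearMap.compLeft (Finset ι) X) := by
  rw [gauge, A.expAd_of_adRight_eq_zero d (f := X)]
  rw [map_neg, A.conv_self d T.hom_source, neg_zero]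

theorem gauge_of_pr (T : A.IsTransported d ψ X u) {z : Finset ι → H} (hz : A.pr z = z) :
    A.gauge d ψ X u z = A.expAd d u (ψ.toLinearMap.compLeft (Finset ι) z) := by
  rw [gauge, A.expAd_of_adRight_eq_zero d (f := z)]
  rw [map_neg, A.conv_eq_zero_of_pr d 0 hz T.pr_source, neg_zero]

theorem euler_eq (T : A.IsTransported d ψ X u) :
    euler (fun _ => 1) u = A.pr (A.gauge d ψ X u X) := by
  rw [T.gauge_source, T.ode]

theorem pr_euler (T : A.IsTransported d ψ X u) (w : ι → ℝ) : A.pr (euler w u) = euler w u := by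
  rw [← A.euler_pr, T.pr_eq]

theorem commute_euler (T : A.IsTransported d ψ X u) (w : ι → ℝ) :
    Commute (A.adRight d u) (A.adRight d (euler w u)) :=
  A.adRight_commute d T.hom (T.hom.euler w)
    (A.conv_eq_zero_of_pr d 0 T.pr_eq (T.pr_euler w))

/-- The logarithmic derivative of the gauge operator `G` is the right multiplication by
`Π G X - G X`, an element of the kernel of the projection. -/
theorem euler_gauge (T : A.IsTransported d ψ X u) (hψ : A.PreservesKernel ψ) (z : Finset ι → H) :
    euler (fun _ => 1) (A.gauge d ψ X u z) = A.gauge d ψ X u (euler (fun _ => 1) z) -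
      A.conv d 0 (A.gauge d ψ X u z) (A.gauge d ψ X u X - A.pr (A.gauge d ψ X u X)) := by
  have hX : euler (fun _ => 1) (-X) = -X := by rw [map_neg, T.euler_source]
  have hc : Commute (A.adRight d (-X)) (A.adRight d (euler (fun _ => 1) (-X))) := by rw [hX]
  rw [← T.euler_eq, gauge, A.euler_expAd d T.empty (T.commute_euler _), euler_compLeft,
    A.euler_expAd d (by simp [T.source_empty]) hc, hX, map_add, map_add, map_neg, map_neg, map_neg,
    A.compLeft_conv d hψ.aut.map_br, A.expAd_conv d T.hom T.empty (hψ.homogeneous T.hom_source),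
    T.gauge_source, map_sub]
  simp only [gauge]
  abel

theorem euler_gauge_source (T : A.IsTransported d ψ X u) (hψ : A.PreservesKernel ψ) :
    euler (fun _ => 1) (A.gauge d ψ X u X) = A.gauge d ψ X u X +
      A.conv d 0 (A.gauge d ψ X u X) (euler (fun _ => 1) u) := by
  rw [T.euler_gauge hψ, T.euler_source, map_sub, A.conv_self d (T.gauge_hom hψ T.hom_source),
    T.euler_eq, zero_sub, sub_neg_eq_add]

/-- The gauge operator preserves the kernel of the projection: its logarithmic derivative takes
values there. -/
theorem pr_gauge_eq_zero (T : A.IsTransported d ψ X u) (hψ : A.PreservesKernel ψ)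
    {z : Finset ι → H} (hz : A.pr z = 0) : A.pr (A.gauge d ψ X u z) = 0 := by
  -- It suffices to consider monomials `z = y ⊗ θ_B`, which are eigenvectors of the Euler
  -- derivation.
  have hsingle : ∀ (B : Finset ι) (y : H), A.proj y = 0 →
      A.pr (A.gauge d ψ X u (Pi.single B y)) = 0 := by
    intro B y hy
    set ρ := A.pr (A.gauge d ψ X u (Pi.single B y)) with hρ
    set κ := A.gauge d ψ X u X - A.pr (A.gauge d ψ X u X) with hκ
    have hκ0 : A.pr κ = 0 := by rw [hκ, map_sub, A.pr_pr, sub_self]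
    have hκe : κ ∅ = 0 := by
      have h1 : A.gauge d ψ X u X ∅ = 0 := by
        rw [T.gauge_apply_of_forall_ssubset (fun B hB => absurd hB (not_ssubset_empty B)),
          T.source_empty, map_zero]
      rw [hκ, Pi.sub_apply, pr_apply, h1]
      simp
    have hD : euler (fun _ => 1) (Pi.single B y : Finset ι → H) = (B.card : ℝ) • Pi.single B y := by
      ext S
      rw [euler_one_apply, Pi.smul_apply]
      by_cases h : S = B
      · rw [h]
      · simp [Pi.single_eq_of_ne h]
    -- Because `κ` is in the kernel, only `ρ = Π G z` contributes to the projection of `[G z, κ]`.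
    have hode : euler (fun _ => 1) ρ = (B.card : ℝ) • ρ - A.pr (A.conv d 0 ρ κ) := by
      rw [hρ, A.euler_pr, T.euler_gauge hψ, hD, A.gauge_smul, map_sub, map_smul,
        A.pr_conv d 0 _ (A.gauge d ψ X u X - _), ← hκ, hκ0, map_zero, map_zero, add_zero]
    refine eq_zero_of_forall_ssubset fun S hS => ?_
    have h1 := congrFun hode S
    rw [euler_one_apply, Pi.sub_apply, Pi.smul_apply, A.pr_apply,
      A.conv_eq_zero_of_left d 0 hS hκe, map_zero, ZeroMemClass.coe_zero, sub_zero,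
      ← sub_eq_zero, ← sub_smul, smul_eq_zero] at h1
    rcases h1 with hc | hc
    · -- In degree `|B|` the equation is void, and `G z` is given by its leading term `ψ y`.
      have hc' : S.card = B.card := by exact_mod_cast sub_eq_zero.1 hc
      rw [hρ, pr_apply, T.gauge_apply_of_forall_ssubset]
      · by_cases h : S = B
        · rw [h, Pi.single_eq_same, hψ.ker y hy, ZeroMemClass.coe_zero]
        · rw [Pi.single_eq_of_ne h, map_zero, map_zero, ZeroMemClass.coe_zero]
      · intro C hC
        refine Pi.single_eq_of_ne ?_ _
        rintro rfl
        exact (card_lt_card hC).ne hc'.symm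
    · exact hc
  have hsum : z = ∑ B : Finset ι, Pi.single B (z B) := (univ_sum_single z).symm
  rw [hsum, A.gauge_sum, map_sum]
  exact sum_eq_zero fun B _ => hsingle B _ (A.projEnd_eq_zero.1 (congrFun hz B))

theorem pr_gauge_pr (T : A.IsTransported d ψ X u) (hψ : A.PreservesKernel ψ)
    (z : Finset ι → H) : A.pr (A.gauge d ψ X u (A.pr z)) = A.pr (A.gauge d ψ X u z) := by
  have h := T.pr_gauge_eq_zero hψ (z := z - A.pr z) (by rw [map_sub, A.pr_pr, sub_self])
  rw [A.gauge_sub, map_sub, sub_eq_zero] at h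
  exact h.symm

theorem pr_eq_zero_of_gauge (T : A.IsTransported d ψ X u) (hψ : A.PreservesKernel ψ)
    {z : Finset ι → H} (hz : A.pr (A.gauge d ψ X u z) = 0) : A.pr z = 0 := by
  rw [← T.pr_gauge_pr hψ] at hz
  refine eq_zero_of_forall_ssubset fun S hS => ?_
  have h := congrFun hz S
  rw [pr_apply, T.gauge_apply_of_forall_ssubset hS] at h
  have h2 := hψ.ker_symm _ (A.projEnd_eq_zero.1 h)
  rw [LinearEquiv.symm_apply_apply] at h2
  have h3 := congrFun (A.pr_pr z) S
  rw [← h3, pr_apply, h2]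
  rfl

/-- The recursion, which is a differential equation in the radial direction, holds in every
direction. -/
theorem euler_weight (T : A.IsTransported d ψ X u) (hψ : A.PreservesKernel ψ) (w : ι → ℝ) :
    euler w u = A.pr (A.expAd d u (ψ.toLinearMap.compLeft (Finset ι) (euler w X))) := by
  have hXw : IsHomogeneous 𝓗 d 0 (euler w X) := T.hom_source.euler w
  have hprX : A.pr (euler w X) = euler w X := by rw [← A.euler_pr, T.pr_source]
  have hDXw : euler (fun _ => 1) (euler w X) = euler w X := by rw [euler_comm, T.euler_source]
  rw [← T.gauge_of_pr hprX]
  set g := A.gauge d ψ X u X with hg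
  set gw := A.gauge d ψ X u (euler w X) with hgw
  have hghom : IsHomogeneous 𝓗 d 0 g := T.gauge_hom hψ T.hom_source
  have hgwhom : IsHomogeneous 𝓗 d 0 gw := T.gauge_hom hψ hXw
  have hg0 : g ∅ = 0 := by
    rw [hg, T.gauge_apply_of_forall_ssubset (fun B hB => absurd hB (not_ssubset_empty B)),
      T.source_empty, map_zero]
  have hgw0 : gw ∅ = 0 := by
    rw [hgw, T.gauge_apply_of_forall_ssubset (fun B hB => absurd hB (not_ssubset_empty B)),
      euler_empty, map_zero]
  -- The elements `X` and `D_w X` of `a` commute, hence so do their images under the gauge operator.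
  have hcomm : A.conv d 0 gw g = 0 := by
    rw [hg, hgw, ← T.gauge_conv hψ _ T.hom_source,
      A.conv_eq_zero_of_pr d 0 hprX T.pr_source]
    simp [gauge]
  have hwg : euler w g = gw + A.conv d 0 g (euler w u) := by
    rw [hg, T.gauge_source, A.euler_expAd d T.empty (T.commute_euler w), euler_compLeft, hgw,
      T.gauge_of_pr hprX]
  have hDgw : euler (fun _ => 1) gw = gw + A.conv d 0 gw (A.pr g) := by
    rw [hgw, T.euler_gauge hψ, hDXw, ← hgw, ← hg, map_sub, hcomm, zero_sub, sub_neg_eq_add]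
  -- The difference of both sides solves a homogeneous linear equation without constant term.
  have hv : euler (fun _ => 1) (euler w u - A.pr gw) =
      A.pr (A.conv d 0 g (euler w u - A.pr gw)) := by
    have h1 : A.pr (A.conv d 0 gw (A.pr g)) = A.pr (A.conv d 0 g (A.pr gw)) := by
      have h2 := A.pr_conv d 0 gw g
      rw [hcomm, map_zero, A.conv_skew d (A.pr_homogeneous hgwhom) hghom, mul_zero, zpow_zero,
        one_smul, map_neg, neg_add_eq_sub] at h2
      exact sub_eq_zero.1 h2.symm
    rw [map_sub, euler_comm, T.euler_eq, A.euler_pr, A.euler_pr, ← hg, hwg, hDgw, map_add, map_add,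
      h1, map_sub, map_sub]
    abel
  refine sub_eq_zero.1 (eq_zero_of_euler_one ?_ fun S hS => ?_)
  · rw [Pi.sub_apply, euler_empty, pr_apply, hgw0]
    simp
  · rw [hv, pr_apply, A.conv_eq_zero_of_right d 0 hS hg0, map_zero, ZeroMemClass.coe_zero]

/-- The derivative of the transported element in the direction of the derived brackets of
`Ehat + [P, ·]` is given by the derived brackets of the conjugate element. Here `p` and `p'` are the
series of brackets `P + [E X] + 1/2 [E X, X] + ⋯` before the projection to `a`, characterized by
their differential equations and their constant terms. -/
theorem pr_expAd_pr (T : A.IsTransported d ψ X u) (hψ : A.PreservesKernel ψ)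
    {Ehat Ehat' : H →ₗ[ℝ] H} (hE' : A.IsDerivation 1 Ehat')
    (hψE : ∀ z, Ehat' (ψ z) = ψ (Ehat z))
    (hadapted : ∀ z, A.proj (Ehat' (A.proj z : H)) = A.proj (Ehat' z)) {p p' : Finset ι → H}
    (hp : euler (fun _ => 1) p = Ehat.compLeft (Finset ι) X + A.conv d 0 p X)
    (hp' : euler (fun _ => 1) p' = Ehat'.compLeft (Finset ι) (euler (fun _ => 1) u) +
      A.conv d 0 p' (euler (fun _ => 1) u))
    (hpp' : p' ∅ = ψ (p ∅)) :
    A.pr (A.expAd d u (ψ.toLinearMap.compLeft (Finset ι) (A.pr p))) = A.pr p' := by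
  rw [← T.gauge_of_pr (A.pr_pr p), T.pr_gauge_pr hψ]
  set g := A.gauge d ψ X u X with hg
  set h := A.gauge d ψ X u (Ehat.compLeft (Finset ι) X) with hh
  set v := A.gauge d ψ X u p - p' with hv
  set D : (Finset ι → H) →ₗ[ℝ] (Finset ι → H) := euler (fun _ => 1) with hD
  set F := Ehat'.compLeft (Finset ι) with hF
  have hghom : IsHomogeneous 𝓗 d 0 g := T.gauge_hom hψ T.hom_source
  have hDuhom : IsHomogeneous 𝓗 d 0 (D u) := T.hom.euler _
  have hempty : ∀ z : Finset ι → H, A.gauge d ψ X u z ∅ = ψ (z ∅) := fun z =>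
    T.gauge_apply_of_forall_ssubset fun B hB => absurd hB (not_ssubset_empty B)
  have hDg : D g = g + A.conv d 0 g (D u) := T.euler_gauge_source hψ
  have hDv : D v = h - F (D u) + A.conv d 0 v (D u) := by
    rw [hv, map_sub, hp', hD, T.euler_gauge hψ, ← hD, hp, A.gauge_add,
      T.gauge_conv hψ _ T.hom_source,
      ← hg, ← hh, map_sub, map_sub, hD, ← T.euler_eq, LinearMap.sub_apply]
    abel
  have hDh : D h = h - A.conv d 0 h g + A.conv d 0 h (D u) := by
    rw [hh, hD, T.euler_gauge hψ, euler_compLeft, T.euler_source, map_sub, ← T.euler_eq]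
    abel
  have hFg : D (F g) = F g + A.conv d 0 (F g) (D u) - A.conv d 0 (F (D u)) g := by
    rw [hF, hD, euler_compLeft, ← hD, hDg, map_add,
      A.conv_compLeft_of_comm d hE' hDuhom hghom]
    abel
  have hDvg : D (A.conv d 0 v g) = A.conv d 0 (h - F (D u)) g + A.conv d 0 v g +
      A.conv d 0 (A.conv d 0 v g) (D u) := by
    have h1 := A.conv_jacobi d v hghom hDuhom
    rw [mul_zero, zpow_zero, one_smul, add_zero] at h1
    rw [h1, hD, euler_conv, ← hD, hDv, hDg, map_add, map_add, LinearMap.add_apply]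
    abel
  -- The difference `v` of the two lifted brackets measures the failure of the gauge operator to
  -- intertwine `Ehat` with `Ehat'` on `X`.
  have key : h = F g - A.conv d 0 v g := by
    set a := h - F g + A.conv d 0 v g with ha
    have hDa : D a = a + A.conv d 0 a (D u) := by
      rw [ha, map_add, map_sub, hDh, hFg, hDvg]
      simp only [map_add, map_sub, LinearMap.add_apply, LinearMap.sub_apply]
      abel
    have ha0 : a = 0 := by
      refine eq_zero_of_forall_ssubset fun S hS => ?_
      have h1 := congrFun hDa S
      rw [hD, euler_one_apply, Pi.add_apply,
        A.conv_eq_zero_of_left d 0 hS (euler_empty _ u), add_zero, ← sub_eq_zero] at h1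
      have h2 : ((S.card : ℝ) - 1) • a S = 0 := by rw [sub_smul, one_smul, h1]
      rcases smul_eq_zero.1 h2 with hc | hc
      · -- On singletons the equation is void, and both sides are computed directly.
        have hc' : S.card = 1 := by exact_mod_cast sub_eq_zero.1 hc
        have hsub : ∀ B, B ⊂ S → B = ∅ := fun B hB => by
          have := card_lt_card hB
          exact card_eq_zero.1 (by omega)
        have hg0 : g ∅ = 0 := by rw [hg, hempty, T.source_empty, map_zero]
        have hv0 : v ∅ = 0 := by rw [hv, Pi.sub_apply, hempty, hpp', sub_self]
        rw [ha, Pi.add_apply, Pi.sub_apply, A.conv_vanishesBelow d 0 (vanishesBelow_one hv0)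
          (vanishesBelow_one hg0) S (by omega), hh, hF, hg, T.gauge_apply_of_forall_ssubset,
          LinearMap.compLeft_apply, LinearMap.compLeft_apply, Function.comp_apply,
          Function.comp_apply, T.gauge_apply_of_forall_ssubset, hψE]
        · simp
        · intro B hB
          rw [hsub B hB, T.source_empty]
        · intro B hB
          simp [hsub B hB, T.source_empty]
      · exact hc
    rw [ha] at ha0
    rw [← sub_eq_zero, ← ha0]
    abel
  -- Adaptedness of `Ehat'` removes the inhomogeneous terms from the equation for `Π v`.
  have hDpv : D (A.pr v) = -A.pr (A.conv d 0 (A.pr v) g) := by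
    have h1 : A.pr (F (D u)) = A.pr (F g) := by
      rw [hD, T.euler_eq]
      ext S
      exact congrArg Subtype.val (hadapted _)
    rw [hD, A.euler_pr, ← hD, hDv, key, map_add, map_sub, map_sub, h1, A.pr_conv d 0 v g, hD,
      T.euler_eq]
    abel
  have hzero : A.pr v = 0 := by
    refine eq_zero_of_euler_one ?_ fun S hS => ?_
    · rw [pr_apply, hv, Pi.sub_apply, hempty, hpp', sub_self]
      simp
    · rw [← hD, hDpv, Pi.neg_apply, pr_apply, A.conv_eq_zero_of_left d 0 hS]
      · simp
      · rw [hg, hempty, T.source_empty, map_zero]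
  rwa [hv, map_sub, sub_eq_zero] at hzero

/-- The transport along the inverse automorphism is inverse to the transport: applied to `u`, the
former is the unique solution of a differential equation that `X` solves as well. -/
theorem eq_source_of_ode (T : A.IsTransported d ψ X u) (hψ : A.PreservesKernel ψ)
    {W : Finset ι → H} (hW0 : W ∅ = 0)
    (hW : euler (fun _ => 1) W = A.pr (A.expAd d W
      (ψ.symm.toLinearMap.compLeft (Finset ι) (euler (fun _ => 1) u)))) : W = X := by
  set f := ψ.symm.toLinearMap.compLeft (Finset ι) (euler (fun _ => 1) u) with hf
  -- The gauge operator carries `e^{[·, X]} ψ⁻¹ D u` to `D u`, and `D u = Π G X` by the equation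
  -- for `u`.
  have hX : A.pr (A.expAd d X f) = X := by
    have h1 : A.gauge d ψ X u (A.expAd d X f) = A.pr (A.gauge d ψ X u X) := by
      have h2 : ψ.toLinearMap.compLeft (Finset ι) f = euler (fun _ => 1) u := by
        ext S
        simp [hf]
      rw [gauge, A.expAd_neg_mul_expAd d T.source_empty, h2, A.expAd_of_adRight_eq_zero,
        T.euler_eq]
      exact A.conv_eq_zero_of_pr d 0 (T.pr_euler _) T.pr_eq
    have h3 := T.pr_eq_zero_of_gauge hψ (z := A.expAd d X f - X)
      (by rw [A.gauge_sub, map_sub, h1, A.pr_pr, sub_self])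
    rw [map_sub, T.pr_source, sub_eq_zero] at h3
    exact h3
  rw [← sub_eq_zero]
  refine eq_zero_of_euler_one (by simp [hW0, T.source_empty]) fun S hS => ?_
  have h4 : A.expAd d W f S = A.expAd d X f S := by
    refine A.expAd_apply_congr d hW0 T.source_empty (by simp [hf]) fun B hB => ?_
    exact sub_eq_zero.1 (hS B hB)
  rw [map_sub, hW, T.euler_source, Pi.sub_apply, pr_apply, h4, ← pr_apply, hX, sub_self]

end IsTransported

/-! ### Maurer–Cartan elements with graded commutative coefficients -/

section MaurerCartan

variable {H : Type*} [AddCommGroup H] [Module ℝ H] {𝓗 : ℤ → Submodule ℝ H} {A : VAlgebra 𝓗}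
  {ι : Type*} [LinearOrder ι] {d : ι → ℤ} {Ehat : H →ₗ[ℝ] H}

/-- The square of `E = Ehat + [P, ·]` is `Ehat² + [Ehat P + ½[P, P], ·]`. -/
theorem square_apply (hE : A.IsDerivation 1 Ehat) {P : H} (hP : P ∈ 𝓗 1) (z : H) :
    ((Ehat + A.br P) ∘ₗ (Ehat + A.br P)) z =
      Ehat (Ehat z) + A.br (Ehat P + (2 : ℝ)⁻¹ • A.br P P) z := by
  have h1 := hE.leibniz 1 P z hP
  have h2 := A.jacobi 1 1 P P z hP hP
  simp only [mul_one, zpow_one] at h1 h2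
  simp only [LinearMap.comp_apply, LinearMap.add_apply, map_add, map_smul, LinearMap.smul_apply, h1]
  have h3 : A.br (A.br P P) z = (2 : ℝ) • A.br P (A.br P z) := by
    rw [neg_one_smul] at h2
    rw [two_smul]
    nth_rewrite 1 [h2]
    abel
  rw [h3]
  module

/-- The generating function of the Jacobiators. With the lifted brackets `p` and the curvature
`Ω = Ehat P + ½[P, P]`, the equation `E ∘ E = 0` makes `Ehat p + ½[p, p]` the constant `Ω`, and the
V-algebra identity identifies its projection with the sum below. -/
theorem pr_square_apply_eq_zero {P : H} (hE : A.IsAdaptedMaurerCartan Ehat P)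
    {X p : Finset ι → H} (hX : IsHomogeneous 𝓗 d 0 X) (hDX : euler (fun _ => 1) X = X)
    (hp : IsHomogeneous 𝓗 d 1 p) (hp0 : p ∅ = P)
    (hDp : euler (fun _ => 1) p = Ehat.compLeft (Finset ι) X + A.conv d 0 p X) {S : Finset ι}
    (hS : S.Nonempty) :
    A.pr (Ehat.compLeft (Finset ι) (A.pr p) + A.conv d 1 p (A.pr p)) S = 0 := by
  set F := Ehat.compLeft (Finset ι) with hF
  set r := F p + (2 : ℝ)⁻¹ • A.conv d 1 p p with hr
  set Ω := Ehat P + (2 : ℝ)⁻¹ • A.br P P with hΩ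
  have hFX : IsHomogeneous 𝓗 d 1 (F X) := by
    have := hX.compLeft (φ := Ehat) (k := 1) hE.derivation.degree
    rwa [zero_add] at this
  have hr0 : r ∅ = Ω := by simp [hr, hF, hp0, hΩ]
  have hpX : IsHomogeneous 𝓗 d 1 (A.conv d 0 p X) := A.conv_mem d hp hX
  have hDr : euler (fun _ => 1) r = A.conv d 0 (r - Pi.single ∅ Ω) X := by
    have h1 : F (F X) = -A.conv d 0 (Pi.single ∅ Ω) X := by
      rw [A.conv_single_empty, eq_neg_iff_add_eq_zero]
      ext S
      have h := square_apply hE.derivation hE.degree (X S)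
      rw [hE.square] at h
      exact h.symm
    have h2 : F (A.conv d 0 p X) = A.conv d 0 (F p) X - A.conv d 1 p (F X) := by
      rw [hF, A.derivation_conv d hE.derivation 0 hp, zpow_one, neg_one_smul, zero_add,
        sub_eq_add_neg]
    have h3 : A.conv d 1 (F X) p = A.conv d 1 p (F X) := by
      rw [A.conv_skew d hFX hp, mul_one, zpow_one, neg_one_smul, neg_neg]
    have h4 : A.conv d 1 (A.conv d 0 p X) p = A.conv d 1 p (A.conv d 0 p X) := by
      rw [A.conv_skew d hpX hp, mul_one, zpow_one, neg_one_smul, neg_neg]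
    have h5 : A.conv d 0 (A.conv d 1 p p) X = (2 : ℝ) • A.conv d 1 p (A.conv d 0 p X) := by
      rw [A.conv_jacobi d p hp hX, mul_zero, zpow_zero, one_smul, h4, two_smul, add_zero]
    rw [hr, map_add, map_smul, hF, euler_compLeft, euler_conv, hDp, ← hF, map_add, map_add, map_add,
      LinearMap.add_apply, h1, h2, h3, h4, map_sub, map_add, map_smul, LinearMap.sub_apply,
      LinearMap.add_apply, LinearMap.smul_apply, h5]
    module
  have hrΩ : r - Pi.single ∅ Ω = 0 := by
    refine eq_zero_of_euler_one (by simp [hr0]) fun B hB => ?_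
    have h1 : euler (fun _ => 1) (Pi.single ∅ Ω : Finset ι → H) = 0 := by
      ext C
      rw [euler_one_apply]
      by_cases h : C = ∅
      · simp [h]
      · simp [Pi.single_eq_of_ne h]
    rw [map_sub, h1, sub_zero, hDr, A.conv_eq_zero_of_left d 0 hB]
    rw [← hDX, euler_empty]
  have hpr : A.pr r = A.pr (F (A.pr p) + A.conv d 1 p (A.pr p)) := by
    have h1 : A.pr (F (A.pr p)) = A.pr (F p) := by
      ext S
      exact congrArg Subtype.val (hE.adapted _)
    rw [hr, map_add, map_add, map_smul, A.pr_conv d 1 p p,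
      A.conv_skew d (A.pr_homogeneous hp) hp, h1, mul_one, zpow_one, neg_one_smul, neg_neg]
    module
  rw [← hpr, sub_eq_zero.1 hrΩ, pr_apply, Pi.single_eq_of_ne hS.ne_empty, map_zero]
  rfl

/-- As `a` is abelian, the bracket `[E v, u]` is symmetric in the elements `u, v` of degree `0`. -/
theorem conv_compLeft_comm (hE : A.IsDerivation 1 Ehat) {P : H} {u v : Finset ι → H}
    (hu : IsHomogeneous 𝓗 d 0 u) (hv : IsHomogeneous 𝓗 d 0 v) (hpu : A.pr u = u)
    (hpv : A.pr v = v) :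
    A.conv d 0 ((Ehat + A.br P).compLeft (Finset ι) v) u =
      A.conv d 0 ((Ehat + A.br P).compLeft (Finset ι) u) v := by
  have h0 : A.conv d 0 v u = 0 := A.conv_eq_zero_of_pr d 0 hpv hpu
  have h1 := A.conv_compLeft_of_comm d hE hu hv
  have h2 := A.conv_jacobi d (Pi.single ∅ P) hv hu
  rw [h0, map_zero] at h1
  rw [h0, map_zero, mul_zero, zpow_zero, one_smul, zero_add] at h2
  have h3 : ∀ w : Finset ι → H, (Ehat + A.br P).compLeft (Finset ι) w =
      Ehat.compLeft (Finset ι) w + A.conv d 0 (Pi.single ∅ P) w := fun w => by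
    rw [A.conv_single_empty]
    rfl
  rw [h3, h3, map_add, map_add, LinearMap.add_apply, LinearMap.add_apply, h2, sub_eq_zero.1 h1.symm]

variable (A d)

/-- The series `P + ∑ 1/(k+1)! [[…[E u, u], …], u]` with `E = Ehat + [P, ·]`, the iterated bracket
containing `k + 1` copies of `u`. -/
noncomputable def derivedSeries [Fintype ι] (Ehat : H →ₗ[ℝ] H) (P : H) (u : Finset ι → H) :
    Finset ι → H :=
  Pi.single ∅ P + ∑ k ∈ range (Fintype.card ι + 1), ((k + 1).factorial : ℝ)⁻¹ •
    (A.adRight d u ^ k) ((Ehat + A.br P).compLeft (Finset ι) u)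

variable {A d}

/-- The series of derived brackets solves the differential equation `D p = Ehat (D u) + [p, D u]`.
-/
theorem euler_derivedSeries [Fintype ι] (hE : A.IsDerivation 1 Ehat) (P : H) {u : Finset ι → H}
    (hu : IsHomogeneous 𝓗 d 0 u) (hpu : A.pr u = u) (hu0 : u ∅ = 0) :
    euler (fun _ => 1) (A.derivedSeries d Ehat P u) =
      Ehat.compLeft (Finset ι) (euler (fun _ => 1) u) +
        A.conv d 0 (A.derivedSeries d Ehat P u) (euler (fun _ => 1) u) := by
  set D : (Finset ι → H) →ₗ[ℝ] (Finset ι → H) := euler (fun _ => 1) with hD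
  set E := (Ehat + A.br P).compLeft (Finset ι) with hEdef
  set N := Fintype.card ι with hN
  have hpD : A.pr (D u) = D u := by rw [hD, ← A.euler_pr, hpu]
  have hcomm : Commute (A.adRight d u) (A.adRight d (D u)) :=
    A.adRight_commute d hu (hu.euler _) (A.conv_eq_zero_of_pr d 0 hpu hpD)
  have hsucc : ∀ k : ℕ, (A.adRight d u ^ (k + 1)) (E (D u)) =
      A.conv d 0 ((A.adRight d u ^ k) (E u)) (D u) := by
    intro k
    rw [pow_succ, Module.End.mul_apply, adRight_apply,
      conv_compLeft_comm hE hu (hu.euler _) hpu hpD, ← adRight_apply, ← Module.End.mul_apply,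
      (hcomm.pow_left k).eq]
    rfl
  have hpow : ∀ k : ℕ,
      D ((A.adRight d u ^ k) (E u)) = (k + 1 : ℝ) • (A.adRight d u ^ k) (E (D u)) := by
    intro k
    cases k with
    | zero => simp [hD, hEdef, euler_compLeft]
    | succ k =>
      rw [hD, A.euler_adRight_pow d hcomm, ← hD, hEdef, euler_compLeft, ← hEdef, ← hD,
        adRight_apply, ← hsucc]
      push_cast
      module
  have hDP : D (Pi.single ∅ P) = 0 := by
    ext C
    rw [hD, euler_one_apply]
    by_cases h : C = ∅
    · simp [h]
    · simp [Pi.single_eq_of_ne h]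
  have hlast : A.conv d 0 ((A.adRight d u ^ N) (E u)) (D u) = 0 := by
    rw [← hsucc, A.adRight_pow_eq_zero d hu0 (by omega)]
    rfl
  have hEu : E (D u) = Ehat.compLeft (Finset ι) (D u) + A.conv d 0 (Pi.single ∅ P) (D u) := by
    rw [A.conv_single_empty]
    rfl
  have hleft : D (A.derivedSeries d Ehat P u) = E (D u) + ∑ k ∈ range N,
      ((k + 1).factorial : ℝ)⁻¹ • A.conv d 0 ((A.adRight d u ^ k) (E u)) (D u) := by
    rw [derivedSeries, map_add, hDP, zero_add, map_sum, sum_range_succ', add_comm]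
    congr 1
    · rw [map_smul, hpow]
      simp
    · refine sum_congr rfl fun k _ => ?_
      rw [map_smul, hpow, hsucc, smul_smul, Nat.factorial_succ (k + 1)]
      congr 1
      push_cast
      field_simp
  rw [hleft, derivedSeries, map_add, LinearMap.add_apply, map_sum, LinearMap.sum_apply,
    sum_range_succ, ← hN, ← hEdef, map_smul, LinearMap.smul_apply, hlast, smul_zero, add_zero, hEu,
    add_assoc]
  congr 2
  exact sum_congr rfl fun k _ => by rw [map_smul, LinearMap.smul_apply]

theorem derivedSeries_empty [Fintype ι] (P : H) {u : Finset ι → H} (hu0 : u ∅ = 0) :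
    A.derivedSeries d Ehat P u ∅ = P := by
  rw [derivedSeries, Pi.add_apply, Pi.single_eq_same, Finset.sum_apply, sum_eq_zero, add_zero]
  intro k _
  rw [Pi.smul_apply, A.adRight_pow_vanishesBelow d hu0 k (m := 1) (vanishesBelow_one (by
    simp [hu0])) ∅ (by simp), smul_zero]

end MaurerCartan

end VAlgebra

/-! ### Words and ordered partitions -/

section Words

variable {ι : Type*} [LinearOrder ι] (d : ι → ℤ)

/-- The Koszul sign that sorts the word `q`. -/
noncomputable def wordSign {n : ℕ} (q : Fin n → ι) : ℝ :=
  ∏ i, ∏ j, if i < j then pairSign d (q i) (q j) else 1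

theorem wordSign_mul_self {n : ℕ} (q : Fin n → ι) : wordSign d q * wordSign d q = 1 := by
  simp only [wordSign, ← prod_mul_distrib]
  refine prod_eq_one fun i _ => prod_eq_one fun j _ => ?_
  split_ifs
  · exact pairSign_mul_self d _ _
  · simp

theorem wordSign_comp_strictMono {n : ℕ} {κ : Type*} [LinearOrder κ] {e : κ → ι}
    (he : StrictMono e) (q : Fin n → κ) : wordSign d (e ∘ q) = wordSign (d ∘ e) q := by
  simp only [wordSign, pairSign, Function.comp_apply, he.lt_iff_lt]

theorem koszulSign_eq_wordSign {n : ℕ} (d : Fin n → ℤ) (σ : Equiv.Perm (Fin n)) :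
    koszulSign d σ = wordSign d σ := by
  simp only [koszulSign, wordSign, pairSign, ite_and]

variable {V W : Type*}

/-- The value of the family `f` at the entries of `x` with index in `S`, in increasing order. -/
def evalOn (f : ∀ n : ℕ, (Fin n → V) → W) (x : ι → V) (S : Finset ι) : W :=
  f S.card fun i => x (S.orderEmbOfFin rfl i)

theorem evalOn_eq_of_strictMono (f : ∀ n : ℕ, (Fin n → V) → W) (x : ι → V) {S : Finset ι} {n : ℕ}
    (hS : S.card = n) {g : Fin n → ι} (hg : StrictMono g) (hgS : ∀ i, g i ∈ S) :
    f n (fun i => x (g i)) = evalOn f x S := by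
  subst hS
  rw [orderEmbOfFin_unique rfl hgS hg]
  rfl

theorem cons_eq_of_strictMono (f : ∀ n : ℕ, (Fin n → V) → W) (y : V) (x : ι → V) {S : Finset ι}
    {n : ℕ} (hS : S.card = n) {g : Fin n → ι} (hg : StrictMono g) (hgS : ∀ i, g i ∈ S) :
    f (n + 1) (Fin.cons y fun i => x (g i)) =
      f (S.card + 1) (Fin.cons y fun i => x (S.orderEmbOfFin rfl i)) := by
  subst hS
  rw [orderEmbOfFin_unique rfl hgS hg]

theorem evalOn_univ (f : ∀ n : ℕ, (Fin n → V) → W) {n : ℕ} (x : Fin n → V) :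
    evalOn f x univ = f n x :=
  (evalOn_eq_of_strictMono f x (by simp) strictMono_id fun i => mem_univ i).symm

theorem evalOn_empty (f : ∀ n : ℕ, (Fin n → V) → W) (x : ι → V) :
    evalOn f x ∅ = f 0 Fin.elim0 :=
  (evalOn_eq_of_strictMono f x card_empty (g := Fin.elim0) (fun i => i.elim0)
    fun i => i.elim0).symm.trans (congrArg _ (funext fun i => i.elim0))

theorem evalOn_singleton (f : ∀ n : ℕ, (Fin n → V) → W) (x : ι → V) (i : ι) :
    evalOn f x {i} = f 1 fun _ => x i :=
  (evalOn_eq_of_strictMono f x (card_singleton i) (g := fun _ => i)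
    (fun a b hab => absurd hab (by simp [Subsingleton.elim a b]))
    fun _ => mem_singleton_self i).symm

theorem evalOn_map (f : ∀ n : ℕ, (Fin n → V) → W) {κ : Type*} [LinearOrder κ] (e : κ ↪o ι)
    (x : ι → V) (S : Finset κ) :
    evalOn f x (S.map e.toEmbedding) = evalOn f (x ∘ e) S :=
  (evalOn_eq_of_strictMono f x (card_map _)
    (e.strictMono.comp (S.orderEmbOfFin rfl).strictMono)
    fun i => mem_map_of_mem _ (S.orderEmbOfFin_mem rfl i)).symm

section Symmetric

variable [AddCommGroup V] [Module ℝ V] [AddCommGroup W] [Module ℝ W] {d}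
  {𝓥 : ℤ → Submodule ℝ V} {𝓦 : ℤ → Submodule ℝ W} {k : ℤ} {f : ∀ n : ℕ, (Fin n → V) → W}

/-- The value of a graded symmetric family on a word without repetitions. -/
theorem IsGradedSymmetricFamily.apply_word (hf : IsGradedSymmetricFamily 𝓥 𝓦 k f) {x : ι → V}
    (hx : ∀ i, x i ∈ 𝓥 (d i)) {n : ℕ} {q : Fin n → ι} (hq : Function.Injective q) {S : Finset ι}
    (hS : S.card = n) (hqS : ∀ i, q i ∈ S) :
    f n (fun i => x (q i)) = wordSign d q • evalOn f x S := by
  let τ₀ : Fin n → Fin n := fun i => (S.orderIsoOfFin hS).symm ⟨q i, hqS i⟩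
  have hτ₀ : ∀ i, S.orderEmbOfFin hS (τ₀ i) = q i := fun i => by
    rw [← coe_orderIsoOfFin_apply, OrderIso.apply_symm_apply]
  have hinj : Function.Injective τ₀ := fun i j h => hq (by rw [← hτ₀ i, ← hτ₀ j, h])
  let τ : Equiv.Perm (Fin n) := Equiv.ofBijective τ₀ (Finite.injective_iff_bijective.1 hinj)
  have hτ : ∀ i, S.orderEmbOfFin hS (τ i) = q i := hτ₀
  have h := hf.symm n (fun i => d (S.orderEmbOfFin hS i)) (fun i => x (S.orderEmbOfFin hS i))
    (fun i => hx _) τ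
  have hsign : koszulSign (fun i => d (S.orderEmbOfFin hS i)) τ = wordSign d q := by
    rw [koszulSign_eq_wordSign]
    have := wordSign_comp_strictMono d (S.orderEmbOfFin hS).strictMono τ
    rw [show (S.orderEmbOfFin hS) ∘ τ = q from funext hτ] at this
    exact this.symm
  have hx' : (fun i => x (S.orderEmbOfFin hS i)) ∘ τ = fun i => x (q i) :=
    funext fun i => congrArg x (hτ i)
  rw [evalOn_eq_of_strictMono f x hS (S.orderEmbOfFin hS).strictMono
    (S.orderEmbOfFin_mem hS), hsign, hx'] at h
  rw [h, smul_smul, wordSign_mul_self, one_smul]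

theorem IsGradedSymmetricFamily.evalOn_mem (hf : IsGradedSymmetricFamily 𝓥 𝓦 k f) {x : ι → V}
    (hx : ∀ i, x i ∈ 𝓥 (d i)) (S : Finset ι) : evalOn f x S ∈ 𝓦 (degSum d S + k) := by
  have h := hf.degree S.card (fun i => d (S.orderEmbOfFin rfl i))
    (fun i => x (S.orderEmbOfFin rfl i)) fun i => hx _
  have hsum : ∑ i, d (S.orderEmbOfFin rfl i) = degSum d S := by
    rw [degSum, ← sum_coe_sort S d, ← (S.orderIsoOfFin rfl).toEquiv.sum_comp]
    rfl
  rwa [hsum] at h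

end Symmetric

end Words

section OrderedPartitions

variable {ι : Type*} [LinearOrder ι] (d : ι → ℤ)

/-- The ordered partitions of `S` into `k` blocks, possibly empty. -/
def orderedPartitions [Fintype ι] (k : ℕ) (S : Finset ι) : Finset (Fin k → Finset ι) :=
  univ.filter fun B => (∀ i j, i ≠ j → Disjoint (B i) (B j)) ∧ univ.biUnion B = S

theorem mem_orderedPartitions [Fintype ι] {k : ℕ} {S : Finset ι} {B : Fin k → Finset ι} :
    B ∈ orderedPartitions k S ↔
      (∀ i j, i ≠ j → Disjoint (B i) (B j)) ∧ univ.biUnion B = S := by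
  simp [orderedPartitions]

/-- The Koszul sign that sorts the concatenation of the increasing words in the blocks of `B`. -/
noncomputable def partitionSign {k : ℕ} (B : Fin k → Finset ι) : ℝ :=
  ∏ i, ∏ j, if i < j then blockSign d (B i) (B j) else 1

theorem partitionSign_snoc {k : ℕ} {B : Fin k → Finset ι}
    (hB : ∀ i j, i ≠ j → Disjoint (B i) (B j)) (C : Finset ι) :
    partitionSign d (Fin.snoc B C : Fin (k + 1) → Finset ι) =
      partitionSign d B * blockSign d (univ.biUnion B) C := by
  have h : blockSign d (univ.biUnion B) C = ∏ i, blockSign d (B i) C :=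
    prod_biUnion fun i _ j _ hij => hB i j hij
  rw [partitionSign, Fin.prod_univ_castSucc, h, partitionSign, ← prod_mul_distrib]
  rw [prod_eq_one (s := univ) (f := fun j : Fin (k + 1) => if Fin.last k < j then
    blockSign d (Fin.snoc (α := fun _ => Finset ι) B C (Fin.last k))
      (Fin.snoc (α := fun _ => Finset ι) B C j) else 1), mul_one]
  · refine prod_congr rfl fun i _ => ?_
    rw [Fin.prod_univ_castSucc]
    simp [Fin.castSucc_lt_castSucc_iff]
  · intro j _
    rw [if_neg (Fin.le_last j).not_gt]

theorem sum_orderedPartitions_zero [Fintype ι] {M : Type*} [AddCommMonoid M] (S : Finset ι)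
    (Φ : (Fin 0 → Finset ι) → M) :
    ∑ B ∈ orderedPartitions 0 S, Φ B = if S = ∅ then Φ Fin.elim0 else 0 := by
  split_ifs with h
  · rw [sum_eq_single Fin.elim0]
    · intro B _ hB
      exact absurd (Subsingleton.elim _ _) hB
    · intro hB
      exact absurd (mem_orderedPartitions.2 ⟨fun i => i.elim0, by simp [h]⟩) hB
  · refine sum_eq_zero fun B hB => absurd ?_ h
    have := (mem_orderedPartitions.1 hB).2
    simpa using this.symm

/-- Sums over ordered partitions by their last block. -/
theorem sum_orderedPartitions_succ [Fintype ι] {M : Type*} [AddCommMonoid M] {k : ℕ} (S : Finset ι)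
    (Φ : (Fin (k + 1) → Finset ι) → M) :
    ∑ B ∈ orderedPartitions (k + 1) S, Φ B =
      ∑ A ∈ S.powerset, ∑ B ∈ orderedPartitions k A, Φ (Fin.snoc B (S \ A)) := by
  have hsnoc : ∀ B ∈ orderedPartitions (k + 1) S,
      Fin.snoc (fun i : Fin k => B i.castSucc)
        (S \ univ.biUnion fun i : Fin k => B i.castSucc) = B := by
    intro B hB
    rw [mem_orderedPartitions] at hB
    have hlast : S \ univ.biUnion (fun i : Fin k => B i.castSucc) = B (Fin.last k) := by
      rw [← hB.2]
      ext a
      simp only [mem_sdiff, mem_biUnion, mem_univ, true_and, Fin.exists_fin_succ']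
      constructor
      · rintro ⟨h | h, h'⟩
        · exact absurd h h'
        · exact h
      · refine fun h => ⟨Or.inr h, ?_⟩
        rintro ⟨i, hi⟩
        exact disjoint_left.1 (hB.1 _ _ (Fin.castSucc_lt_last i).ne) hi h
    funext i
    refine Fin.lastCases ?_ (fun i => ?_) i
    · simp [hlast]
    · simp
  rw [sum_sigma']
  refine sum_bij' (fun B _ => (⟨univ.biUnion (fun i : Fin k => B i.castSucc),
      fun i => B i.castSucc⟩ : Σ _ : Finset ι, (Fin k → Finset ι)))
    (fun x _ => Fin.snoc x.2 (S \ x.1)) ?_ ?_ ?_ ?_ ?_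
  · intro B hB
    rw [mem_orderedPartitions] at hB
    simp only [mem_sigma, mem_powerset, mem_orderedPartitions, and_true]
    refine ⟨?_, fun i j hij => hB.1 _ _ (by simpa using hij)⟩
    rw [← hB.2]
    exact biUnion_subset.2 fun i _ => subset_biUnion_of_mem B (mem_univ _)
  · rintro ⟨A, B⟩ h
    simp only [mem_sigma, mem_powerset, mem_orderedPartitions] at h ⊢
    obtain ⟨hA, hB, rfl⟩ := h
    have hBi : ∀ i, B i ⊆ univ.biUnion B := fun i => subset_biUnion_of_mem B (mem_univ i)
    refine ⟨?_, ?_⟩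
    · intro i j
      refine Fin.lastCases ?_ (fun i => ?_) i <;> refine Fin.lastCases ?_ (fun j => ?_) j
      · simp
      · intro _
        simpa using (disjoint_sdiff.mono_left (hBi j)).symm
      · intro _
        simpa using disjoint_sdiff.mono_left (hBi i)
      · intro hij
        simpa using hB i j (by simpa using hij)
    · ext a
      simp only [mem_biUnion, mem_univ, true_and, Fin.exists_fin_succ', Fin.snoc_castSucc,
        Fin.snoc_last, mem_sdiff]
      constructor
      · rintro (⟨i, hi⟩ | h)
        · exact hA (hBi i hi)
        · exact h.1
      · intro ha
        by_cases h : ∃ i, a ∈ B i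
        · exact Or.inl h
        · exact Or.inr ⟨ha, h⟩
  · exact hsnoc
  · rintro ⟨A, B⟩ h
    simp only [mem_sigma, mem_powerset, mem_orderedPartitions] at h ⊢
    simp [h.2.2]
  · exact fun B hB => congrArg Φ (hsnoc B hB).symm

end OrderedPartitions

namespace VAlgebra

variable {H : Type*} [AddCommGroup H] [Module ℝ H] {𝓗 : ℤ → Submodule ℝ H} (A : VAlgebra 𝓗)
  {ι : Type*} [LinearOrder ι] [Fintype ι] (d : ι → ℤ)

theorem nested_succ_last (k : ℕ) (y : H) (x : Fin (k + 1) → H) :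
    A.nested (k + 1) y x = A.br (A.nested k y fun i => x i.castSucc) (x (Fin.last k)) := by
  induction k generalizing y with
  | zero => rfl
  | succ k ih =>
    rw [nested, ih]
    rfl

/-- The iterated bracket `[[…[f, u], …], u]` as a sum over ordered partitions, the first block
belonging to `f`. -/
theorem adRight_pow_apply (u f : Finset ι → H) (k : ℕ) (S : Finset ι) :
    (A.adRight d u ^ k) f S = ∑ B ∈ orderedPartitions (k + 1) S,
      partitionSign d B • A.nested k (f (B 0)) fun j => u (B j.succ) := by
  induction k generalizing S with
  | zero =>
    rw [sum_orderedPartitions_succ, sum_eq_single ∅]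
    · rw [sum_orderedPartitions_zero, if_pos rfl, partitionSign_snoc d (fun i => i.elim0)]
      simp [nested, partitionSign, Fin.snoc]
    · intro C _ hC
      rw [sum_orderedPartitions_zero, if_neg hC]
    · simp
  | succ k ih =>
    rw [pow_succ', Module.End.mul_apply, KoszulGradedLieAlgebra.adRight_apply,
      KoszulGradedLieAlgebra.conv_zero_apply, sum_orderedPartitions_succ]
    refine sum_congr rfl fun C _ => ?_
    rw [ih, map_sum, LinearMap.sum_apply, smul_sum]
    refine sum_congr rfl fun B hB => ?_
    rw [mem_orderedPartitions] at hB
    rw [partitionSign_snoc d hB.1, hB.2, nested_succ_last, map_smul, LinearMap.smul_apply,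
      smul_smul, mul_comm]
    have h0 : (Fin.snoc B (S \ C) : Fin (k + 2) → Finset ι) 0 = B 0 :=
      Fin.snoc_castSucc (α := fun _ => Finset ι) (S \ C) B 0
    have h1 : ∀ j : Fin k, (Fin.snoc B (S \ C) : Fin (k + 2) → Finset ι) j.castSucc.succ =
        B j.succ := fun j => Fin.snoc_castSucc (α := fun _ => Finset ι) (S \ C) B j.succ
    have h2 : (Fin.snoc B (S \ C) : Fin (k + 2) → Finset ι) (Fin.last k).succ = S \ C :=
      Fin.snoc_last (α := fun _ => Finset ι) (S \ C) B
    simp only [h0, h1, h2]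

/-- For a constant `y` the iterated bracket `[[…[y, u], …], u]` has no block for `y`. -/
theorem adRight_pow_single_apply (u : Finset ι → H) (y : H) (k : ℕ) (S : Finset ι) :
    (A.adRight d u ^ k) (Pi.single ∅ y) S = ∑ B ∈ orderedPartitions k S,
      partitionSign d B • A.nested k y fun j => u (B j) := by
  induction k generalizing S with
  | zero =>
    rw [sum_orderedPartitions_zero, pow_zero, Module.End.one_apply]
    split_ifs with h
    · simp [h, partitionSign, nested]
    · exact Pi.single_eq_of_ne h _
  | succ k ih =>
    rw [pow_succ', Module.End.mul_apply, KoszulGradedLieAlgebra.adRight_apply,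
      KoszulGradedLieAlgebra.conv_zero_apply, sum_orderedPartitions_succ]
    refine sum_congr rfl fun C _ => ?_
    rw [ih, map_sum, LinearMap.sum_apply, smul_sum]
    refine sum_congr rfl fun B hB => ?_
    rw [mem_orderedPartitions] at hB
    rw [partitionSign_snoc d hB.1, hB.2, nested_succ_last, map_smul, LinearMap.smul_apply,
      smul_smul, mul_comm]
    simp

end VAlgebra

/-! ### Sums over compositions and permutations as sums over ordered partitions -/

section Compositions

namespace Composition

variable {n : ℕ} (c : Composition n)

theorem embedding_lt_embedding {a b : Fin c.length} (h : a < b) (s : Fin (c.blocksFun a))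
    (t : Fin (c.blocksFun b)) : c.embedding a s < c.embedding b t := by
  rw [Fin.lt_def, coe_embedding, coe_embedding]
  have h1 := c.sizeUpTo_succ' a
  have h2 : c.sizeUpTo (a + 1) ≤ c.sizeUpTo b := c.monotone_sizeUpTo h
  have := s.2
  omega

/-- The ordered partition of `{1, …, n}` into the images under `σ` of the blocks of `c`. -/
def permBlocks (σ : Equiv.Perm (Fin n)) (j : Fin c.length) : Finset (Fin n) :=
  univ.image fun i => σ (c.embedding j i)

theorem injective_perm_embedding (σ : Equiv.Perm (Fin n)) (j : Fin c.length) :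
    Function.Injective fun i => σ (c.embedding j i) :=
  σ.injective.comp (c.embedding j).injective

theorem mem_permBlocks {σ : Equiv.Perm (Fin n)} {j : Fin c.length} {a : Fin n} :
    a ∈ c.permBlocks σ j ↔ c.index (σ.symm a) = j := by
  simp only [permBlocks, mem_image, mem_univ, true_and]
  constructor
  · rintro ⟨i, rfl⟩
    simp
  · rintro rfl
    exact ⟨c.invEmbedding (σ.symm a), by simp [c.embedding_comp_inv]⟩

theorem card_permBlocks (σ : Equiv.Perm (Fin n)) (j : Fin c.length) :
    (c.permBlocks σ j).card = c.blocksFun j := by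
  rw [permBlocks, card_image_of_injective _ (c.injective_perm_embedding σ j),
    card_univ, Fintype.card_fin]

theorem permBlocks_mem_orderedPartitions (σ : Equiv.Perm (Fin n)) :
    c.permBlocks σ ∈ orderedPartitions c.length univ := by
  rw [mem_orderedPartitions]
  refine ⟨fun i j hij => disjoint_left.2 fun a hi hj => hij ?_, ?_⟩
  · rw [← c.mem_permBlocks.1 hi, c.mem_permBlocks.1 hj]
  · ext a
    simp [mem_permBlocks]

/-- Every ordered partition into blocks of the prescribed sizes arises from `∏ cⱼ!`
permutations. -/
theorem card_permBlocks_eq {B : Fin c.length → Finset (Fin n)}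
    (hB : B ∈ orderedPartitions c.length univ) (hcard : ∀ j, (B j).card = c.blocksFun j) :
    (univ.filter fun σ => c.permBlocks σ = B).card = ∏ j, (c.blocksFun j).factorial := by
  rw [mem_orderedPartitions] at hB
  have hex : ∀ a, ∃ j, a ∈ B j := fun a => by
    have : a ∈ univ.biUnion B := hB.2 ▸ mem_univ a
    simpa using this
  choose b hb using hex
  have hbB : ∀ a j, a ∈ B j ↔ b a = j := fun a j =>
    ⟨fun h => by_contra fun hne => disjoint_left.1 (hB.1 _ _ hne) (hb a) h, fun h => h ▸ hb a⟩
  have hfib : ∀ j, Fintype.card {a // c.index a = j} = c.blocksFun j := fun j => by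
    rw [Fintype.card_subtype, ← c.card_permBlocks (Equiv.refl _) j]
    congr 1
    ext a
    simp [mem_permBlocks]
  have hfib' : ∀ j, Fintype.card {a // b a = j} = c.blocksFun j := fun j => by
    rw [Fintype.card_subtype, ← hcard]
    congr 1
    ext a
    simp [hbB]
  -- The permutations in question form a coset of the stabilizer of the block structure of `c`.
  let σ₀ : Equiv.Perm (Fin n) := Equiv.ofFiberEquiv (f := c.index) (g := b) fun j =>
    Fintype.equivOfCardEq ((hfib j).trans (hfib' j).symm)
  have hσ₀ : ∀ a, b (σ₀ a) = c.index a := Equiv.ofFiberEquiv_map _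
  have hiff : ∀ σ, c.permBlocks σ = B ↔ ∀ a, b (σ a) = c.index a := fun σ => by
    constructor
    · intro h a
      rw [← hbB, ← h, mem_permBlocks, Equiv.symm_apply_apply]
    · intro h
      funext j
      ext a
      rw [mem_permBlocks, hbB, ← h, Equiv.apply_symm_apply]
  have hstab := DomMulAct.stabilizer_card (f := c.index)
  simp only [hfib] at hstab
  rw [← hstab, Fintype.card_subtype]
  refine card_bij' (fun σ _ => σ₀⁻¹ * σ) (fun τ _ => σ₀ * τ) ?_ ?_ (by simp) (by simp)
  · intro σ hσ
    rw [mem_filter, hiff] at hσ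
    refine mem_filter.2 ⟨mem_univ _, funext fun a => ?_⟩
    rw [Function.comp_apply, ← hσ₀, Equiv.Perm.mul_apply, ← Equiv.Perm.mul_apply,
      mul_inv_cancel, Equiv.Perm.one_apply, hσ.2]
  · intro τ hτ
    rw [mem_filter] at hτ
    rw [mem_filter, hiff]
    refine ⟨mem_univ _, fun a => ?_⟩
    rw [Equiv.Perm.mul_apply, hσ₀]
    exact congrFun hτ.2 a

/-- The Koszul sign of `σ` sorts each of the words `σ` restricted to a block, and then the blocks.
-/
theorem koszulSign_eq (d : Fin n → ℤ) (σ : Equiv.Perm (Fin n)) :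
    koszulSign d σ = (∏ j, wordSign d fun i => σ (c.embedding j i)) *
      partitionSign d (c.permBlocks σ) := by
  have hblock : ∀ a b, a ≠ b → blockSign d (c.permBlocks σ a) (c.permBlocks σ b) =
      ∏ s, ∏ t, pairSign d (σ (c.embedding a s)) (σ (c.embedding b t)) := fun a b _ => by
    rw [blockSign, permBlocks, prod_image (c.injective_perm_embedding σ a).injOn]
    refine prod_congr rfl fun s _ => ?_
    rw [permBlocks, prod_image (c.injective_perm_embedding σ b).injOn]
  rw [koszulSign_eq_wordSign, wordSign, ← c.blocksFinEquiv.prod_comp, Fintype.prod_sigma,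
    partitionSign, ← prod_mul_distrib]
  refine prod_congr rfl fun a _ => ?_
  have hswap : ∀ s : Fin (c.blocksFun a),
      (∏ j, if c.blocksFinEquiv ⟨a, s⟩ < j then
        pairSign d (σ (c.blocksFinEquiv ⟨a, s⟩)) (σ j) else 1) =
      ∏ b, ∏ t, if c.embedding a s < c.embedding b t then
        pairSign d (σ (c.embedding a s)) (σ (c.embedding b t)) else 1 := fun s => by
    rw [← c.blocksFinEquiv.prod_comp, Fintype.prod_sigma]
    rfl
  simp only [hswap]
  rw [prod_comm, ← mul_prod_erase univ _ (mem_univ a),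
    ← mul_prod_erase univ (fun b => if a < b then _ else _) (mem_univ a), if_neg (lt_irrefl a),
    one_mul]
  congr 1
  · simp [wordSign]
  · refine prod_congr rfl fun b hb => ?_
    have hab : a ≠ b := (ne_of_mem_erase hb).symm
    split_ifs with h
    · rw [hblock a b hab]
      simp [c.embedding_lt_embedding h]
    · refine prod_eq_one fun s _ => prod_eq_one fun t _ => if_neg ?_
      exact (c.embedding_lt_embedding (lt_of_le_of_ne (not_lt.1 h) hab.symm) t s).not_gt

end Composition

/-- Ordered partitions into nonempty blocks, sorted by the sizes of their blocks. -/
theorem sum_composition_orderedPartitions {M : Type*} [AddCommMonoid M] {n : ℕ}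
    (Φ : ∀ k, (Fin k → Finset (Fin n)) → M)
    (hΦ : ∀ k B, (∃ j, B j = ∅) → Φ k B = 0) :
    ∑ c : Composition n, ∑ B ∈ (orderedPartitions c.length univ).filter
        (fun B => ∀ j, (B j).card = c.blocksFun j), Φ c.length B =
      ∑ k ∈ range (n + 1), ∑ B ∈ orderedPartitions k univ, Φ k B := by
  rw [sum_sigma', sum_sigma']
  refine sum_bij_ne_zero (fun p _ _ => (⟨p.1.length, p.2⟩ : Σ k, Fin k → Finset (Fin n)))
    ?_ ?_ ?_ (fun _ _ _ => rfl)
  · rintro ⟨c, B⟩ h _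
    simp only [mem_sigma, mem_univ, true_and, mem_filter, mem_range] at h ⊢
    exact ⟨Nat.lt_succ_of_le c.length_le, h.1⟩
  · rintro ⟨c, B⟩ h _ ⟨c', B'⟩ h' _ heq
    simp only [mem_sigma, mem_univ, true_and, mem_filter] at h h'
    let F : (Σ k, Fin k → Finset (Fin n)) → List ℕ := fun p => List.ofFn fun j => (p.2 j).card
    have h1 : F ⟨c.length, B⟩ = c.blocks := by
      simp only [F, h.2, c.ofFn_blocksFun]
    have h2 : F ⟨c'.length, B'⟩ = c'.blocks := by
      simp only [F, h'.2, c'.ofFn_blocksFun]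
    have hcc : c = c' := Composition.ext (by rw [← h1, ← h2]; exact congrArg F heq)
    subst hcc
    simpa using heq
  · rintro ⟨k, B⟩ h hne
    simp only [mem_sigma, mem_range] at h
    have hB := mem_orderedPartitions.1 h.2
    have hpos : ∀ j, 0 < (B j).card := fun j =>
      card_pos.2 (nonempty_iff_ne_empty.2 fun h0 => hne (hΦ k B ⟨j, h0⟩))
    have hsum : ∑ j, (B j).card = n := by
      rw [← card_biUnion fun i _ j _ hij => hB.1 i j hij, hB.2, card_univ, Fintype.card_fin]
    obtain ⟨c, hc⟩ : ∃ c : Composition n, c.blocks = List.ofFn fun j => (B j).card :=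
      ⟨⟨List.ofFn fun j => (B j).card, fun {i} hi => by
        obtain ⟨j, rfl⟩ := (List.mem_ofFn' _ _).1 hi
        exact hpos j, by rw [List.sum_ofFn, hsum]⟩, rfl⟩
    have hlen : c.length = k := by
      rw [← c.blocks_length, hc, List.length_ofFn]
    subst hlen
    have hblocks : ∀ j, (B j).card = c.blocksFun j := by
      rw [← c.ofFn_blocksFun] at hc
      exact fun j => (congrFun (List.ofFn_injective hc) j).symm
    exact ⟨⟨c, B⟩, by simp [h.2, hblocks], hne, rfl⟩

variable {V W X : Type*} [AddCommGroup V] [Module ℝ V] [AddCommGroup W] [Module ℝ W]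
  [AddCommGroup X] [Module ℝ X] {𝓥 : ℤ → Submodule ℝ V} {𝓦 : ℤ → Submodule ℝ W}

/-- A sum over compositions and permutations of values of a graded symmetric family collects the
values on ordered partitions. -/
theorem sum_composition_perm {f : ∀ n : ℕ, (Fin n → V) → W} {n : ℕ}
    (hf : IsGradedSymmetricFamily 𝓥 𝓦 0 f) (hf0 : ∀ x, f 0 x = 0)
    {G : ∀ k : ℕ, (Fin k → W) → X}
    (hG : ∀ k (c : Fin k → ℝ) v, G k (fun j => c j • v j) = (∏ j, c j) • G k v)
    {d : Fin n → ℤ} {x : Fin n → V} (hx : ∀ i, x i ∈ 𝓥 (d i)) :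
    ∑ c : Composition n, ∑ σ : Equiv.Perm (Fin n),
      (koszulSign d σ / ((c.length.factorial : ℝ) * ∏ j, ((c.blocksFun j).factorial : ℝ))) •
        G c.length (fun j => f (c.blocksFun j) fun i => x (σ (c.embedding j i))) =
      ∑ k ∈ range (n + 1), (k.factorial : ℝ)⁻¹ • ∑ B ∈ orderedPartitions k univ,
        partitionSign d B • G k fun j => evalOn f x (B j) := by
  have hterm : ∀ (c : Composition n) (σ : Equiv.Perm (Fin n)),
      koszulSign d σ • G c.length (fun j => f (c.blocksFun j) fun i => x (σ (c.embedding j i))) =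
        partitionSign d (c.permBlocks σ) • G c.length fun j => evalOn f x (c.permBlocks σ j) := by
    intro c σ
    have h : (fun j => f (c.blocksFun j) fun i => x (σ (c.embedding j i))) = fun j =>
        (wordSign d fun i => σ (c.embedding j i)) • evalOn f x (c.permBlocks σ j) :=
      funext fun j => hf.apply_word hx (c.injective_perm_embedding σ j)
        (c.card_permBlocks σ j) fun i => mem_image_of_mem _ (mem_univ i)
    rw [h, hG, smul_smul, c.koszulSign_eq, mul_right_comm, ← prod_mul_distrib]
    simp [wordSign_mul_self]
  have h0 : ∀ S : Finset (Fin n), S = ∅ → evalOn f x S = 0 := by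
    rintro S rfl
    rw [evalOn_empty, hf0]
  simp only [smul_sum]
  rw [← sum_composition_orderedPartitions (fun k B => (k.factorial : ℝ)⁻¹ •
    partitionSign d B • G k fun j => evalOn f x (B j))]
  · refine sum_congr rfl fun c _ => ?_
    rw [← sum_fiberwise_of_maps_to (g := c.permBlocks)
      (t := (orderedPartitions c.length univ).filter fun B => ∀ j, (B j).card = c.blocksFun j)
      fun σ _ => mem_filter.2 ⟨c.permBlocks_mem_orderedPartitions σ, c.card_permBlocks σ⟩]
    refine sum_congr rfl fun B hB => ?_
    rw [mem_filter] at hB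
    have hp : (∏ j, ((c.blocksFun j).factorial : ℝ)) ≠ 0 :=
      prod_ne_zero_iff.2 fun j _ => Nat.cast_ne_zero.2 (Nat.factorial_ne_zero _)
    rw [sum_congr rfl (g := fun _ => ((c.length.factorial : ℝ) *
      ∏ j, ((c.blocksFun j).factorial : ℝ))⁻¹ • partitionSign d B •
        G c.length fun j => evalOn f x (B j)), sum_const, c.card_permBlocks_eq hB.1 hB.2,
      ← Nat.cast_smul_eq_nsmul ℝ, smul_smul]
    · congr 1
      push_cast
      rw [mul_inv, mul_comm, mul_assoc, inv_mul_cancel₀ hp, mul_one]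
    · intro σ hσ
      rw [← (mem_filter.1 hσ).2, div_eq_inv_mul, ← smul_smul, hterm]
  · rintro k B ⟨j, hj⟩
    have h : (fun j => evalOn f x (B j)) =
        fun i => (if i = j then (0 : ℝ) else 1) • evalOn f x (B i) := by
      funext i
      split_ifs with hi
      · rw [zero_smul, hi, h0 _ hj]
      · rw [one_smul]
    rw [h, hG, prod_eq_zero (mem_univ j) (by simp), zero_smul, smul_zero, smul_zero]

end Compositions

/-! ### Insertions as sums over subsets -/

section Insertion

variable {n : ℕ}

/-- The images under `σ` of the first `r` positions. -/
def headSet (r : ℕ) (σ : Equiv.Perm (Fin n)) : Finset (Fin n) :=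
  univ.filter fun a => (σ.symm a : ℕ) < r

theorem mem_headSet {r : ℕ} {σ : Equiv.Perm (Fin n)} {a : Fin n} :
    a ∈ headSet r σ ↔ (σ.symm a : ℕ) < r := by
  simp [headSet]

theorem card_headSet {r : ℕ} (hr : r ≤ n) (σ : Equiv.Perm (Fin n)) :
    (headSet r σ).card = r := by
  have h : headSet r σ = univ.image fun i : Fin r => σ ⟨i, by omega⟩ := by
    ext a
    simp only [mem_headSet, mem_image, mem_univ, true_and]
    constructor
    · intro h
      exact ⟨⟨σ.symm a, h⟩, by simp⟩
    · rintro ⟨i, rfl⟩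
      simp
  have hinj : Function.Injective fun i : Fin r => σ ⟨i, by omega⟩ := fun i j hij => by
    simpa [Fin.ext_iff] using hij
  rw [h, card_image_of_injective _ hinj, card_univ, Fintype.card_fin]

theorem card_univ_sdiff_headSet {r : ℕ} (hr : r ≤ n) (σ : Equiv.Perm (Fin n)) :
    (univ \ headSet r σ).card = n - r := by
  rw [card_sdiff_of_subset (subset_univ _), card_headSet hr, card_univ, Fintype.card_fin]

theorem IsShuffle.strictMono_head {r : ℕ} (hr : r ≤ n) {σ : Equiv.Perm (Fin n)}
    (h : IsShuffle r σ) : StrictMono fun i : Fin r => σ ⟨i, by omega⟩ :=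
  fun _ j hij => h _ _ hij (Or.inl j.2)

theorem IsShuffle.strictMono_tail {r : ℕ} (hr : r ≤ n) {σ : Equiv.Perm (Fin n)}
    (h : IsShuffle r σ) : StrictMono fun j : Fin (n - r) => σ ⟨r + j, by omega⟩ :=
  fun i _ hij => h _ _ (Nat.add_lt_add_left hij r) (Or.inr (Nat.le_add_right r i))

/-- A shuffle is determined by the set of its first values. -/
theorem IsShuffle.eq_of_headSet {r : ℕ} (hr : r ≤ n) {σ τ : Equiv.Perm (Fin n)}
    (hσ : IsShuffle r σ) (hτ : IsShuffle r τ) (h : headSet r σ = headSet r τ) : σ = τ := by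
  have h1 := orderEmbOfFin_unique (s := headSet r σ) (card_headSet hr σ)
    (f := fun i : Fin r => σ ⟨i, by omega⟩) (fun i => by simp [mem_headSet])
    (hσ.strictMono_head hr)
  have h2 := orderEmbOfFin_unique (s := headSet r σ) (card_headSet hr σ)
    (f := fun i : Fin r => τ ⟨i, by omega⟩) (fun i => by simp [h, mem_headSet])
    (hτ.strictMono_head hr)
  have h3 := orderEmbOfFin_unique (s := univ \ headSet r σ) (card_univ_sdiff_headSet hr σ)
    (f := fun i : Fin (n - r) => σ ⟨r + i, by omega⟩) (fun i => by simp [mem_headSet])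
    (hσ.strictMono_tail hr)
  have h4 := orderEmbOfFin_unique (s := univ \ headSet r σ) (card_univ_sdiff_headSet hr σ)
    (f := fun i : Fin (n - r) => τ ⟨r + i, by omega⟩) (fun i => by simp [h, mem_headSet])
    (hτ.strictMono_tail hr)
  ext1 i
  by_cases hi : (i : ℕ) < r
  · exact congrFun (h1.trans h2.symm) ⟨i, hi⟩
  · have := congrFun (h3.trans h4.symm) ⟨i - r, by omega⟩
    simpa [Nat.add_sub_cancel' (not_lt.1 hi)] using this

theorem exists_isShuffle (S : Finset (Fin n)) :
    ∃ σ : Equiv.Perm (Fin n), IsShuffle S.card σ ∧ headSet S.card σ = S := by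
  have hS : S.card ≤ n := by simpa using card_le_univ S
  have hSc : Sᶜ.card = n - S.card := by rw [card_compl, Fintype.card_fin]
  have hadd : n = S.card + (n - S.card) := by omega
  let σ : Equiv.Perm (Fin n) := (finCongr hadd).trans
    (finSumFinEquiv.symm.trans (finSumEquivOfFinset (m := S.card) rfl hSc))
  have hhead : ∀ i (hi : i < S.card), σ ⟨i, by omega⟩ = S.orderEmbOfFin rfl ⟨i, hi⟩ := by
    intro i hi
    have : finCongr hadd ⟨i, by omega⟩ = Fin.castAdd (n - S.card) ⟨i, hi⟩ := rfl
    simp only [σ, Equiv.trans_apply, this, finSumFinEquiv_symm_apply_castAdd,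
      finSumEquivOfFinset_inl]
  have htail : ∀ i (hi : i < n - S.card), σ ⟨S.card + i, by omega⟩ =
      Sᶜ.orderEmbOfFin hSc ⟨i, hi⟩ := by
    intro i hi
    have : finCongr hadd ⟨S.card + i, by omega⟩ = Fin.natAdd S.card ⟨i, hi⟩ := rfl
    simp only [σ, Equiv.trans_apply, this, finSumFinEquiv_symm_apply_natAdd,
      finSumEquivOfFinset_inr]
  have htail' : ∀ (i : Fin n) (hi : S.card ≤ i), σ i =
      Sᶜ.orderEmbOfFin hSc ⟨i - S.card, by omega⟩ := by
    intro i hi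
    rw [← htail]
    congr 1
    exact Fin.ext (Nat.add_sub_cancel' hi).symm
  refine ⟨σ, ?_, ?_⟩
  · rintro ⟨i, hin⟩ ⟨j, hjn⟩ hij (h | h)
    · rw [hhead i (lt_trans hij h), hhead j h]
      exact (S.orderEmbOfFin rfl).strictMono hij
    · rw [htail' ⟨i, hin⟩ h, htail' ⟨j, hjn⟩ (h.trans hij.le)]
      exact (Sᶜ.orderEmbOfFin hSc).strictMono (Nat.sub_lt_sub_right h hij)
  · ext a
    obtain ⟨i, rfl⟩ := σ.surjective a
    rw [mem_headSet, Equiv.symm_apply_apply]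
    by_cases hi : (i : ℕ) < S.card
    · rw [show σ i = _ from hhead i hi]
      simp [hi]
    · rw [htail' i (not_lt.1 hi)]
      have := Sᶜ.orderEmbOfFin_mem hSc ⟨i - S.card, by omega⟩
      simp only [mem_compl] at this
      simp [hi, this]

theorem IsShuffle.koszulSign_eq {r : ℕ} {σ : Equiv.Perm (Fin n)} (h : IsShuffle r σ)
    (d : Fin n → ℤ) :
    koszulSign d σ = blockSign d (headSet r σ) (univ \ headSet r σ) := by
  have hA : ∀ Φ : Fin n → ℝ, ∏ a ∈ headSet r σ, Φ a =
      ∏ i : Fin n, if (i : ℕ) < r then Φ (σ i) else 1 := fun Φ => by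
    rw [headSet, prod_filter, ← Equiv.prod_comp σ]
    simp only [Equiv.symm_apply_apply]
  have hA' : ∀ Φ : Fin n → ℝ, ∏ a ∈ univ \ headSet r σ, Φ a =
      ∏ i : Fin n, if (i : ℕ) < r then 1 else Φ (σ i) := fun Φ => by
    rw [headSet, ← filter_not, prod_filter, ← Equiv.prod_comp σ]
    simp only [Equiv.symm_apply_apply, ite_not]
  rw [koszulSign_eq_wordSign, wordSign, blockSign, hA]
  refine prod_congr rfl fun i _ => ?_
  have hpos : ∀ j, i < j → ((j : ℕ) < r ∨ r ≤ (i : ℕ)) → pairSign d (σ i) (σ j) = 1 :=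
    fun j hij hr => if_neg (h i j hij hr).not_gt
  by_cases hi : (i : ℕ) < r
  · rw [if_pos hi, hA']
    refine prod_congr rfl fun j _ => ?_
    by_cases hj : (j : ℕ) < r
    · rw [if_pos hj]
      split_ifs with hij
      · exact hpos j hij (Or.inl hj)
      · rfl
    · rw [if_neg hj, if_pos (Fin.lt_def.2 (hi.trans_le (not_lt.1 hj)))]
  · rw [if_neg hi]
    refine prod_eq_one fun j _ => ?_
    split_ifs with hij
    · exact hpos j hij (Or.inr (not_lt.1 hi))
    · rfl

variable {V W : Type*} [AddCommGroup W] [Module ℝ W]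

/-- Shuffles correspond to subsets, namely to the sets of their first values. -/
theorem insertion_eq_sum (f : ∀ n : ℕ, (Fin n → V) → W) (m : ∀ n : ℕ, (Fin n → V) → V)
    (d : Fin n → ℤ) (x : Fin n → V) :
    insertion f m d x = ∑ S ∈ (univ : Finset (Fin n)).powerset, blockSign d S (univ \ S) •
      f ((univ \ S).card + 1) (Fin.cons (evalOn m x S) fun i =>
        x ((univ \ S).orderEmbOfFin rfl i)) := by
  classical
  rw [insertion, sum_sigma']
  refine sum_bij (fun p _ => headSet p.1 p.2) (fun _ _ => by simp) ?_ ?_ ?_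
  · rintro ⟨r, σ⟩ h ⟨r', σ'⟩ h' heq
    simp only [mem_sigma, mem_univ, true_and, mem_filter] at h h' heq
    have hr : r = r' := Fin.ext (by
      rw [← card_headSet r.is_le σ, ← card_headSet r'.is_le σ', heq])
    subst hr
    rw [h.eq_of_headSet r.is_le h' heq]
  · intro S _
    obtain ⟨σ, hσ, hS⟩ := exists_isShuffle S
    have hlt : S.card < n + 1 := Nat.lt_succ_of_le (by simpa using card_le_univ S)
    exact ⟨⟨⟨S.card, hlt⟩, σ⟩, by simpa using hσ, hS⟩
  · rintro ⟨r, σ⟩ h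
    simp only [mem_sigma, mem_univ, true_and, mem_filter] at h
    rw [h.koszulSign_eq]
    congr 1
    rw [← cons_eq_of_strictMono f _ x (card_univ_sdiff_headSet r.is_le σ)
      (h.strictMono_tail r.is_le) fun i => by simp [mem_headSet],
      ← evalOn_eq_of_strictMono m x (card_headSet r.is_le σ) (h.strictMono_head r.is_le)
      fun i => by simp [mem_headSet]]

end Insertion

/-! ### Restriction to subsets, and decomposition according to the first block -/

theorem blockSign_map {ι κ : Type*} [LinearOrder ι] [LinearOrder κ] (d : ι → ℤ) (e : κ ↪o ι)
    (S T : Finset κ) : blockSign d (S.map e.toEmbedding) (T.map e.toEmbedding) =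
      blockSign (d ∘ e) S T := by
  simp [blockSign, prod_map, pairSign]

theorem degSum_map {ι κ : Type*} (d : ι → ℤ) (e : κ ↪ ι) (S : Finset κ) :
    degSum d (S.map e) = degSum (d ∘ e) S := sum_map _ _ _

theorem sum_powerset_map {ι κ M : Type*} [AddCommMonoid M] (e : κ ↪ ι)
    (S : Finset κ) (Φ : Finset ι → M) :
    ∑ A ∈ (S.map e).powerset, Φ A = ∑ A ∈ S.powerset, Φ (A.map e) := by
  classical
  refine (sum_bij (fun A _ => A.map e) ?_ ?_ ?_ fun _ _ => rfl).symm
  · intro A hA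
    rw [mem_powerset] at hA ⊢
    exact map_subset_map.2 hA
  · intro A _ B _ h
    exact map_injective e h
  · intro A hA
    rw [mem_powerset, subset_map_iff] at hA
    obtain ⟨u, hu, rfl⟩ := hA
    exact ⟨u, mem_powerset.2 hu, rfl⟩

theorem single_empty_comp_map {ι κ H : Type*} [DecidableEq ι] [DecidableEq κ] [Zero H] (e : κ ↪ ι)
    (y : H) :
    (fun T : Finset κ => (Pi.single ∅ y : Finset ι → H) (T.map e)) =
      Pi.single ∅ y := by
  funext T
  rcases eq_or_ne T ∅ with rfl | h
  · rw [map_empty, Pi.single_eq_same, Pi.single_eq_same]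
  · rw [Pi.single_eq_of_ne h, Pi.single_eq_of_ne (by simpa using h)]

/-- A sum over subsets that only receives contributions from singletons. -/
theorem sum_powerset_of_card_ne_one {ι M : Type*} [AddCommMonoid M] (S : Finset ι)
    (Φ : Finset ι → M) (hΦ : ∀ A, A.card ≠ 1 → Φ A = 0) :
    ∑ A ∈ S.powerset, Φ A = ∑ i ∈ S, Φ {i} := by
  refine (sum_of_injOn singleton singleton_injective.injOn ?_ ?_
    fun _ _ => rfl).symm
  · intro i hi
    simpa using hi
  · intro A hA hA'
    refine hΦ A fun h => hA' ?_
    obtain ⟨i, rfl⟩ := card_eq_one.1 h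
    exact ⟨i, by simpa using hA, rfl⟩

namespace KoszulGradedLieAlgebra

variable {H : Type*} [AddCommGroup H] [Module ℝ H] {𝓗 : ℤ → Submodule ℝ H}
  (L : KoszulGradedLieAlgebra 𝓗) {ι κ : Type*} [LinearOrder ι] [LinearOrder κ] (d : ι → ℤ)

theorem conv_map (e : κ ↪o ι) (j : ℤ) (f g : Finset ι → H) (S : Finset κ) :
    L.conv d j f g (S.map e.toEmbedding) = L.conv (d ∘ e) j (fun T => f (T.map e.toEmbedding))
      (fun T => g (T.map e.toEmbedding)) S := by
  classical
  rw [conv_apply, conv_apply, sum_powerset_map]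
  refine sum_congr rfl fun A _ => ?_
  rw [degSum_map, ← Finset.map_sdiff, blockSign_map]
  rfl

theorem adRight_pow_map (e : κ ↪o ι) (u f : Finset ι → H) (k : ℕ) (S : Finset κ) :
    (L.adRight d u ^ k) f (S.map e.toEmbedding) =
      (L.adRight (d ∘ e) (fun T => u (T.map e.toEmbedding)) ^ k)
        (fun T => f (T.map e.toEmbedding)) S := by
  induction k generalizing S with
  | zero => rfl
  | succ k ih =>
    rw [pow_succ', pow_succ', Module.End.mul_apply, Module.End.mul_apply, adRight_apply,
      adRight_apply, conv_map]
    simp only [ih]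

theorem expAd_map [Fintype ι] [Fintype κ] (e : κ ↪o ι) {u : Finset ι → H} (hu : u ∅ = 0)
    (f : Finset ι → H) (S : Finset κ) :
    L.expAd d u f (S.map e.toEmbedding) = L.expAd (d ∘ e) (fun T => u (T.map e.toEmbedding))
      (fun T => f (T.map e.toEmbedding)) S := by
  rw [L.expAd_apply_apply d hu f (card_map _).le,
    L.expAd_apply_apply _ (by rw [map_empty, hu]) _ le_rfl]
  simp only [adRight_pow_map]

/-- Iterated brackets of `f` with `u`, sorted by the coefficient of `f`. -/
theorem adRight_pow_eq_sum (u f : Finset ι → H) (k : ℕ) (S : Finset ι) :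
    (L.adRight d u ^ k) f S = ∑ A ∈ S.powerset, blockSign d A (S \ A) •
      (L.adRight d u ^ k) (Pi.single ∅ (f A)) (S \ A) := by
  induction k generalizing S with
  | zero =>
    simp only [pow_zero, Module.End.one_apply]
    rw [sum_eq_single S]
    · simp
    · intro A hA hne
      rw [Pi.single_eq_of_ne, smul_zero]
      intro h
      exact hne (Subset.antisymm (mem_powerset.1 hA) (sdiff_eq_empty_iff_subset.1 h))
    · simp
  | succ k ih =>
    simp only [pow_succ', Module.End.mul_apply, adRight_apply, conv_zero_apply]
    have h : ∀ T ∈ S.powerset, blockSign d T (S \ T) • L.br ((L.adRight d u ^ k) f T) (u (S \ T)) =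
        ∑ A ∈ T.powerset, (blockSign d (A ∪ T \ A) (S \ T) * blockSign d A (T \ A)) •
          L.br ((L.adRight d u ^ k) (Pi.single ∅ (f A)) (T \ A)) (u (S \ T)) := fun T _ => by
      rw [ih, map_sum, LinearMap.sum_apply, smul_sum]
      refine sum_congr rfl fun A hA => ?_
      rw [map_smul, LinearMap.smul_apply, smul_smul, union_sdiff_of_subset (mem_powerset.1 hA)]
    rw [sum_congr rfl h, sum_powerset_assoc S fun A B C => (blockSign d (A ∪ B) C *
      blockSign d A B) • L.br ((L.adRight d u ^ k) (Pi.single ∅ (f A)) B) (u C)]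
    refine sum_congr rfl fun A _ => ?_
    rw [smul_sum]
    refine sum_congr rfl fun B hB => ?_
    have hB' := mem_powerset.1 hB
    rw [smul_smul, blockSign_union_left d (disjoint_sdiff.mono_right hB'),
      ← union_sdiff_of_subset hB', blockSign_union_right d A disjoint_sdiff,
      union_sdiff_of_subset hB']
    congr 1
    ring

/-- `e^{[·, u]} f` is the sum over the values of `f` of the brackets of these values with values of
`u`. -/
theorem expAd_eq_sum [Fintype ι] {u : Finset ι → H} (hu : u ∅ = 0) (f : Finset ι → H)
    (S : Finset ι) :
    L.expAd d u f S = ∑ A ∈ S.powerset, blockSign d A (S \ A) •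
      L.expAd d u (Pi.single ∅ (f A)) (S \ A) := by
  rw [L.expAd_apply_apply d hu f (card_le_univ S)]
  simp only [L.expAd_apply_apply d hu _ (card_le_univ _), smul_sum]
  rw [sum_comm]
  refine sum_congr rfl fun k _ => ?_
  rw [adRight_pow_eq_sum, smul_sum]
  exact sum_congr rfl fun A _ => smul_comm _ _ _

end KoszulGradedLieAlgebra

section Primary

open KoszulGradedLieAlgebra

variable {ι V : Type*} [AddCommGroup V]

/-- The family with value `x i` at `{i}` and `0` elsewhere. -/
def primary (x : ι → V) (S : Finset ι) : V := if S.card = 1 then ∑ i ∈ S, x i else 0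

@[simp] theorem primary_singleton (x : ι → V) (i : ι) : primary x {i} = x i := by
  simp [primary]

theorem primary_of_card_ne_one (x : ι → V) {S : Finset ι} (hS : S.card ≠ 1) : primary x S = 0 :=
  if_neg hS

@[simp] theorem primary_empty (x : ι → V) : primary x ∅ = 0 := by
  simp [primary]

theorem primary_map {κ : Type*} (e : κ ↪ ι) (x : ι → V) (S : Finset κ) :
    primary x (S.map e) = primary (x ∘ e) S := by
  simp [primary, sum_map]

theorem primary_homogeneous [Module ℝ V] {𝓥 : ℤ → Submodule ℝ V} {d : ι → ℤ} {x : ι → V}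
    (hx : ∀ i, x i ∈ 𝓥 (d i)) : IsHomogeneous 𝓥 d 0 (primary x) := fun S => by
  by_cases hS : S.card = 1
  · obtain ⟨i, rfl⟩ := card_eq_one.1 hS
    simpa using hx i
  · rw [primary_of_card_ne_one x hS]
    exact zero_mem _

theorem euler_primary [Module ℝ V] (w : ι → ℝ) (x : ι → V) :
    euler w (primary x) = primary fun i => w i • x i := by
  funext S
  rw [euler_apply]
  by_cases hS : S.card = 1
  · obtain ⟨i, rfl⟩ := card_eq_one.1 hS
    simp
  · rw [primary_of_card_ne_one x hS, primary_of_card_ne_one _ hS, smul_zero]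

theorem compLeft_primary [Module ℝ V] {W : Type*} [AddCommGroup W] [Module ℝ W] (φ : V →ₗ[ℝ] W)
    (x : ι → V) : φ.compLeft (Finset ι) (primary x) = primary fun i => φ (x i) := by
  funext S
  by_cases hS : S.card = 1
  · simp [primary, hS]
  · simp [primary, hS]

/-- Values of `e^{[·, u]}` on a family supported on singletons. -/
theorem KoszulGradedLieAlgebra.expAd_primary [Module ℝ V] {𝓥 : ℤ → Submodule ℝ V}
    (L : KoszulGradedLieAlgebra 𝓥) [LinearOrder ι] [Fintype ι] (d : ι → ℤ) {u : Finset ι → V}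
    (hu : u ∅ = 0) (x : ι → V) (S : Finset ι) :
    L.expAd d u (primary x) S = ∑ i ∈ S, blockSign d {i} (S \ {i}) •
      L.expAd d u (Pi.single ∅ (x i)) (S \ {i}) := by
  rw [L.expAd_eq_sum d hu, sum_powerset_of_card_ne_one]
  · simp
  · intro A hA
    rw [primary_of_card_ne_one x hA, Pi.single_zero, map_zero, Pi.zero_apply, smul_zero]

end Primary

/-! ### Koszul signs of products of permutations -/

/-- A product of a symmetric function over the pairs of positions of a word without repetitions does
not depend on the order of the word. -/
theorem prod_lt_comp_of_injective {κ M : Type*} [LinearOrder κ] [CommMonoid M] {n : ℕ}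
    {q : Fin n → κ} (hq : Function.Injective q) {h : κ → κ → M} (hh : ∀ a b, h a b = h b a) :
    ∏ i, ∏ j, (if i < j then h (q i) (q j) else 1) =
      ∏ a ∈ univ.image q, ∏ b ∈ univ.image q, if a < b then h a b else 1 := by
  have h1 : ∀ i j, (if i < j then h (q i) (q j) else 1) =
      (if i < j ∧ q i < q j then h (q i) (q j) else 1) *
        if i < j ∧ q j < q i then h (q i) (q j) else 1 := by
    intro i j
    by_cases hij : i < j
    · rcases lt_or_gt_of_ne (hq.ne hij.ne) with h' | h' <;> simp [hij, h', h'.not_gt]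
    · simp [hij]
  have h2 : ∀ i j, (if q i < q j then h (q i) (q j) else 1) =
      (if i < j ∧ q i < q j then h (q i) (q j) else 1) *
        if j < i ∧ q i < q j then h (q j) (q i) else 1 := by
    intro i j
    by_cases hij : q i < q j
    · have hne : i ≠ j := fun h' => hij.ne (congrArg q h')
      rcases lt_or_gt_of_ne hne with h' | h' <;> simp [hij, h', h'.not_gt, hh (q i)]
    · simp [hij]
  rw [prod_image hq.injOn]
  simp only [prod_image hq.injOn, h1, h2, prod_mul_distrib]
  congr 1
  exact prod_comm

section Koszul

variable {n : ℕ} (d : Fin n → ℤ)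

/-- The Koszul sign is a cocycle for the action of the symmetric group on degrees. -/
theorem koszulSign_mul (σ τ : Equiv.Perm (Fin n)) :
    koszulSign d (σ * τ) = koszulSign d σ * koszulSign (d ∘ σ) τ := by
  -- The sign of the pair of the positions `a, b` of `σ`, whichever of them comes first.
  let h : Fin n → Fin n → ℝ := fun a b =>
    if a < b then pairSign d (σ a) (σ b) else pairSign d (σ b) (σ a)
  have hh : ∀ a b, h a b = h b a := by
    intro a b
    rcases lt_trichotomy a b with hab | rfl | hab
    · simp [h, hab, hab.not_gt]
    · rfl
    · simp [h, hab, hab.not_gt]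
  have hσ : koszulSign d σ = ∏ i, ∏ j, if i < j then h (τ i) (τ j) else 1 := by
    rw [prod_lt_comp_of_injective τ.injective hh, image_univ_equiv, koszulSign_eq_wordSign,
      wordSign]
    refine prod_congr rfl fun i _ => prod_congr rfl fun j _ => ?_
    by_cases hij : i < j
    · simp [h, hij]
    · simp [hij]
  rw [hσ, koszulSign_eq_wordSign, koszulSign_eq_wordSign, wordSign, wordSign, ← prod_mul_distrib]
  refine prod_congr rfl fun i _ => ?_
  rw [← prod_mul_distrib]
  refine prod_congr rfl fun j _ => ?_
  by_cases hij : i < j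
  · simp only [if_pos hij, Equiv.Perm.mul_apply, h]
    rcases lt_or_gt_of_ne (τ.injective.ne hij.ne) with h' | h'
    · rw [if_pos h', show pairSign (d ∘ σ) (τ i) (τ j) = 1 from if_neg h'.not_gt, mul_one]
    · rw [if_neg h'.not_gt, show pairSign (d ∘ σ) (τ i) (τ j) =
        (-1 : ℝ) ^ (d (σ (τ i)) * d (σ (τ j))) from if_pos h',
        pairSign_swap d (σ.injective.ne (τ.injective.ne hij.ne)), mul_comm]
  · simp [hij]

theorem koszulSign_one : koszulSign d 1 = 1 :=
  prod_eq_one fun _ _ => prod_eq_one fun _ _ => if_neg fun h => h.1.not_gt h.2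

theorem koszulSign_swap {m : ℕ} (d : Fin (m + 1) → ℤ) (i : Fin m) :
    koszulSign d (Equiv.swap i.castSucc i.succ) = (-1 : ℝ) ^ (d i.castSucc * d i.succ) := by
  have hlt : i.castSucc < i.succ := Fin.castSucc_lt_succ
  rw [koszulSign, prod_eq_single i.castSucc, prod_eq_single i.succ]
  · rw [if_pos ⟨hlt, by simp⟩]
    simp [mul_comm]
  · intro j _ hj
    refine if_neg fun h => ?_
    rw [Equiv.swap_apply_left, Equiv.swap_apply_of_ne_of_ne h.1.ne' hj] at h
    have h1 := Fin.lt_def.1 h.1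
    have h2 := Fin.lt_def.1 h.2
    simp only [Fin.val_castSucc, Fin.val_succ] at h1 h2
    omega
  · simp
  · intro a _ ha
    refine prod_eq_one fun b _ => if_neg fun h => ?_
    rcases eq_or_ne a i.succ with rfl | ha'
    · rw [Equiv.swap_apply_right, Equiv.swap_apply_of_ne_of_ne (hlt.trans h.1).ne' h.1.ne'] at h
      exact (h.2.trans (hlt.trans h.1)).ne rfl
    · rw [Equiv.swap_apply_of_ne_of_ne ha ha'] at h
      have h1 := Fin.lt_def.1 h.1
      have h2 := Fin.lt_def.1 h.2
      have h3 : (a : ℕ) ≠ i := fun h' => ha (Fin.ext h')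
      rcases eq_or_ne b i.castSucc with rfl | hb
      · rw [Equiv.swap_apply_left] at h2
        simp only [Fin.val_castSucc, Fin.val_succ] at h1 h2
        omega
      · rcases eq_or_ne b i.succ with rfl | hb'
        · rw [Equiv.swap_apply_right] at h2
          simp only [Fin.val_castSucc, Fin.val_succ] at h1 h2
          omega
        · rw [Equiv.swap_apply_of_ne_of_ne hb hb'] at h2
          omega
  · simp

theorem Fin.swap_zero_apply_succ_succ {m : ℕ} (j : Fin m) :
    Equiv.swap (Fin.castSucc (0 : Fin (m + 1))) (Fin.succ 0) j.succ.succ = j.succ.succ :=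
  Equiv.swap_apply_of_ne_of_ne (Fin.succ_ne_zero _)
    fun h => Fin.succ_ne_zero _ (Fin.succ_injective _ h)

theorem Fin.swap_succ_apply_zero {m : ℕ} (i : Fin m) :
    Equiv.swap i.succ.castSucc i.succ.succ 0 = 0 :=
  Equiv.swap_apply_of_ne_of_ne (Fin.succ_ne_zero i.castSucc).symm (Fin.succ_ne_zero _).symm

theorem Fin.swap_succ_apply_succ {m : ℕ} (i : Fin m) (j : Fin (m + 1)) :
    Equiv.swap i.succ.castSucc i.succ.succ j.succ = (Equiv.swap i.castSucc i.succ j).succ :=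
  (Fin.succ_injective _).swap_apply i.castSucc i.succ j

/-- Graded symmetry follows from graded symmetry under adjacent transpositions. -/
theorem eq_koszulSign_smul_of_swap {V W : Type*} [AddCommGroup V] [Module ℝ V] [AddCommGroup W]
    [Module ℝ W] {𝓥 : ℤ → Submodule ℝ V} {m : ℕ} {f : (Fin (m + 1) → V) → W}
    (hf : ∀ (d : Fin (m + 1) → ℤ) (x : Fin (m + 1) → V), (∀ i, x i ∈ 𝓥 (d i)) → ∀ i : Fin m,
      f x = (-1 : ℝ) ^ (d i.castSucc * d i.succ) • f (x ∘ Equiv.swap i.castSucc i.succ))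
    (d : Fin (m + 1) → ℤ) (x : Fin (m + 1) → V) (hx : ∀ i, x i ∈ 𝓥 (d i))
    (σ : Equiv.Perm (Fin (m + 1))) : f x = koszulSign d σ • f (x ∘ σ) := by
  have hσ : σ ∈ Submonoid.closure
      (Set.range fun i : Fin m => Equiv.swap i.castSucc i.succ) := by
    rw [Equiv.Perm.mclosure_swap_castSucc_succ]
    exact Submonoid.mem_top σ
  induction hσ using Submonoid.closure_induction generalizing d x with
  | mem τ hτ =>
    obtain ⟨i, rfl⟩ := hτ
    rw [koszulSign_swap]
    exact hf d x hx i
  | one =>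
    rw [koszulSign_one, one_smul]
    rfl
  | mul τ ρ _ _ hτ hρ =>
    rw [koszulSign_mul, hτ d x hx, hρ (d ∘ τ) (x ∘ τ) fun i => hx _, smul_smul]
    rfl

end Koszul

/-! ### Iterated brackets and derived brackets as graded symmetric families -/

namespace VAlgebra

variable {H : Type*} [AddCommGroup H] [Module ℝ H] {𝓗 : ℤ → Submodule ℝ H} (A : VAlgebra 𝓗)

/-- Iterated brackets as multilinear maps. -/
noncomputable def nestedMultilinear (A : VAlgebra 𝓗) :
    ∀ n : ℕ, H →ₗ[ℝ] MultilinearMap ℝ (fun _ : Fin n => H) H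
  | 0 => (MultilinearMap.constLinearEquivOfIsEmpty ℝ ℝ (fun _ : Fin 0 => H) H).toLinearMap
  | n + 1 => (multilinearCurryLeftEquiv ℝ (fun _ : Fin (n + 1) => H) H).symm.toLinearMap ∘ₗ
      A.br.compr₂ (nestedMultilinear A n)

theorem nestedMultilinear_apply (n : ℕ) (y : H) (x : Fin n → H) :
    A.nestedMultilinear n y x = A.nested n y x := by
  induction n generalizing y with
  | zero => rfl
  | succ n ih => exact ih (A.br y (x 0)) fun i => x i.succ

theorem nested_smul (n : ℕ) (c : ℝ) (y : H) (x : Fin n → H) :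
    A.nested n (c • y) x = c • A.nested n y x := by
  simp only [← nestedMultilinear_apply, map_smul, smul_apply]

theorem nested_mem {n : ℕ} {i : ℤ} {d : Fin n → ℤ} {y : H} {x : Fin n → H} (hy : y ∈ 𝓗 i)
    (hx : ∀ j, x j ∈ 𝓗 (d j)) : A.nested n y x ∈ 𝓗 (i + ∑ j, d j) := by
  induction n generalizing i y with
  | zero => simpa [nested] using hy
  | succ n ih =>
    rw [Fin.sum_univ_succ, ← add_assoc]
    exact ih (A.br_mem _ _ _ _ hy (hx 0)) fun j => hx _

/-- Elements of the abelian subalgebra act by commuting operators. -/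
theorem br_br_comm {i j : ℤ} {u v : A.a} (hu : u ∈ A.grading i) (hv : v ∈ A.grading j) (y : H) :
    A.br (A.br y u) v = (-1 : ℝ) ^ (i * j) • A.br (A.br y v) u := by
  have hu' : (u : H) ∈ 𝓗 i := hu
  have hv' : (v : H) ∈ 𝓗 j := hv
  rw [A.jacobi_right hu' hv', A.abelian, map_zero, zero_add]

theorem nested_swap {m : ℕ} (y : H) {d : Fin (m + 1) → ℤ} {x : Fin (m + 1) → A.a}
    (hx : ∀ i, x i ∈ A.grading (d i)) (i : Fin m) :
    A.nested (m + 1) y (fun j => x j) = (-1 : ℝ) ^ (d i.castSucc * d i.succ) •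
      A.nested (m + 1) y (fun j => x (Equiv.swap i.castSucc i.succ j)) := by
  induction m generalizing y with
  | zero => exact i.elim0
  | succ m ih =>
    refine Fin.cases ?_ (fun i => ?_) i
    · have h0 : Equiv.swap (Fin.castSucc (0 : Fin (m + 1))) (Fin.succ 0) 0 = Fin.succ 0 :=
        Equiv.swap_apply_left _ _
      have h1 : Equiv.swap (Fin.castSucc (0 : Fin (m + 1))) (Fin.succ 0) (Fin.succ 0) = 0 :=
        Equiv.swap_apply_right _ _
      simp only [nested, Fin.swap_zero_apply_succ_succ, h0, h1]
      rw [A.br_br_comm (hx 0) (hx (Fin.succ 0)), nested_smul]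
      rfl
    · refine (ih (A.br y (x 0)) (d := fun j => d j.succ) (fun j => hx j.succ) i).trans ?_
      change _ = _ • A.nested (m + 1)
        (A.br y (x (Equiv.swap i.succ.castSucc i.succ.succ 0)))
        fun j => x (Equiv.swap i.succ.castSucc i.succ.succ j.succ)
      simp only [Fin.swap_succ_apply_zero, Fin.swap_succ_apply_succ]
      rfl

/-- The brackets `[[…[E x₁, x₂], …], xₙ]`, with `P` in arity `0`, before the projection to `a`. -/
def liftedBrackets (Ehat : H →ₗ[ℝ] H) (P : H) : ∀ n : ℕ, (Fin n → A.a) → H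
  | 0, _ => P
  | n + 1, x => A.nested n ((Ehat + A.br P) (x 0)) fun i => x i.succ

theorem derivedBrackets_eq (Ehat : H →ₗ[ℝ] H) (P : H) (n : ℕ) (x : Fin n → A.a) :
    A.derivedBrackets Ehat P n x = A.proj (A.liftedBrackets Ehat P n x) := by
  cases n <;> rfl

variable {A} in
/-- As `a` is abelian, `[E u, v]` is graded symmetric in `u` and `v`. -/
theorem br_map_comm {Ehat : H →ₗ[ℝ] H} (hE : A.IsDerivation 1 Ehat) (P : H) {i j : ℤ}
    {u v : A.a} (hu : u ∈ A.grading i) (hv : v ∈ A.grading j) :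
    A.br ((Ehat + A.br P) u) v = (-1 : ℝ) ^ (i * j) • A.br ((Ehat + A.br P) v) u := by
  have h := hE.leibniz i u v hu
  rw [A.abelian, map_zero, A.skew i (j + 1) u (Ehat v) hu (hE.degree _ _ hv), smul_neg, smul_smul,
    negOne_zpow_mul, negOne_zpow_congr (b := i * j) i (by ring)] at h
  rw [LinearMap.add_apply, LinearMap.add_apply, map_add, map_add, LinearMap.add_apply,
    LinearMap.add_apply, A.br_br_comm hu hv, smul_add]
  congr 1
  exact eq_of_sub_eq_zero (by rw [sub_eq_add_neg]; exact h.symm)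

theorem liftedBrackets_family {Ehat : H →ₗ[ℝ] H} (hE : A.IsDerivation 1 Ehat) {P : H}
    (hP : P ∈ 𝓗 1) : IsGradedSymmetricFamily A.grading 𝓗 1 (A.liftedBrackets Ehat P) where
  multilinear n := by
    cases n with
    | zero => exact ⟨MultilinearMap.constOfIsEmpty ℝ _ P, fun x => rfl⟩
    | succ n =>
      refine ⟨(LinearMap.uncurryLeft (M := fun _ : Fin (n + 1) => H)
        (A.nestedMultilinear n ∘ₗ (Ehat + A.br P))).compLinearMap fun _ => A.a.subtype, fun x => ?_⟩
      exact A.nestedMultilinear_apply n _ _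
  degree n d x hx := by
    cases n with
    | zero => simpa [liftedBrackets] using hP
    | succ n =>
      have h0 : (Ehat + A.br P) (x 0) ∈ 𝓗 (d 0 + 1) := by
        rw [LinearMap.add_apply]
        refine Submodule.add_mem _ (hE.degree _ _ (hx 0)) ?_
        rw [add_comm]
        exact A.br_mem _ _ _ _ hP (hx 0)
      have h := A.nested_mem h0 (d := fun i => d i.succ) (x := fun i => (x i.succ : H))
        fun i => hx i.succ
      rwa [add_right_comm, ← Fin.sum_univ_succ] at h
  symm n d x hx σ := by
    cases n with
    | zero =>
      rw [Subsingleton.elim σ 1, koszulSign_one, one_smul]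
      rfl
    | succ n =>
      refine eq_koszulSign_smul_of_swap (fun d x hx i => ?_) d x hx σ
      cases n with
      | zero => exact i.elim0
      | succ n =>
        refine Fin.cases ?_ (fun i => ?_) i
        · have h0 : Equiv.swap (Fin.castSucc (0 : Fin (n + 1))) (Fin.succ 0) 0 = Fin.succ 0 :=
            Equiv.swap_apply_left _ _
          have h1 : Equiv.swap (Fin.castSucc (0 : Fin (n + 1))) (Fin.succ 0) (Fin.succ 0) = 0 :=
            Equiv.swap_apply_right _ _
          simp only [liftedBrackets, nested, Fin.swap_zero_apply_succ_succ, h0, h1,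
            Function.comp_apply]
          rw [br_map_comm hE P (hx 0) (hx (Fin.succ 0)), nested_smul]
          rfl
        · simp only [liftedBrackets, Function.comp_apply, Fin.swap_succ_apply_zero,
            Fin.swap_succ_apply_succ]
          exact A.nested_swap _ (d := fun j => d j.succ) (fun j => hx j.succ) i

theorem derivedBrackets_family {Ehat : H →ₗ[ℝ] H} (hE : A.IsDerivation 1 Ehat) {P : H}
    (hP : P ∈ 𝓗 1) :
    IsGradedSymmetricFamily A.grading A.grading 1 (A.derivedBrackets Ehat P) where
  multilinear n := by
    obtain ⟨F, hF⟩ := (A.liftedBrackets_family hE hP).multilinear n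
    refine ⟨A.proj.compMultilinearMap F, fun x => ?_⟩
    rw [derivedBrackets_eq, ← hF]
    rfl
  degree n d x hx := by
    rw [derivedBrackets_eq]
    exact A.proj_mem _ _ ((A.liftedBrackets_family hE hP).degree n d x hx)
  symm n d x hx σ := by
    rw [derivedBrackets_eq, derivedBrackets_eq, ← map_smul,
      ← (A.liftedBrackets_family hE hP).symm n d x hx σ]

end VAlgebra

section WordSign

variable {ι : Type*} [LinearOrder ι] (d : ι → ℤ)

theorem wordSign_of_strictMono {n : ℕ} {q : Fin n → ι} (hq : StrictMono q) : wordSign d q = 1 := by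
  refine prod_eq_one fun i _ => prod_eq_one fun j _ => ?_
  split_ifs with h
  · exact if_neg (hq h).not_gt
  · rfl

theorem wordSign_succ {n : ℕ} (q : Fin (n + 1) → ι) : wordSign d q =
    (∏ j : Fin n, pairSign d (q 0) (q j.succ)) * wordSign d fun j : Fin n => q j.succ := by
  rw [wordSign, Fin.prod_univ_succ]
  congr 1
  · rw [Fin.prod_univ_succ, if_neg (lt_irrefl _), one_mul]
    exact prod_congr rfl fun j _ => if_pos (Fin.succ_pos j)
  · refine prod_congr rfl fun i _ => ?_
    rw [Fin.prod_univ_succ, if_neg (Fin.not_lt_zero _), one_mul]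
    simp only [Fin.succ_lt_succ_iff]

theorem wordSign_castSucc {n : ℕ} (q : Fin (n + 1) → ι) : wordSign d q =
    wordSign d (fun j : Fin n => q j.castSucc) *
      ∏ j : Fin n, pairSign d (q j.castSucc) (q (Fin.last n)) := by
  rw [wordSign, Fin.prod_univ_castSucc, wordSign, ← prod_mul_distrib,
    prod_eq_one (f := fun j => if Fin.last n < j then _ else _)
      fun j _ => if_neg (Fin.le_last j).not_gt, mul_one]
  refine prod_congr rfl fun i _ => ?_
  rw [Fin.prod_univ_castSucc, if_pos (Fin.castSucc_lt_last i)]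
  simp only [Fin.castSucc_lt_castSucc_iff]

end WordSign

section PermSucc

variable {n : ℕ}

/-- The inverse of `i.cycleRange` moves the entry `i` to the front. -/
theorem koszulSign_cycleRange_symm (d : Fin (n + 1) → ℤ) (i : Fin (n + 1)) :
    koszulSign d i.cycleRange.symm = blockSign d {i} (univ \ {i}) := by
  have h : (fun j : Fin n => i.cycleRange.symm j.succ) = i.succAbove :=
    funext fun j => Fin.cycleRange_symm_succ i j
  rw [koszulSign_eq_wordSign, wordSign_succ, h,
    wordSign_of_strictMono d (Fin.strictMono_succAbove i), mul_one, blockSign, prod_singleton,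
    ← compl_eq_univ_sdiff, ← Fin.image_succAbove_univ,
    prod_image (Fin.succAbove_right_injective).injOn]
  simp only [Fin.cycleRange_symm_zero, Fin.cycleRange_symm_succ]

theorem koszulSign_decomposeFin_symm (d : Fin (n + 1) → ℤ) (τ : Equiv.Perm (Fin n)) :
    koszulSign d (Equiv.Perm.decomposeFin.symm (0, τ)) = koszulSign (d ∘ Fin.succ) τ := by
  rw [koszulSign_eq_wordSign, wordSign_succ, koszulSign_eq_wordSign,
    ← wordSign_comp_strictMono d Fin.strictMono_succ]
  simp only [Equiv.Perm.decomposeFin_symm_apply_zero, Equiv.Perm.decomposeFin_symm_apply_succ,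
    Equiv.swap_self, Equiv.refl_apply]
  rw [prod_eq_one fun j _ => show pairSign d 0 (τ j).succ = 1 from if_neg (Fin.not_lt_zero _),
    one_mul]
  rfl

/-- A permutation consists of its first value and a permutation of the remaining entries. -/
theorem sum_perm_succ {M : Type*} [AddCommMonoid M] (Φ : Equiv.Perm (Fin (n + 1)) → M) :
    ∑ σ, Φ σ = ∑ i : Fin (n + 1), ∑ τ : Equiv.Perm (Fin n),
      Φ (i.cycleRange.symm * Equiv.Perm.decomposeFin.symm (0, τ)) := by
  rw [← Fintype.sum_prod_type']
  refine (Fintype.sum_bijective (fun p : Fin (n + 1) × Equiv.Perm (Fin n) =>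
    (p.1.cycleRange.symm * Equiv.Perm.decomposeFin.symm (0, p.2) : Equiv.Perm (Fin (n + 1)))) ?_ _ _
    fun _ => rfl).symm
  rw [Fintype.bijective_iff_injective_and_card]
  refine ⟨?_, by simp [Fintype.card_perm, Nat.factorial_succ]⟩
  rintro ⟨i, τ⟩ ⟨i', τ'⟩ h
  have h0 := Equiv.ext_iff.1 h 0
  simp only [Equiv.Perm.mul_apply, Equiv.Perm.decomposeFin_symm_apply_zero,
    Fin.cycleRange_symm_zero] at h0
  subst h0
  have h1 := Equiv.Perm.decomposeFin.symm.injective (mul_left_cancel h)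
  exact Prod.ext rfl (Prod.ext_iff.1 h1).2

end PermSucc

/-! ### The recursively defined family -/

/-- The Koszul sign depends only on the parities of the degrees. -/
theorem koszulSign_congr {n : ℕ} {d d' : Fin n → ℤ} (h : ∀ i, Odd (d i) ↔ Odd (d' i))
    (σ : Equiv.Perm (Fin n)) : koszulSign d σ = koszulSign d' σ := by
  unfold koszulSign
  refine prod_congr rfl fun i _ => prod_congr rfl fun j _ => ?_
  congr 1
  have hodd : Odd (d (σ i) * d (σ j)) ↔ Odd (d' (σ i) * d' (σ j)) := by
    rw [Int.odd_mul, Int.odd_mul, h, h]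
  rcases Int.even_or_odd (d (σ i) * d (σ j)) with he | ho
  · rw [he.neg_one_zpow,
      (Int.not_odd_iff_even.1 fun h' => Int.not_odd_iff_even.2 he (hodd.2 h')).neg_one_zpow]
  · rw [ho.neg_one_zpow, (hodd.1 ho).neg_one_zpow]

namespace VAlgebra

variable {H : Type*} [AddCommGroup H] [Module ℝ H] {𝓗 : ℤ → Submodule ℝ H} (A : VAlgebra 𝓗)

/-- The projection of `a` onto its components of odd degree (for `b = true`) or of even degree. -/
noncomputable def parityProj (b : Bool) : A.a →ₗ[ℝ] A.a :=
  DirectSum.toModule ℝ ℤ A.a (fun i => if decide (Odd i) = b then (A.grading i).subtype else 0) ∘ₗ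
    (LinearEquiv.ofBijective (DirectSum.coeLinearMap A.grading)
      A.grading_isInternal).symm.toLinearMap

theorem parityProj_apply (b : Bool) {i : ℤ} {x : A.a} (hx : x ∈ A.grading i) :
    A.parityProj b x = if decide (Odd i) = b then x else 0 := by
  have h : (LinearEquiv.ofBijective (DirectSum.coeLinearMap A.grading)
      A.grading_isInternal).symm x = DirectSum.lof ℝ ℤ (fun i => A.grading i) i ⟨x, hx⟩ := by
    rw [LinearEquiv.symm_apply_eq]
    exact (DirectSum.coeLinearMap_lof A.grading i ⟨x, hx⟩).symm
  rw [parityProj, LinearMap.comp_apply, LinearEquiv.coe_coe, h, DirectSum.toModule_lof]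
  split_ifs <;> rfl

/-- The summand of the recursion that belongs to a composition and a permutation. -/
noncomputable def recursionTerm (ψ : H →ₗ[ℝ] H) {n : ℕ} (c : Composition n)
    (U : ∀ j : Fin c.length, MultilinearMap ℝ (fun _ : Fin (c.blocksFun j) => A.a) A.a)
    (σ : Equiv.Perm (Fin (n + 1))) : MultilinearMap ℝ (fun _ : Fin (n + 1) => A.a) A.a :=
  A.proj.compMultilinearMap <| MultilinearMap.domDomCongr σ <| LinearMap.uncurryLeft
    (M := fun _ : Fin (n + 1) => A.a)
    ((MultilinearMap.domDomCongrLinearEquiv ℝ ℝ A.a H c.blocksFinEquiv).toLinearMap ∘ₗ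
      { toFun := fun y => (A.nestedMultilinear c.length (ψ y)).compMultilinearMap
          fun j => A.a.subtype.compMultilinearMap (U j)
        map_add' := fun y z => by ext; simp
        map_smul' := fun r y => by ext; simp })

theorem recursionTerm_apply (ψ : H →ₗ[ℝ] H) {n : ℕ} (c : Composition n)
    (U : ∀ j : Fin c.length, MultilinearMap ℝ (fun _ : Fin (c.blocksFun j) => A.a) A.a)
    (σ : Equiv.Perm (Fin (n + 1))) (x : Fin (n + 1) → A.a) :
    A.recursionTerm ψ c U σ x = A.proj (A.nested c.length (ψ (x (σ 0)))
      fun j => (U j fun i => x (σ (c.embedding j i).succ) : A.a)) := by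
  rw [← nestedMultilinear_apply]
  rfl

/-- The family defined by the recursion, with `0` in arity zero. The Koszul signs depend on the
parities of the degrees, so the arguments are decomposed into their components of even (for
`b i = false`) and of odd degree (`b i = true`); this makes the recursion, which concerns homogeneous
arguments, define multilinear maps. -/
noncomputable def transportMap (ψ : H →ₗ[ℝ] H) :
    ∀ n : ℕ, MultilinearMap ℝ (fun _ : Fin n => A.a) A.a
  | 0 => 0
  | n + 1 => ∑ b : Fin (n + 1) → Bool, ∑ c : Composition n, ∑ σ : Equiv.Perm (Fin (n + 1)),
      (koszulSign (fun i => if b i then 1 else 0) σ /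
          ((n + 1 : ℝ) * (c.length.factorial : ℝ) * ∏ j, ((c.blocksFun j).factorial : ℝ))) •
        (A.recursionTerm ψ c (fun j => transportMap ψ (c.blocksFun j)) σ).compLinearMap
          fun i => A.parityProj (b i)
termination_by n => n
decreasing_by exact Nat.lt_succ_of_le (c.blocksFun_le j)

theorem transportMap_satisfiesRecursion (ψ : H ≃ₗ[ℝ] H) :
    A.SatisfiesRecursion ψ fun n => A.transportMap ψ.toLinearMap n := by
  intro n d x hx
  change A.transportMap ψ.toLinearMap (n + 1) x = _
  rw [transportMap, _root_.sum_apply, sum_eq_single fun i => decide (Odd (d i))]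
  · rw [_root_.sum_apply]
    refine sum_congr rfl fun c _ => ?_
    rw [_root_.sum_apply]
    refine sum_congr rfl fun σ _ => ?_
    have hx' : (fun i => A.parityProj (decide (Odd (d i))) (x i)) = x :=
      funext fun i => by rw [A.parityProj_apply _ (hx i), if_pos rfl]
    rw [smul_apply, MultilinearMap.compLinearMap_apply, hx', recursionTerm_apply,
      koszulSign_congr (d' := d)]
    · rfl
    · intro i
      by_cases h : Odd (d i) <;> simp [h]
  · intro b _ hb
    obtain ⟨i, hi⟩ := Function.ne_iff.1 hb
    rw [_root_.sum_apply]
    refine sum_eq_zero fun c _ => ?_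
    rw [_root_.sum_apply]
    refine sum_eq_zero fun σ _ => ?_
    rw [smul_apply, MultilinearMap.compLinearMap_apply,
      MultilinearMap.map_coord_zero _ i, smul_zero]
    rw [A.parityProj_apply _ (hx i), if_neg (Ne.symm hi)]
  · simp

variable {A}

/-- The right-hand side of the recursion is symmetrized over all permutations, so graded symmetry
follows from the cocycle property of the Koszul sign. -/
theorem SatisfiesRecursion.family {ψ : H ≃ₗ[ℝ] H} (hψ : A.IsAutomorphism ψ)
    {U : ∀ n : ℕ, (Fin n → A.a) → A.a} (hU : A.SatisfiesRecursion ψ U)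
    (hlin : ∀ n, ∃ F : MultilinearMap ℝ (fun _ : Fin n => A.a) A.a, ∀ x, F x = U n x)
    (hU0 : ∀ x, U 0 x = 0) : IsGradedSymmetricFamily A.grading A.grading 0 U where
  multilinear := hlin
  degree n := by
    induction n using Nat.strong_induction_on with
    | _ n ih =>
      intro d x hx
      cases n with
      | zero =>
        rw [hU0]
        exact zero_mem _
      | succ n =>
        rw [hU n d x hx]
        refine sum_mem fun c _ => sum_mem fun σ _ => Submodule.smul_mem _ _ ?_
        have h := A.nested_mem (hψ.degree _ _ (hx (σ 0)))
          (fun j => ih (c.blocksFun j) (Nat.lt_succ_of_le (c.blocksFun_le j))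
            (fun i => d (σ (c.embedding j i).succ)) (fun i => x (σ (c.embedding j i).succ))
            fun i => hx _)
        simp only [add_zero] at h
        rw [c.sum_sum_apply_embedding fun i => d (σ i.succ),
          ← Fin.sum_univ_succ fun i => d (σ i), Equiv.sum_comp σ] at h
        rw [add_zero]
        exact A.proj_mem _ _ h
  symm n d x hx τ := by
    cases n with
    | zero => rw [hU0, hU0, smul_zero]
    | succ n =>
      rw [hU n d x hx, hU n (d ∘ τ) (x ∘ τ) fun i => hx _, smul_sum]
      refine sum_congr rfl fun c _ => ?_
      rw [smul_sum, ← Equiv.sum_comp (Equiv.mulLeft τ)]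
      refine sum_congr rfl fun σ _ => ?_
      rw [Equiv.coe_mulLeft, koszulSign_mul, smul_smul, mul_div_assoc]
      rfl

/-! ### The recursion as a differential equation for coefficients -/

variable {ψ : H ≃ₗ[ℝ] H} {U : ∀ n : ℕ, (Fin n → A.a) → A.a}

/-- The values of a family on the subsets of a word, as elements of the ambient space: these are the
coefficients of `∑ 1/n! Uⁿ(X, …, X)` for `X = ∑ x_i ⊗ θ_i`. -/
def coeffs {ι : Type*} [LinearOrder ι] (U : ∀ n : ℕ, (Fin n → A.a) → A.a) (x : ι → A.a)
    (S : Finset ι) : H := (evalOn U x S : A.a)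

section Coeffs

variable {ι : Type*} [LinearOrder ι] {d : ι → ℤ} {x : ι → A.a}

theorem coeffs_map {κ : Type*} [LinearOrder κ] (e : κ ↪o ι) (S : Finset κ) :
    coeffs U x (S.map e.toEmbedding) = coeffs U (x ∘ e) S := by
  rw [coeffs, evalOn_map]
  rfl

theorem coeffs_comp_map {κ : Type*} [LinearOrder κ] (e : κ ↪o ι) :
    (fun S : Finset κ => coeffs U x (S.map e.toEmbedding)) = coeffs U (x ∘ e) :=
  funext fun S => coeffs_map e S

theorem coeffs_empty (hU0 : ∀ x, U 0 x = 0) : coeffs U x ∅ = 0 := by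
  rw [coeffs, evalOn_empty, hU0]
  rfl

theorem pr_coeffs : A.pr (coeffs U x) = coeffs U x := A.pr_coe _

theorem coeffs_homogeneous {k : ℤ} (hU : IsGradedSymmetricFamily A.grading A.grading k U)
    (hx : ∀ i, x i ∈ A.grading (d i)) :
    KoszulGradedLieAlgebra.IsHomogeneous 𝓗 d k (coeffs U x) :=
  fun S => hU.evalOn_mem hx S

end Coeffs

theorem smul_nested (n : ℕ) (c : Fin n → ℝ) (y : H) (x : Fin n → H) :
    A.nested n y (fun j => c j • x j) = (∏ j, c j) • A.nested n y x := by
  rw [← nestedMultilinear_apply, ← nestedMultilinear_apply]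
  exact MultilinearMap.map_smul_univ _ c x

/-- The recursion, with the sum over all permutations with given first value and over all
compositions expressed by the exponential. -/
theorem SatisfiesRecursion.smul_apply (hU : A.SatisfiesRecursion ψ U)
    (hf : IsGradedSymmetricFamily A.grading A.grading 0 U) (hU0 : ∀ x, U 0 x = 0) {n : ℕ}
    {d : Fin (n + 1) → ℤ} {x : Fin (n + 1) → A.a} (hx : ∀ i, x i ∈ A.grading (d i)) :
    (n + 1 : ℝ) • U (n + 1) x = ∑ i, blockSign d {i} (univ \ {i}) •
      A.proj (A.expAd (d ∘ i.succAbove) (coeffs U (x ∘ i.succAbove))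
        (Pi.single ∅ (ψ (x i))) univ) := by
  have hn : (n + 1 : ℝ) ≠ 0 := by positivity
  have hterm : ∀ i, A.proj (A.expAd (d ∘ i.succAbove) (coeffs U (x ∘ i.succAbove))
        (Pi.single ∅ (ψ (x i))) univ) = ∑ c : Composition n, ∑ τ : Equiv.Perm (Fin n),
      (koszulSign (d ∘ i.succAbove) τ /
          ((c.length.factorial : ℝ) * ∏ j, ((c.blocksFun j).factorial : ℝ))) •
        A.proj (A.nested c.length (ψ (x i))
          fun j => (U (c.blocksFun j) fun k => x (i.succAbove (τ (c.embedding j k))) : A.a)) := by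
    intro i
    have h := sum_composition_perm hf hU0
      (G := fun k v => A.proj (A.nested k (ψ (x i)) fun j => (v j : H)))
      (fun k c v => by
        rw [← map_smul, ← smul_nested]
        rfl) (d := d ∘ i.succAbove) (x := x ∘ i.succAbove) fun j => hx _
    refine Eq.trans ?_ h.symm
    rw [A.expAd_apply_apply _ (coeffs_empty hU0) _ (N := n) (by simp), map_sum]
    refine sum_congr rfl fun k _ => ?_
    rw [adRight_pow_single_apply, map_smul, map_sum]
    simp only [map_smul]
    rfl
  simp only [hterm]
  rw [hU n d x hx, smul_sum]
  simp only [smul_sum]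
  simp only [sum_perm_succ]
  rw [sum_comm]
  refine sum_congr rfl fun i _ => ?_
  refine sum_congr rfl fun c _ => sum_congr rfl fun τ _ => ?_
  have hcyc : d ∘ (i.cycleRange.symm : Fin (n + 1) → Fin (n + 1)) ∘ Fin.succ = d ∘ i.succAbove :=
    funext fun j => congrArg d (Fin.cycleRange_symm_succ i j)
  rw [koszulSign_mul, koszulSign_cycleRange_symm, koszulSign_decomposeFin_symm, Function.comp_assoc,
    hcyc, smul_smul, smul_smul]
  simp only [Equiv.Perm.mul_apply, Equiv.Perm.decomposeFin_symm_apply_zero,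
    Equiv.Perm.decomposeFin_symm_apply_succ, Equiv.swap_self, Equiv.refl_apply,
    Fin.cycleRange_symm_zero, Fin.cycleRange_symm_succ]
  congr 1
  field_simp

end VAlgebra

namespace VAlgebra

open KoszulGradedLieAlgebra

variable {H : Type*} [AddCommGroup H] [Module ℝ H] {𝓗 : ℤ → Submodule ℝ H} {A : VAlgebra 𝓗}
  {ψ : H ≃ₗ[ℝ] H} {U : ∀ n : ℕ, (Fin n → A.a) → A.a}

theorem map_succAboveOrderEmb_univ {n : ℕ} (i : Fin (n + 1)) :
    (univ : Finset (Fin n)).map (Fin.succAboveOrderEmb i).toEmbedding = univ \ {i} := by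
  rw [map_eq_image, ← compl_eq_univ_sdiff, ← Fin.image_succAbove_univ]
  rfl

/-- On each word, a family that satisfies the recursion solves the differential equation: the factor
`1/n` of the recursion is the inverse of the Euler derivation in polynomial degree `n`. -/
theorem SatisfiesRecursion.isTransported (hU : A.SatisfiesRecursion ψ U)
    (hf : IsGradedSymmetricFamily A.grading A.grading 0 U) (hU0 : ∀ x, U 0 x = 0)
    {ι : Type*} [LinearOrder ι] [Fintype ι] {d : ι → ℤ} {x : ι → A.a}
    (hx : ∀ i, x i ∈ A.grading (d i)) :
    A.IsTransported d ψ (primary fun i => (x i : H)) (coeffs U x) where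
  hom_source := primary_homogeneous fun i => hx i
  pr_source := by
    refine (compLeft_primary A.projEnd _).trans ?_
    simp [projEnd_apply, A.proj_coe]
  euler_source := by
    rw [euler_primary]
    simp
  hom := coeffs_homogeneous hf hx
  pr_eq := pr_coeffs
  empty := coeffs_empty hU0
  ode := by
    have huniv : ∀ (n : ℕ) (d : Fin (n + 1) → ℤ) (x : Fin (n + 1) → A.a),
        (∀ i, x i ∈ A.grading (d i)) → (n + 1 : ℝ) • U (n + 1) x =
          A.proj (A.expAd d (coeffs U x) (primary fun i => ψ (x i)) univ) := by
      intro n d x hx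
      rw [hU.smul_apply hf hU0 hx, A.expAd_primary d (coeffs_empty hU0), map_sum]
      refine sum_congr rfl fun i _ => ?_
      rw [map_smul]
      congr 2
      rw [← map_succAboveOrderEmb_univ i, A.expAd_map _ _ (coeffs_empty hU0), coeffs_comp_map,
        single_empty_comp_map]
      rfl
    funext S
    rw [euler_one_apply, pr_apply, compLeft_primary]
    rcases h0 : S.card with _ | n
    rotate_left
    · have hn := h0
      set e := S.orderEmbOfFin hn with he
      have hS : S = univ.map e.toEmbedding := (map_orderEmbOfFin_univ S hn).symm
      have h := huniv _ (d ∘ e) (x ∘ e) fun i => hx _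
      conv_rhs => rw [hS]
      conv_lhs => rw [hS]
      rw [A.expAd_map _ _ (coeffs_empty hU0), coeffs_comp_map, coeffs_map, coeffs, evalOn_univ]
      simp only [primary_map]
      push_cast
      rw [← Submodule.coe_smul, h]
      rfl
    · rw [card_eq_zero] at h0
      subst h0
      rw [A.expAd_empty _ (coeffs_empty hU0)]
      simp

/-- The derivative of the transported family in its first argument. In contrast to the recursion, in
which all arguments play the same role, only `y` is acted upon by `ψ` here. -/
theorem SatisfiesRecursion.apply_cons (hU : A.SatisfiesRecursion ψ U)
    (hψ : A.PreservesKernel ψ)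
    (hf : IsGradedSymmetricFamily A.grading A.grading 0 U) (hU0 : ∀ x, U 0 x = 0)
    {n : ℕ} {d : Fin n → ℤ} {x : Fin n → A.a} (hx : ∀ i, x i ∈ A.grading (d i)) {k : ℤ} {y : A.a}
    (hy : y ∈ A.grading k) :
    U (n + 1) (Fin.cons y x) =
      A.proj (A.expAd d (coeffs U x) (Pi.single ∅ (ψ y)) univ) := by
  set x' : Fin (n + 1) → A.a := Fin.cons y x with hx'
  set d' : Fin (n + 1) → ℤ := Fin.cons k d with hd'
  have hxd : ∀ i, x' i ∈ A.grading (d' i) := fun i => by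
    refine Fin.cases ?_ (fun i => ?_) i
    · exact hy
    · exact hx i
  -- The weight that is concentrated on the first entry singles out `y`.
  have h := congrFun ((hU.isTransported hf hU0 hxd).euler_weight hψ (Pi.single 0 1)) univ
  rw [euler_apply, sum_pi_single', if_pos (mem_univ _), one_smul, coeffs, evalOn_univ,
    pr_apply, euler_primary, compLeft_primary, A.expAd_primary d' (coeffs_empty hU0),
    sum_eq_single 0] at h
  · rw [Subtype.ext h]
    have hsign : blockSign d' {0} (univ \ {0}) = 1 := by
      rw [blockSign, prod_singleton]
      exact prod_eq_one fun j _ => if_neg (Fin.not_lt_zero _)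
    have hx0 : x' ∘ Fin.succAboveOrderEmb 0 = x := by
      funext j
      simp [hx']
    have hd0 : d' ∘ Fin.succAboveOrderEmb 0 = d := by
      funext j
      simp [hd']
    rw [hsign, one_smul, ← map_succAboveOrderEmb_univ 0, A.expAd_map _ _ (coeffs_empty hU0),
      coeffs_comp_map, single_empty_comp_map, hx0, hd0, Pi.single_eq_same, one_smul]
    rfl
  · intro i _ hi
    rw [Pi.single_eq_of_ne hi, zero_smul, LinearEquiv.coe_coe, map_zero, Pi.single_zero, map_zero,
      Pi.zero_apply, smul_zero]
  · simp

/-- The insertion of a family `m` into the transported family is the derivative of the latter in the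
direction of `m`. -/
theorem SatisfiesRecursion.insertion_eq (hU : A.SatisfiesRecursion ψ U)
    (hψ : A.PreservesKernel ψ)
    (hf : IsGradedSymmetricFamily A.grading A.grading 0 U) (hU0 : ∀ x, U 0 x = 0)
    {m : ∀ n : ℕ, (Fin n → A.a) → A.a} {k : ℤ}
    (hm : IsGradedSymmetricFamily A.grading A.grading k m)
    {n : ℕ} {d : Fin n → ℤ} {x : Fin n → A.a} (hx : ∀ i, x i ∈ A.grading (d i)) :
    insertion U m d x = A.proj (A.expAd d (coeffs U x)
      (ψ.toLinearMap.compLeft (Finset (Fin n)) (coeffs m x)) univ) := by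
  rw [insertion_eq_sum, A.expAd_eq_sum d (coeffs_empty hU0), map_sum]
  refine sum_congr rfl fun S _ => ?_
  rw [map_smul]
  congr 1
  set e := (univ \ S).orderEmbOfFin rfl
  rw [hU.apply_cons hψ hf hU0 (d := d ∘ e) (fun i => hx _) (hm.evalOn_mem hx S)]
  conv_rhs => rw [← map_orderEmbOfFin_univ (univ \ S) rfl]
  rw [A.expAd_map _ _ (coeffs_empty hU0), coeffs_comp_map, single_empty_comp_map]
  rfl

theorem smul_family {k : ℤ} {m : ∀ n : ℕ, (Fin n → A.a) → A.a}
    (hm : IsGradedSymmetricFamily A.grading A.grading k m) (n : ℕ) (c : Fin n → ℝ)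
    (v : Fin n → A.a) : m n (fun j => c j • v j) = (∏ j, c j) • m n v := by
  obtain ⟨F, hF⟩ := hm.multilinear n
  rw [← hF, ← hF]
  exact F.map_smul_univ c v

/-- The composition of derived brackets with a family is the series of derived brackets, evaluated
on the family. -/
theorem familyComp_derivedBrackets
    (hf : IsGradedSymmetricFamily A.grading A.grading 0 U) (hU0 : ∀ x, U 0 x = 0)
    {Ehat : H →ₗ[ℝ] H} (hE : A.IsDerivation 1 Ehat) {P : H} (hP : P ∈ 𝓗 1)
    {n : ℕ} {d : Fin n → ℤ} {x : Fin n → A.a} (hx : ∀ i, x i ∈ A.grading (d i)) :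
    familyComp (A.derivedBrackets Ehat P) U d x =
      A.proj (A.derivedSeries d Ehat P (coeffs U x) univ) := by
  have hzero : (A.adRight d (coeffs U x) ^ n) ((Ehat + A.br P).compLeft (Finset (Fin n))
      (coeffs U x)) univ = 0 := by
    refine A.adRight_pow_vanishesBelow d (coeffs_empty hU0) n (m := 1)
      (vanishesBelow_one ?_) univ (by simp)
    simp [coeffs_empty hU0]
  rw [familyComp, sum_composition_perm hf hU0
    (smul_family (A.derivedBrackets_family hE hP)) hx, sum_range_succ', derivedSeries,
    Fintype.card_fin, Pi.add_apply, Finset.sum_apply, sum_range_succ (n := n), Pi.smul_apply, hzero,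
    smul_zero, add_zero, add_comm, map_add, map_sum]
  congr 1
  · rw [sum_orderedPartitions_zero, Nat.factorial_zero, Nat.cast_one, inv_one, one_smul]
    split_ifs with h
    · rw [h, Pi.single_eq_same]
      simp [partitionSign, derivedBrackets]
    · rw [Pi.single_eq_of_ne h, map_zero]
  · refine sum_congr rfl fun k _ => ?_
    rw [Pi.smul_apply, adRight_pow_apply, map_smul, map_sum]
    congr 1
    refine sum_congr rfl fun B _ => ?_
    rw [map_smul]
    rfl

end VAlgebra

/-! ### The Jacobi identities and the morphism property -/

section Families

variable {V W : Type*} [AddCommGroup V] [Module ℝ V] [AddCommGroup W] [Module ℝ W]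
  {𝓥 : ℤ → Submodule ℝ V} {𝓦 : ℤ → Submodule ℝ W} {k : ℤ} {f : ∀ n : ℕ, (Fin n → V) → W}

/-- Moving one entry of an increasing word to the end. -/
theorem IsGradedSymmetricFamily.apply_snoc (hf : IsGradedSymmetricFamily 𝓥 𝓦 k f) {ι : Type*}
    [LinearOrder ι] {d : ι → ℤ} {x : ι → V} (hx : ∀ i, x i ∈ 𝓥 (d i)) {S : Finset ι} {i : ι}
    (hi : i ∈ S) {n : ℕ} (hS : (S \ {i}).card = n) :
    f (n + 1) (Fin.snoc (α := fun _ => V) (fun j => x ((S \ {i}).orderEmbOfFin hS j)) (x i)) =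
      blockSign d (S \ {i}) {i} • evalOn f x S := by
  set e := (S \ {i}).orderEmbOfFin hS
  have he : ∀ j, e j ∈ S \ {i} := fun j => orderEmbOfFin_mem _ hS j
  let q : Fin (n + 1) → ι := Fin.snoc (α := fun _ => ι) e i
  have hq1 : ∀ j : Fin n, q j.castSucc = e j := fun j => Fin.snoc_castSucc (α := fun _ => ι) _ _ j
  have hq2 : q (Fin.last n) = i := Fin.snoc_last (α := fun _ => ι) _ _
  have hinj : Function.Injective q := by
    refine Fin.snoc_injective_iff.2 ⟨e.injective, ?_⟩
    rintro ⟨j, hj⟩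
    have := he j
    simp [hj] at this
  have hcard : S.card = n + 1 := by
    rw [← hS, card_sdiff_of_subset (singleton_subset_iff.2 hi), card_singleton]
    have := card_pos.2 ⟨i, hi⟩
    omega
  have hmem : ∀ j, q j ∈ S := by
    refine Fin.lastCases ?_ fun j => ?_
    · rwa [hq2]
    · rw [hq1]
      exact (mem_sdiff.1 (he j)).1
  have h := hf.apply_word hx hinj hcard hmem
  rw [wordSign_castSucc] at h
  simp only [hq1, hq2] at h
  rw [wordSign_of_strictMono d e.strictMono, one_mul] at h
  have hsign : ∏ j, pairSign d (e j) i = blockSign d (S \ {i}) {i} := by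
    conv_rhs => rw [← map_orderEmbOfFin_univ (S \ {i}) hS]
    rw [blockSign, prod_map]
    simp only [prod_singleton]
    rfl
  rw [hsign] at h
  rw [← h]
  congr 1
  funext j
  refine Fin.lastCases ?_ (fun j => ?_) j
  · rw [Fin.snoc_last, hq2]
  · rw [Fin.snoc_castSucc, hq1]

theorem IsGradedSymmetricFamily.apply_cons (hf : IsGradedSymmetricFamily 𝓥 𝓦 k f) {n : ℕ}
    {d : Fin n → ℤ} {x : Fin n → V} (hx : ∀ i, x i ∈ 𝓥 (d i)) {l : ℤ} {y : V} (hy : y ∈ 𝓥 l) :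
    f (n + 1) (Fin.cons y x) =
      (-1 : ℝ) ^ (l * ∑ i, d i) • f (n + 1) (Fin.snoc (α := fun _ => V) x y) := by
  let d' : Fin (n + 1) → ℤ := Fin.cons l d
  have hxd : ∀ i, (Fin.cons y x : Fin (n + 1) → V) i ∈ 𝓥 (d' i) := fun i => by
    refine Fin.cases ?_ (fun i => ?_) i
    · exact hy
    · exact hx i
  have hcard : (univ \ {0} : Finset (Fin (n + 1))).card = n := by
    rw [card_sdiff_of_subset (subset_univ _)]
    simp
  have he : Fin.succ = (univ \ {0} : Finset (Fin (n + 1))).orderEmbOfFin hcard :=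
    orderEmbOfFin_unique hcard (by simp) Fin.strictMono_succ
  have hsign : blockSign d' (univ \ {0}) {0} = (-1 : ℝ) ^ (l * ∑ i, d i) := by
    have hone : blockSign d' {0} (univ \ {0}) = 1 := by
      rw [blockSign, prod_singleton]
      exact prod_eq_one fun j _ => if_neg (Fin.not_lt_zero _)
    have hsum := degSum_sdiff d' (subset_univ {0})
    rw [degSum_singleton, degSum, degSum, Fin.sum_univ_succ, add_right_inj] at hsum
    rw [blockSign_swap d' sdiff_disjoint, hone, mul_one, degSum_singleton, degSum, hsum, mul_comm]
    rfl
  have h := hf.apply_snoc hxd (mem_univ 0) hcard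
  rw [← he, hsign, evalOn_univ] at h
  simp only [Fin.cons_succ, Fin.cons_zero] at h
  rw [h, smul_smul, negOne_zpow_mul_self, one_smul]

end Families

namespace VAlgebra

open KoszulGradedLieAlgebra

variable {H : Type*} [AddCommGroup H] [Module ℝ H] {𝓗 : ℤ → Submodule ℝ H} {A : VAlgebra 𝓗}
  {ψ : H ≃ₗ[ℝ] H} {U : ∀ n : ℕ, (Fin n → A.a) → A.a} {Ehat : H →ₗ[ℝ] H} {P : H}

theorem liftedBrackets_snoc (n : ℕ) (x : Fin (n + 1) → A.a) (y : A.a) :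
    A.liftedBrackets Ehat P (n + 2) (Fin.snoc (α := fun _ => A.a) x y) =
      A.br (A.liftedBrackets Ehat P (n + 1) x) y := by
  rw [liftedBrackets, nested_succ_last, liftedBrackets]
  have h0 : (Fin.snoc x y : Fin (n + 2) → A.a) 0 = x 0 :=
    Fin.snoc_castSucc (α := fun _ => A.a) y x 0
  have h1 : ∀ j : Fin n, (Fin.snoc x y : Fin (n + 2) → A.a) j.castSucc.succ = x j.succ :=
    fun j => Fin.snoc_castSucc (α := fun _ => A.a) y x j.succ
  have h2 : (Fin.snoc x y : Fin (n + 2) → A.a) (Fin.last n).succ = y :=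
    Fin.snoc_last (α := fun _ => A.a) y x
  simp only [h0, h1, h2]

/-- The lifted brackets of a word `X = ∑ x_i ⊗ θ_i` solve the differential equation
`D p = Ehat X + [p, X]`. -/
theorem euler_liftedBrackets (hE : A.IsDerivation 1 Ehat) (hP : P ∈ 𝓗 1) {ι : Type*}
    [LinearOrder ι] {d : ι → ℤ} {x : ι → A.a} (hx : ∀ i, x i ∈ A.grading (d i)) :
    euler (fun _ => 1) (evalOn (A.liftedBrackets Ehat P) x) =
      Ehat.compLeft (Finset ι) (primary fun i => (x i : H)) +
        A.conv d 0 (evalOn (A.liftedBrackets Ehat P) x) (primary fun i => (x i : H)) := by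
  have hf := A.liftedBrackets_family hE hP
  funext S
  rw [euler_one_apply, Pi.add_apply, A.conv_zero_apply, LinearMap.compLeft_apply,
    Function.comp_apply, sum_powerset_compl S fun B C => blockSign d B C •
      A.br (evalOn (A.liftedBrackets Ehat P) x B) (primary (fun i => (x i : H)) C),
    sum_powerset_of_card_ne_one S _ fun B hB => by
      rw [primary_of_card_ne_one _ hB, map_zero, smul_zero]]
  simp only [primary_singleton]
  rcases hS : S.card with _ | _ | n
  · rw [card_eq_zero] at hS
    simp [hS]
  · obtain ⟨i, rfl⟩ := card_eq_one.1 hS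
    rw [evalOn_singleton, primary_singleton, sum_singleton, Finset.sdiff_self, evalOn_empty]
    simp [liftedBrackets, nested]
  · rw [primary_of_card_ne_one _ (by omega), map_zero, zero_add, ← hS, Nat.cast_smul_eq_nsmul,
      ← sum_const]
    refine sum_congr rfl fun i hi => ?_
    have hcard : (S \ {i}).card = n + 1 := by
      rw [card_sdiff_of_subset (singleton_subset_iff.2 hi), card_singleton]
      omega
    have h := hf.apply_snoc hx hi hcard
    rw [liftedBrackets_snoc, evalOn_eq_of_strictMono (A.liftedBrackets Ehat P) x hcard
      ((S \ {i}).orderEmbOfFin hcard).strictMono (orderEmbOfFin_mem _ hcard)] at h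
    rw [h, smul_smul, blockSign_mul_self, one_smul]

theorem pr_liftedBrackets {ι : Type*} [LinearOrder ι] (x : ι → A.a) :
    A.pr (evalOn (A.liftedBrackets Ehat P) x) = coeffs (A.derivedBrackets Ehat P) x := by
  funext S
  rw [pr_apply, coeffs, evalOn, evalOn, derivedBrackets_eq]

/-- The Jacobiators of the derived brackets in terms of the lifted brackets `p`: they are the
coefficients of `Π (Ehat Π p + [p, Π p])`. -/
theorem insertion_derivedBrackets (hE : A.IsDerivation 1 Ehat) (hP : P ∈ 𝓗 1) {n : ℕ}
    {d : Fin n → ℤ} {x : Fin n → A.a} (hx : ∀ i, x i ∈ A.grading (d i)) :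
    insertion (A.derivedBrackets Ehat P) (A.derivedBrackets Ehat P) d x =
      A.proj (Ehat (coeffs (A.derivedBrackets Ehat P) x univ) +
        A.conv d 1 (evalOn (A.liftedBrackets Ehat P) x)
          (coeffs (A.derivedBrackets Ehat P) x) univ) := by
  have hf := A.liftedBrackets_family hE hP
  have hD := A.derivedBrackets_family hE hP
  rw [insertion_eq_sum, map_add, A.conv_apply,
    sum_powerset_compl univ fun B C => (blockSign d B C * (-1 : ℝ) ^ (degSum d B * 1)) •
      A.br (evalOn (A.liftedBrackets Ehat P) x B) (coeffs (A.derivedBrackets Ehat P) x C),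
    map_sum, ← sum_erase_add _ _ (mem_powerset_self univ),
    ← sum_erase_add (univ : Finset (Fin n)).powerset _ (mem_powerset_self univ), add_left_comm]
  congr 1
  · refine sum_congr rfl fun S hS => ?_
    have hne : (univ \ S).Nonempty := by
      rw [nonempty_iff_ne_empty, Ne, sdiff_eq_empty_iff_subset]
      exact fun h => (mem_erase.1 hS).1 (univ_subset_iff.1 h)
    have hmem := hD.evalOn_mem hx S
    obtain ⟨l, hl⟩ : ∃ l, (univ \ S).card = l + 1 := ⟨_, (Nat.succ_pred (card_pos.2 hne).ne').symm⟩
    set e := (univ \ S).orderEmbOfFin hl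
    have hcons := cons_eq_of_strictMono (A.liftedBrackets Ehat P)
      (evalOn (A.derivedBrackets Ehat P) x S) x hl e.strictMono (orderEmbOfFin_mem _ hl)
    rw [derivedBrackets_eq, ← hcons, hf.apply_cons (d := d ∘ e) (fun i => hx _) hmem,
      liftedBrackets_snoc, evalOn_eq_of_strictMono (A.liftedBrackets Ehat P) x hl e.strictMono
        (orderEmbOfFin_mem _ hl)]
    have hsum : ∑ i, (d ∘ e) i = degSum d (univ \ S) := by
      rw [← map_orderEmbOfFin_univ (univ \ S) hl, degSum_map]
      rfl
    rw [hsum, map_smul, map_smul, smul_smul, blockSign_swap d sdiff_disjoint]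
    congr 1
    rw [mul_right_comm, negOne_zpow_mul, mul_comm]
    congr 1
    exact congrArg _ (by ring)
  · rw [Finset.sdiff_self, blockSign_empty_right, one_smul]
    rw [evalOn_empty, blockSign_empty_left, degSum_empty, zero_mul, zpow_zero, mul_one, one_smul,
      ← map_add]
    rfl

theorem derivedBrackets_isLInftyAlgebra (hE : A.IsAdaptedMaurerCartan Ehat P) :
    IsLInftyAlgebra A.grading (A.derivedBrackets Ehat P) where
  family := A.derivedBrackets_family hE.derivation hE.degree
  jacobi n d x hn hx := by
    have hf := A.liftedBrackets_family hE.derivation hE.degree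
    rw [insertion_derivedBrackets hE.derivation hE.degree hx, ← pr_liftedBrackets]
    have hne : (univ : Finset (Fin n)).Nonempty := ⟨⟨0, hn⟩, mem_univ _⟩
    exact Subtype.ext (pr_square_apply_eq_zero hE (primary_homogeneous fun i => hx i)
      (by rw [euler_primary]; simp) (fun S => hf.evalOn_mem hx S) (evalOn_empty _ _)
      (euler_liftedBrackets hE.derivation hE.degree hx) hne)

/-- The transported family is a morphism between the derived brackets of `Ehat + [P, ·]` and of its
conjugate under `ψ`. -/
theorem SatisfiesRecursion.isLInftyMorphism (hU : A.SatisfiesRecursion ψ U)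
    (hψ : A.PreservesKernel ψ)
    (hf : IsGradedSymmetricFamily A.grading A.grading 0 U) (hU0 : ∀ x, U 0 x = 0)
    {Ehat' : H →ₗ[ℝ] H} (hE : A.IsDerivation 1 Ehat) (hP : P ∈ 𝓗 1)
    (hE' : A.IsDerivation 1 Ehat') (hψE : ∀ z, Ehat' (ψ z) = ψ (Ehat z))
    (hadapted : ∀ z, A.proj (Ehat' (A.proj z : H)) = A.proj (Ehat' z)) :
    IsLInftyMorphism A.grading A.grading (A.derivedBrackets Ehat P)
      (A.derivedBrackets Ehat' (ψ P)) U where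
  family := hf
  zero_ary := hU0
  comm n d x hx := by
    have T := hU.isTransported hf hU0 hx
    rw [hU.insertion_eq hψ hf hU0 (A.derivedBrackets_family hE hP) hx,
      familyComp_derivedBrackets hf hU0 hE' (hψ.aut.degree _ _ hP) hx, ← pr_liftedBrackets]
    exact Subtype.ext (congrFun (T.pr_expAd_pr hψ hE' hψE hadapted
      (euler_liftedBrackets hE hP hx)
      (A.euler_derivedSeries hE' (ψ P) T.hom T.pr_eq T.empty)
      ((A.derivedSeries_empty (ψ P) T.empty).trans
        (congrArg ψ (evalOn_empty (A.liftedBrackets Ehat P) x).symm))) univ)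

end VAlgebra

/-! ### Gluing of blocks -/

theorem biUnion_sdiff_of_pairwiseDisjoint {ι κ : Type*} [DecidableEq ι] [DecidableEq κ]
    {b : κ → Finset ι} {T R : Finset κ}
    (hT : (T : Set κ).PairwiseDisjoint b) (hR : R ⊆ T) :
    (T \ R).biUnion b = T.biUnion b \ R.biUnion b := by
  ext i
  simp only [mem_biUnion, mem_sdiff, not_exists, not_and]
  constructor
  · rintro ⟨j, ⟨hj, hjR⟩, hi⟩
    refine ⟨⟨j, hj, hi⟩, fun l hl hil => ?_⟩
    have hjl : j ≠ l := fun h => hjR (h ▸ hl)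
    exact disjoint_left.1 (hT hj (hR hl) hjl) hi hil
  · rintro ⟨⟨j, hj, hi⟩, h⟩
    exact ⟨j, ⟨hj, fun hjR => h j hjR hi⟩, hi⟩

section Gluing

open KoszulGradedLieAlgebra

variable {ι κ : Type*} [LinearOrder ι] [LinearOrder κ] (d : ι → ℤ) (b : κ → Finset ι)

/-- The sign that sorts the concatenation of the blocks `b j`, `j ∈ T`, taken in increasing order of
`j`. -/
noncomputable def gluingSign (T : Finset κ) : ℝ :=
  ∏ j ∈ T, ∏ l ∈ T, if j < l then blockSign d (b j) (b l) else 1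

variable {b} in
/-- The gluing sign compares the Koszul signs for words in blocks, each block counting as one entry
whose degree is the sum of its degrees, with those for words in the entries of the blocks. -/
theorem gluingSign_union {S T : Finset κ} (hST : Disjoint S T)
    (hb : ((S ∪ T : Finset κ) : Set κ).PairwiseDisjoint b) :
    gluingSign d b (S ∪ T) * blockSign (fun j => degSum d (b j)) S T =
      gluingSign d b S * gluingSign d b T * blockSign d (S.biUnion b) (T.biUnion b) := by
  have hne : ∀ j ∈ S, ∀ l ∈ T, j ≠ l := fun j hj l hl h => disjoint_left.1 hST hj (h ▸ hl)
  have hS : (S : Set κ).PairwiseDisjoint b := hb.subset (by simp)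
  have hT : (T : Set κ).PairwiseDisjoint b := hb.subset (by simp)
  have hcross : blockSign d (S.biUnion b) (T.biUnion b) =
      ∏ j ∈ S, ∏ l ∈ T, blockSign d (b j) (b l) := by
    rw [blockSign, prod_biUnion hS]
    refine prod_congr rfl fun j _ => ?_
    simp only [prod_biUnion hT, blockSign]
    exact prod_comm
  have hpair : ∀ j ∈ S, ∀ l ∈ T, (if j < l then blockSign d (b j) (b l) else 1) *
      (if l < j then blockSign d (b l) (b j) else 1) * pairSign (fun j => degSum d (b j)) j l =
        blockSign d (b j) (b l) := by
    intro j hj l hl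
    have hdisj : Disjoint (b j) (b l) := hb (by simp [hj]) (by simp [hl]) (hne j hj l hl)
    rcases lt_or_gt_of_ne (hne j hj l hl) with h | h
    · simp [pairSign, h, h.not_gt]
    · rw [if_neg h.not_gt, if_pos h, one_mul, blockSign_swap d hdisj.symm, pairSign, if_pos h,
        mul_comm (degSum d (b l)), mul_right_comm, negOne_zpow_mul_self, one_mul]
  have hprod : ∏ j ∈ S, ∏ l ∈ T, blockSign d (b j) (b l) =
      (∏ j ∈ S, ∏ l ∈ T, if j < l then blockSign d (b j) (b l) else 1) *
      (∏ j ∈ T, ∏ l ∈ S, if j < l then blockSign d (b j) (b l) else 1) *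
      blockSign (fun j => degSum d (b j)) S T := by
    rw [prod_comm (s := T), blockSign, ← prod_mul_distrib, ← prod_mul_distrib]
    refine prod_congr rfl fun j hj => ?_
    rw [← prod_mul_distrib, ← prod_mul_distrib]
    exact prod_congr rfl fun l hl => (hpair j hj l hl).symm
  rw [hcross, hprod]
  simp only [gluingSign, prod_union hST, prod_mul_distrib]
  ring

/-- The sign of an ordered partition, in terms of the enumeration of its blocks. -/
theorem partitionSign_mul_wordSign {k : ℕ} {q : Fin k → κ} (hq : Function.Injective q)
    (hb : ∀ i j, i ≠ j → Disjoint (b (q i)) (b (q j))) :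
    partitionSign d (fun i => b (q i)) * wordSign (fun j => degSum d (b j)) q =
      gluingSign d b (univ.image q) := by
  let h : κ → κ → ℝ := fun a c => if a < c then blockSign d (b a) (b c) else blockSign d (b c) (b a)
  have hh : ∀ a c, h a c = h c a := by
    intro a c
    rcases lt_trichotomy a c with hac | rfl | hac
    · simp [h, hac, hac.not_gt]
    · rfl
    · simp [h, hac, hac.not_gt]
  have hsign : gluingSign d b (univ.image q) =
      ∏ a ∈ univ.image q, ∏ c ∈ univ.image q, if a < c then h a c else 1 := by
    refine prod_congr rfl fun a _ => prod_congr rfl fun c _ => ?_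
    split_ifs with hac
    · exact (if_pos hac).symm
    · rfl
  rw [hsign, ← prod_lt_comp_of_injective hq hh, partitionSign, wordSign, ← prod_mul_distrib]
  refine prod_congr rfl fun i _ => ?_
  rw [← prod_mul_distrib]
  refine prod_congr rfl fun j _ => ?_
  by_cases hij : i < j
  · simp only [if_pos hij, h, pairSign]
    rcases lt_or_gt_of_ne (hq.ne hij.ne) with h' | h'
    · rw [if_pos h', if_neg h'.not_gt, mul_one]
    · rw [if_neg h'.not_gt, if_pos h', blockSign_swap d (hb i j hij.ne), mul_right_comm,
        negOne_zpow_mul_self, one_mul]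
  · simp [hij]

variable [Fintype κ]

open scoped Classical in
/-- The sets of pairwise disjoint blocks with union `S`. -/
noncomputable def blockDecompositions (S : Finset ι) : Finset (Finset κ) :=
  univ.filter fun T => (T : Set κ).PairwiseDisjoint b ∧ T.biUnion b = S

theorem mem_blockDecompositions {κ : Type*} [Fintype κ] (b : κ → Finset ι) {S : Finset ι}
    {T : Finset κ} :
    T ∈ blockDecompositions b S ↔ (T : Set κ).PairwiseDisjoint b ∧ T.biUnion b = S := by
  simp [blockDecompositions]

variable {H : Type*} [AddCommGroup H] [Module ℝ H]

/-- Gluing: a family on the subsets of `κ` induces a family on the subsets of `ι`, the element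
`j : κ` standing for the block `b j`. This is the substitution `θ_j ↦ ∏_{i ∈ b j} θ_i`. -/
noncomputable def glue : (Finset κ → H) →ₗ[ℝ] (Finset ι → H) where
  toFun f S := ∑ T ∈ blockDecompositions b S, gluingSign d b T • f T
  map_add' f g := by
    funext S
    simp [sum_add_distrib]
  map_smul' c f := by
    funext S
    simp only [Pi.smul_apply, RingHom.id_apply, smul_sum, smul_comm c]

theorem glue_apply (f : Finset κ → H) (S : Finset ι) :
    glue d b f S = ∑ T ∈ blockDecompositions b S, gluingSign d b T • f T := rfl

theorem glue_compLeft (φ : H →ₗ[ℝ] H) (f : Finset κ → H) :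
    glue d b (φ.compLeft (Finset κ) f) = φ.compLeft (Finset ι) (glue d b f) := by
  funext S
  simp [glue_apply]

theorem euler_glue (w : ι → ℝ) (f : Finset κ → H) :
    euler w (glue d b f) = glue d b (euler (fun j => ∑ i ∈ b j, w i) f) := by
  funext S
  rw [euler_apply, glue_apply, glue_apply, smul_sum]
  refine sum_congr rfl fun T hT => ?_
  obtain ⟨h1, rfl⟩ := (mem_blockDecompositions b).1 hT
  rw [euler_apply, smul_comm, sum_biUnion h1]

variable {b}

theorem glue_empty (hb : ∀ j, (b j).Nonempty) (f : Finset κ → H) : glue d b f ∅ = f ∅ := by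
  have h : blockDecompositions b (∅ : Finset ι) = {∅} := by
    ext T
    rw [mem_blockDecompositions, mem_singleton]
    constructor
    · rintro ⟨-, hT⟩
      refine eq_empty_of_forall_notMem fun j hj => ?_
      obtain ⟨i, hi⟩ := hb j
      have : i ∈ T.biUnion b := mem_biUnion.2 ⟨j, hj, hi⟩
      simp [hT] at this
    · rintro rfl
      simp
  rw [glue_apply, h, sum_singleton, gluingSign, prod_empty, one_smul]

theorem glue_primary (hb : ∀ j, (b j).Nonempty) (hinj : Function.Injective b)
    (hsurj : ∀ S, S.Nonempty → ∃ j, b j = S) {u : Finset ι → H} (hu : u ∅ = 0) :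
    glue d b (primary fun j => u (b j)) = u := by
  funext S
  rcases S.eq_empty_or_nonempty with rfl | hS
  · rw [glue_empty d hb, primary_empty, hu]
  · obtain ⟨j, rfl⟩ := hsurj S hS
    rw [glue_apply, sum_eq_single {j}]
    · simp [gluingSign]
    · intro T hT hne
      rw [primary_of_card_ne_one, smul_zero]
      intro hcard
      obtain ⟨l, rfl⟩ := card_eq_one.1 hcard
      have h := ((mem_blockDecompositions b).1 hT).2
      rw [singleton_biUnion] at h
      exact hne (congrArg _ (hinj h))
    · intro h
      exact absurd ((mem_blockDecompositions b).2 (by simp)) h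

variable {𝓗 : ℤ → Submodule ℝ H} (L : KoszulGradedLieAlgebra 𝓗)

/-- Gluing is a homomorphism for the convolution bracket. -/
theorem glue_conv (hb : ∀ j, (b j).Nonempty) (j : ℤ) (f g : Finset κ → H) :
    glue d b (L.conv (fun j => degSum d (b j)) j f g) =
      L.conv d j (glue d b f) (glue d b g) := by
  funext S
  rw [glue_apply, L.conv_apply]
  simp only [L.conv_apply, glue_apply, map_sum, LinearMap.sum_apply, smul_sum, map_smul,
    LinearMap.smul_apply, smul_smul]
  have hprod : ∀ A ∈ S.powerset, (∑ T ∈ blockDecompositions b (S \ A),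
      ∑ R ∈ blockDecompositions b A, (blockSign d A (S \ A) * (-1 : ℝ) ^ (degSum d A * j) *
        (gluingSign d b T * gluingSign d b R)) • L.br (f R) (g T)) =
      ∑ p ∈ blockDecompositions b A ×ˢ blockDecompositions b (S \ A),
        (blockSign d A (S \ A) * (-1 : ℝ) ^ (degSum d A * j) *
        (gluingSign d b p.2 * gluingSign d b p.1)) • L.br (f p.1) (g p.2) := fun A _ => by
    rw [sum_product, sum_comm]
  rw [sum_congr rfl hprod, sum_sigma', sum_sigma']
  refine sum_bij' (fun p _ => (⟨p.2.biUnion b, p.2, p.1 \ p.2⟩ :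
      Σ _ : Finset ι, Finset κ × Finset κ))
    (fun p _ => (⟨p.2.1 ∪ p.2.2, p.2.1⟩ : Σ _ : Finset κ, Finset κ)) ?_ ?_ ?_ ?_ ?_
  · rintro ⟨T, R⟩ h
    simp only [mem_sigma, mem_powerset, mem_product, mem_blockDecompositions] at h ⊢
    obtain ⟨⟨hT, rfl⟩, hR⟩ := h
    exact ⟨biUnion_subset_biUnion_of_subset_left b hR, ⟨hT.subset (coe_subset.2 hR), trivial⟩,
      hT.subset (coe_subset.2 sdiff_subset), biUnion_sdiff_of_pairwiseDisjoint hT hR⟩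
  · rintro ⟨B, R, T⟩ h
    simp only [mem_sigma, mem_powerset, mem_product, mem_blockDecompositions] at h ⊢
    obtain ⟨hB, ⟨hR, rfl⟩, hT, hTB⟩ := h
    refine ⟨⟨?_, ?_⟩, subset_union_left⟩
    · rw [coe_union, Set.pairwiseDisjoint_union]
      refine ⟨hR, hT, fun j hj l hl _ => ?_⟩
      have hl' := subset_biUnion_of_mem b hl
      rw [hTB] at hl'
      exact disjoint_sdiff.mono (subset_biUnion_of_mem b hj) hl'
    · rw [union_biUnion, hTB, union_sdiff_of_subset hB]
  · rintro ⟨T, R⟩ h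
    simp only [mem_sigma, mem_powerset] at h
    simp [union_sdiff_of_subset h.2]
  · rintro ⟨B, R, T⟩ h
    simp only [mem_sigma, mem_powerset, mem_product, mem_blockDecompositions] at h ⊢
    obtain ⟨hB, ⟨hR, rfl⟩, hT, hTB⟩ := h
    have hdisj : Disjoint R T := by
      rw [disjoint_left]
      intro j hj hj'
      obtain ⟨i, hi⟩ := hb j
      have h1 : i ∈ T.biUnion b := mem_biUnion.2 ⟨j, hj', hi⟩
      rw [hTB] at h1
      exact (mem_sdiff.1 h1).2 (mem_biUnion.2 ⟨j, hj, hi⟩)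
    rw [union_sdiff_cancel_left hdisj]
  · rintro ⟨T, R⟩ h
    simp only [mem_sigma, mem_powerset, mem_blockDecompositions] at h ⊢
    obtain ⟨⟨hT, rfl⟩, hR⟩ := h
    have hdeg : degSum (fun j => degSum d (b j)) R = degSum d (R.biUnion b) :=
      (sum_biUnion (hT.subset (coe_subset.2 hR))).symm
    have hsign := gluingSign_union d (disjoint_sdiff (s := R) (t := T))
      (by rwa [union_sdiff_of_subset hR])
    rw [union_sdiff_of_subset hR, biUnion_sdiff_of_pairwiseDisjoint hT hR] at hsign
    rw [hdeg, ← mul_assoc, hsign]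
    congr 1
    ring

theorem glue_adRight_pow (hb : ∀ j, (b j).Nonempty) (u f : Finset κ → H) (k : ℕ) :
    glue d b ((L.adRight (fun j => degSum d (b j)) u ^ k) f) =
      (L.adRight d (glue d b u) ^ k) (glue d b f) := by
  induction k with
  | zero => rfl
  | succ k ih =>
    rw [pow_succ', pow_succ', Module.End.mul_apply, Module.End.mul_apply, adRight_apply,
      adRight_apply, glue_conv d L hb, ih]

theorem glue_expAd [Fintype ι] (hb : ∀ j, (b j).Nonempty) {u : Finset κ → H} (hu : u ∅ = 0)
    (f : Finset κ → H) :
    glue d b (L.expAd (fun j => degSum d (b j)) u f) =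
      L.expAd d (glue d b u) (glue d b f) := by
  funext S
  have hκ : ∀ T : Finset κ, T.card ≤ Fintype.card κ + Fintype.card ι := fun T =>
    (card_le_univ T).trans (Nat.le_add_right _ _)
  rw [L.expAd_apply_apply d ((glue_empty d hb u).trans hu) _
    ((card_le_univ S).trans (Nat.le_add_left _ (Fintype.card κ)))]
  simp only [← glue_adRight_pow d L hb]
  rw [glue_apply]
  simp only [L.expAd_apply_apply _ hu _ (hκ _), smul_sum]
  rw [sum_comm]
  refine sum_congr rfl fun k _ => ?_
  rw [glue_apply, smul_sum]
  exact sum_congr rfl fun T _ => smul_comm _ _ _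

end Gluing

/-! ### The inverse of the transported family -/

section OrderedBlocks

variable {ι κ M : Type*} [LinearOrder ι] [Fintype ι] [LinearOrder κ] [Fintype κ] [AddCommMonoid M]
  {b : κ → Finset ι}

/-- Every decomposition into `k` blocks arises from `k!` ordered partitions. -/
theorem sum_orderedPartitions_eq_factorial_smul (hb : ∀ j, (b j).Nonempty)
    (hinj : Function.Injective b) (hsurj : ∀ S, S.Nonempty → ∃ j, b j = S) (k : ℕ) (S : Finset ι)
    (Φ : (Fin k → Finset ι) → M) (Ψ : Finset κ → M)
    (hΦ : ∀ B, (∃ i, B i = ∅) → Φ B = 0)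
    (hΦΨ : ∀ q : Fin k → κ, Function.Injective q →
      (∀ i j, i ≠ j → Disjoint (b (q i)) (b (q j))) → Φ (fun i => b (q i)) = Ψ (univ.image q)) :
    ∑ B ∈ orderedPartitions k S, Φ B =
      k.factorial • ∑ T ∈ blockDecompositions b S with T.card = k, Ψ T := by
  classical
  let g : (Fin k → Finset ι) → Finset κ := fun B => univ.filter fun j => ∃ i, b j = B i
  have hq : ∀ B ∈ orderedPartitions k S, (∀ i, (B i).Nonempty) →
      ∃ q : Fin k → κ, Function.Injective q ∧ B = (fun i => b (q i)) ∧ g B = univ.image q := by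
    intro B hB hne
    choose q hq using fun i => hsurj (B i) (hne i)
    refine ⟨q, fun i j hij => ?_, funext fun i => (hq i).symm, ?_⟩
    · by_contra h
      have h1 := (mem_orderedPartitions.1 hB).1 i j h
      rw [← hq i, ← hq j, hij, disjoint_self_iff_empty] at h1
      exact (hb _).ne_empty h1
    · ext j
      simp [g, ← hq, hinj.eq_iff, eq_comm]
  rw [← sum_filter_of_ne (p := fun B => ∀ i, (B i).Nonempty), ← sum_fiberwise_of_maps_to (g := g)
    (t := (blockDecompositions b S).filter fun T => T.card = k), smul_sum]
  · refine sum_congr rfl fun T hT => ?_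
    rw [mem_filter, mem_blockDecompositions] at hT
    obtain ⟨⟨hT1, hT2⟩, hTk⟩ := hT
    have hcard : (((orderedPartitions k S).filter fun B => ∀ i, (B i).Nonempty).filter
        fun B => g B = T).card = (univ : Finset (Fin k ≃ T)).card := by
      refine (card_bij (fun (e : Fin k ≃ T) _ => fun i => b (e i)) ?_ ?_ ?_).symm
      · intro e _
        simp only [mem_filter, mem_orderedPartitions]
        refine ⟨⟨⟨fun i j hij => hT1 (e i).2 (e j).2 ?_, ?_⟩, fun i => hb _⟩, ?_⟩
        · exact fun h => hij (e.injective (Subtype.ext h))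
        · rw [← hT2]
          ext a
          simp only [mem_biUnion, mem_univ, true_and]
          constructor
          · rintro ⟨i, hi⟩
            exact ⟨e i, (e i).2, hi⟩
          · rintro ⟨j, hj, hi⟩
            exact ⟨e.symm ⟨j, hj⟩, by simpa using hi⟩
        · ext j
          simp only [g, mem_filter, mem_univ, true_and, hinj.eq_iff]
          constructor
          · rintro ⟨i, rfl⟩
            exact (e i).2
          · intro hj
            exact ⟨e.symm ⟨j, hj⟩, by simp⟩
      · intro e _ e' _ h
        ext i
        exact hinj (congrFun h i)
      · intro B hB
        rw [mem_filter, mem_filter] at hB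
        obtain ⟨⟨hB, hne⟩, hBT⟩ := hB
        obtain ⟨q, hqi, rfl, hgq⟩ := hq B hB hne
        have hqT : ∀ i, q i ∈ T := fun i => by
          rw [← hBT, hgq]
          exact mem_image_of_mem _ (mem_univ i)
        have he : Function.Bijective fun i => (⟨q i, hqT i⟩ : T) := by
          refine ⟨fun i j h => hqi (congrArg Subtype.val h), ?_⟩
          rintro ⟨j, hj⟩
          rw [← hBT, hgq] at hj
          obtain ⟨i, -, rfl⟩ := mem_image.1 hj
          exact ⟨i, rfl⟩
        exact ⟨Equiv.ofBijective _ he, mem_univ _, rfl⟩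
    rw [card_univ, Fintype.card_equiv (Fintype.equivOfCardEq (by simp [hTk])),
      Fintype.card_fin] at hcard
    rw [← hcard, ← sum_const]
    refine sum_congr rfl fun B hB => ?_
    rw [mem_filter, mem_filter] at hB
    obtain ⟨⟨hB, hne⟩, rfl⟩ := hB
    obtain ⟨q, hqi, rfl, hgq⟩ := hq B hB hne
    rw [hgq]
    exact hΦΨ q hqi (mem_orderedPartitions.1 hB).1
  · intro B hB
    rw [mem_filter] at hB
    obtain ⟨hB, hne⟩ := hB
    obtain ⟨q, hqi, rfl, hgq⟩ := hq B hB hne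
    have hB' := mem_orderedPartitions.1 hB
    rw [mem_filter, mem_blockDecompositions, hgq, card_image_of_injective _ hqi, card_univ,
      Fintype.card_fin]
    refine ⟨⟨?_, ?_⟩, rfl⟩
    · intro j hj l hl hjl
      obtain ⟨i, -, rfl⟩ := mem_image.1 (mem_coe.1 hj)
      obtain ⟨i', -, rfl⟩ := mem_image.1 (mem_coe.1 hl)
      exact hB'.1 i i' fun h => hjl (h ▸ rfl)
    · rw [← hB'.2, image_biUnion]
  · intro B _ hB i
    rw [nonempty_iff_ne_empty]
    exact fun h => hB (hΦ B ⟨i, h⟩)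

end OrderedBlocks

namespace VAlgebra

open KoszulGradedLieAlgebra

variable {H : Type*} [AddCommGroup H] [Module ℝ H] {𝓗 : ℤ → Submodule ℝ H} {A : VAlgebra 𝓗}
  {ψ : H ≃ₗ[ℝ] H} {U U' : ∀ n : ℕ, (Fin n → A.a) → A.a}

/-- The composition of two families: the values of `U` on all nonempty subsets of the given word
form a word of their own, on which `U'` is evaluated, and the result is glued. -/
theorem familyComp_eq_glue (hf : IsGradedSymmetricFamily A.grading A.grading 0 U)
    (hU0 : ∀ x, U 0 x = 0) (hf' : IsGradedSymmetricFamily A.grading A.grading 0 U')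
    {n : ℕ} {d : Fin n → ℤ} {x : Fin n → A.a} (hx : ∀ i, x i ∈ A.grading (d i))
    {κ : Type*} [LinearOrder κ] [Fintype κ] {b : κ → Finset (Fin n)} (hb : ∀ j, (b j).Nonempty)
    (hinj : Function.Injective b) (hsurj : ∀ S, S.Nonempty → ∃ j, b j = S) :
    ((familyComp U' U d x : A.a) : H) =
      glue d b (coeffs U' fun j => evalOn U x (b j)) univ := by
  have hz : ∀ j, evalOn U x (b j) ∈ A.grading (degSum d (b j)) := fun j => by
    simpa using hf.evalOn_mem hx (b j)
  have hk : ∀ k, (k.factorial : ℝ)⁻¹ • ∑ B ∈ orderedPartitions k univ,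
      partitionSign d B • U' k (fun j => evalOn U x (B j)) =
      ∑ T ∈ blockDecompositions b univ with T.card = k,
        gluingSign d b T • evalOn U' (fun j => evalOn U x (b j)) T := by
    intro k
    rw [sum_orderedPartitions_eq_factorial_smul hb hinj hsurj k univ _ (fun T =>
      gluingSign d b T • evalOn U' (fun j => evalOn U x (b j)) T), ← Nat.cast_smul_eq_nsmul ℝ,
      smul_smul, inv_mul_cancel₀ (Nat.cast_ne_zero.2 (Nat.factorial_ne_zero k)), one_smul]
    · rintro B ⟨i, hi⟩
      obtain ⟨F, hF⟩ := hf'.multilinear k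
      rw [← hF, F.map_coord_zero i, smul_zero]
      rw [hi, evalOn_empty, hU0]
    · intro q hq hdisj
      rw [← partitionSign_mul_wordSign d b hq hdisj, ← smul_smul]
      congr 1
      exact hf'.apply_word hz hq (by rw [card_image_of_injective _ hq]; simp) fun i =>
        mem_image_of_mem _ (mem_univ i)
  have hcard : ∀ T ∈ blockDecompositions b (univ : Finset (Fin n)),
      T.card ∈ range (n + 1) := by
    intro T hT
    obtain ⟨h1, h2⟩ := (mem_blockDecompositions b).1 hT
    rw [mem_range, Nat.lt_succ_iff]
    calc T.card = ∑ _j ∈ T, 1 := by simp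
      _ ≤ ∑ j ∈ T, (b j).card := sum_le_sum fun j _ => card_pos.2 (hb j)
      _ = n := by rw [← card_biUnion h1, h2, card_univ, Fintype.card_fin]
  rw [familyComp, sum_composition_perm hf hU0 (smul_family hf') hx, glue_apply]
  simp only [hk]
  rw [sum_fiberwise_of_maps_to hcard]
  simp [coeffs]

theorem coe_idFamily {n : ℕ} (x : Fin n → A.a) :
    ((idFamily n x : A.a) : H) = primary (fun i => (x i : H)) univ := by
  rcases n with _ | _ | n
  · simp [idFamily]
  · simp [idFamily, primary]
  · rw [primary_of_card_ne_one _ (by simp)]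
    rfl

/-- The families of `ψ` and of its inverse are inverse to each other, because the composition solves
the differential equation of `VAlgebra.IsTransported.eq_source_of_ode`. -/
theorem SatisfiesRecursion.familyComp_symm (hU : A.SatisfiesRecursion ψ U)
    (hf : IsGradedSymmetricFamily A.grading A.grading 0 U) (hU0 : ∀ x, U 0 x = 0)
    (hU' : A.SatisfiesRecursion ψ.symm U')
    (hf' : IsGradedSymmetricFamily A.grading A.grading 0 U') (hU0' : ∀ x, U' 0 x = 0)
    (hψ : A.PreservesKernel ψ) (hψ' : A.PreservesKernel ψ.symm)
    {n : ℕ} {d : Fin n → ℤ} {x : Fin n → A.a} (hx : ∀ i, x i ∈ A.grading (d i)) :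
    familyComp U' U d x = idFamily n x := by
  -- An enumeration `b` of all nonempty subsets of the word.
  obtain ⟨m, b, hb, hinj, hsurj⟩ : ∃ (m : ℕ) (b : Fin m → Finset (Fin n)),
      (∀ j, (b j).Nonempty) ∧ Function.Injective b ∧ ∀ S, S.Nonempty → ∃ j, b j = S := by
    let e := Fintype.equivFin {S : Finset (Fin n) // S.Nonempty}
    exact ⟨_, fun j => (e.symm j : Finset (Fin n)), fun j => (e.symm j).2,
      Subtype.val_injective.comp e.symm.injective, fun S hS => ⟨e ⟨S, hS⟩, by simp⟩⟩
  have hz : ∀ j, evalOn U x (b j) ∈ A.grading (degSum d (b j)) := fun j => by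
    simpa using hf.evalOn_mem hx (b j)
  have T := hU.isTransported hf hU0 hx
  have T' := hU'.isTransported hf' hU0' hz
  -- The blocks `b j` are given the weights `|b j|`: then the differential equation for `U'` on the
  -- word of all blocks is glued to a differential equation on the given word.
  have hW := congrArg (glue d b) (T'.euler_weight hψ' fun j => ∑ _i ∈ b j, 1)
  have hprim : glue d b (primary fun j => ((evalOn U x (b j) : A.a) : H)) = coeffs U x :=
    glue_primary d hb hinj hsurj (coeffs_empty hU0)
  rw [← euler_glue] at hW
  have hpr : ∀ f, glue d b (A.pr f) = A.pr (glue d b f) := fun f => glue_compLeft d b A.projEnd f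
  rw [hpr, glue_expAd d A.toKoszulGradedLieAlgebra hb T'.empty, glue_compLeft,
    ← euler_glue, hprim] at hW
  refine Subtype.ext ?_
  rw [familyComp_eq_glue hf hU0 hf' hx hb hinj hsurj, coe_idFamily,
    T.eq_source_of_ode hψ ((glue_empty d hb _).trans T'.empty) hW]

end VAlgebra

/-! ### Automorphisms, the flow and the kernel of the projection -/

namespace KoszulGradedLieAlgebra

variable {H : Type*} [AddCommGroup H] [Module ℝ H] {𝓗 : ℤ → Submodule ℝ H}
  {L : KoszulGradedLieAlgebra 𝓗} {Φ Ψ : H ≃ₗ[ℝ] H}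

/-- The inverse preserves degrees because an automorphism commutes with taking homogeneous
components. -/
theorem IsAutomorphism.symm (hΦ : L.IsAutomorphism Φ) : L.IsAutomorphism Φ.symm where
  degree i x hx := by
    let := L.internal.chooseDecomposition
    have hcomm : ∀ y : H, ((DirectSum.decompose 𝓗 (Φ y) i : 𝓗 i) : H) =
        Φ ((DirectSum.decompose 𝓗 y i : 𝓗 i) : H) := by
      intro y
      induction y using DirectSum.Decomposition.inductionOn 𝓗 with
      | zero => simp
      | @homogeneous j y =>
        rcases eq_or_ne j i with rfl | hji
        · rw [DirectSum.decompose_of_mem_same 𝓗 y.2,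
            DirectSum.decompose_of_mem_same 𝓗 (hΦ.degree _ _ y.2)]
        · rw [DirectSum.decompose_of_mem_ne 𝓗 y.2 hji,
            DirectSum.decompose_of_mem_ne 𝓗 (hΦ.degree _ _ y.2) hji, map_zero]
      | add y z hy hz => simp [hy, hz]
    have h := hcomm (Φ.symm x)
    rw [Φ.apply_symm_apply, DirectSum.decompose_of_mem_same 𝓗 hx] at h
    rw [h, Φ.symm_apply_apply]
    exact SetLike.coe_mem _
  map_br x y := by
    rw [Φ.symm_apply_eq, hΦ.map_br, Φ.apply_symm_apply, Φ.apply_symm_apply]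

theorem IsAutomorphism.trans (hΦ : L.IsAutomorphism Φ) (hΨ : L.IsAutomorphism Ψ) :
    L.IsAutomorphism (Φ.trans Ψ) where
  degree i x hx := hΨ.degree i _ (hΦ.degree i x hx)
  map_br x y := by simp [hΦ.map_br, hΨ.map_br]

end KoszulGradedLieAlgebra

/-- A continuous linear map may be applied to a derivative; the spaces need not be Hausdorff. -/
theorem ContinuousLinearMap.comp_hasDerivWithinAt {E F : Type*} [AddCommGroup E] [Module ℝ E]
    [TopologicalSpace E] [IsTopologicalAddGroup E] [ContinuousSMul ℝ E] [AddCommGroup F]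
    [Module ℝ F] [TopologicalSpace F] [IsTopologicalAddGroup F] [ContinuousSMul ℝ F]
    (g : E →L[ℝ] F) {f : ℝ → E} {f' : E} {s : Set ℝ} {t : ℝ} (hf : HasDerivWithinAt f f' s t) :
    HasDerivWithinAt (fun τ => g (f τ)) (g f') s t := by
  refine .of_isLittleOTVS (((g.isBigOTVS_comp).trans_isLittleOTVS hf.isLittleOTVS).congr_left ?_)
  intro p
  simp

namespace VAlgebra

open KoszulGradedLieAlgebra

section

variable {H : Type*} [AddCommGroup H] [Module ℝ H] {𝓗 : ℤ → Submodule ℝ H} {A : VAlgebra 𝓗}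
  {ψ : H ≃ₗ[ℝ] H} {Ehat : H →ₗ[ℝ] H} {P : H}

theorem PreservesKernel.symm (hψ : A.PreservesKernel ψ) : A.PreservesKernel ψ.symm :=
  ⟨hψ.aut.symm, hψ.ker_symm, hψ.ker⟩

/-- For degree preserving maps it suffices to consider homogeneous elements of the kernel. -/
theorem proj_apply_eq_zero_of_homogeneous {F : H →ₗ[ℝ] H}
    (hF : ∀ i, ∀ w ∈ 𝓗 i, A.proj w = 0 → A.proj (F w) = 0) {z : H} (hz : A.proj z = 0) :
    A.proj (F z) = 0 := by
  have htop : (⊤ : Submodule ℝ H) ≤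
      LinearMap.eqLocus (A.proj ∘ₗ F) (A.proj ∘ₗ F ∘ₗ A.projEnd) := by
    rw [← A.internal.submodule_iSup_eq_top]
    refine iSup_le fun i w hw => ?_
    have h := hF i (w - A.proj w) (sub_mem hw (A.proj_mem i w hw))
      (by rw [map_sub, A.proj_coe, sub_self])
    rw [map_sub, map_sub, sub_eq_zero] at h
    exact h
  have h : A.proj (F z) = A.proj (F (A.proj z : H)) := htop (Submodule.mem_top (x := z))
  rw [h, hz, Submodule.coe_zero, map_zero, map_zero]

/-- Adapted Maurer–Cartan elements are transported by automorphisms that preserve the kernel of the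
projection: adaptedness of `Ehat` says that `Ehat` maps this kernel to itself. -/
theorem IsAdaptedMaurerCartan.conj (hE : A.IsAdaptedMaurerCartan Ehat P)
    (hψ : A.PreservesKernel ψ) :
    A.IsAdaptedMaurerCartan (ψ.toLinearMap ∘ₗ Ehat ∘ₗ ψ.symm.toLinearMap) (ψ P) where
  derivation :=
    { degree := fun i x hx => hψ.aut.degree _ _
        (hE.derivation.degree _ _ (hψ.aut.symm.degree _ _ hx))
      leibniz := fun i x y hx => by
        simp [hψ.aut.symm.map_br, hE.derivation.leibniz i _ _ (hψ.aut.symm.degree _ _ hx),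
          hψ.aut.map_br] }
  adapted z := by
    have h1 : A.proj (ψ.symm (z - A.proj z)) = 0 :=
      hψ.ker_symm _ (by rw [map_sub, A.proj_coe, sub_self])
    have h2 := hE.adapted (ψ.symm (z - A.proj z))
    rw [h1, Submodule.coe_zero, map_zero, map_zero] at h2
    have h3 := hψ.ker _ h2.symm
    rw [map_sub, map_sub, map_sub, map_sub, sub_eq_zero] at h3
    exact h3.symm
  degree := hψ.aut.degree _ _ hE.degree
  square := by
    have hconj : ψ.toLinearMap ∘ₗ Ehat ∘ₗ ψ.symm.toLinearMap + A.br (ψ P) =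
        ψ.toLinearMap ∘ₗ (Ehat + A.br P) ∘ₗ ψ.symm.toLinearMap := by
      ext z
      simp [hψ.aut.map_br]
    ext z
    have h := LinearMap.congr_fun hE.square (ψ.symm z)
    rw [LinearMap.comp_apply] at h
    rw [hconj]
    simp only [LinearMap.comp_apply, LinearEquiv.coe_coe, LinearEquiv.symm_apply_apply, h,
      LinearMap.zero_apply, map_zero]

/-- The Jacobiator with no arguments is the projection of the curvature `Ehat P + ½[P, P]`: it
vanishes if and only if the curvature lies in the kernel of the projection. -/
theorem derivedBrackets_one_derivedBrackets_zero (hE : A.IsAdaptedMaurerCartan Ehat P) :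
    (A.derivedBrackets Ehat P 1 fun _ => A.derivedBrackets Ehat P 0 Fin.elim0) =
      A.proj (Ehat P + (1 / 2 : ℝ) • A.br P P) := by
  have hskew : A.br (A.proj P : H) P = A.br P (A.proj P : H) := by
    rw [A.skew 1 1 _ _ (A.proj_mem 1 P hE.degree) hE.degree]
    simp
  have h : A.proj (A.br P P) = (2 : ℝ) • A.proj (A.br P (A.proj P : H)) := by
    rw [A.proj_br, hskew, two_smul]
  change A.proj ((Ehat + A.br P) (A.proj P : H)) = _
  rw [LinearMap.add_apply, map_add, map_add, hE.adapted, map_smul, h, smul_smul]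
  norm_num

/-- The transport of families along `ψ` is an isomorphism, with the transport along the inverse of
`ψ` as its inverse. -/
theorem transportMap_isLInftyIso (hψ : A.PreservesKernel ψ) (hE : A.IsAdaptedMaurerCartan Ehat P)
    {Ehat' : H →ₗ[ℝ] H} (hψE : ∀ z, Ehat' (ψ z) = ψ (Ehat z))
    (hE' : A.IsAdaptedMaurerCartan Ehat' (ψ P)) :
    IsLInftyIso A.grading A.grading (A.derivedBrackets Ehat P)
      (A.derivedBrackets Ehat' (ψ P)) fun n => A.transportMap ψ.toLinearMap n := by
  have hψ' := hψ.symm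
  have hz : ∀ ψ : H ≃ₗ[ℝ] H, ∀ x, A.transportMap ψ.toLinearMap 0 x = 0 := fun _ _ => by
    rw [transportMap, _root_.zero_apply]
  have hU := A.transportMap_satisfiesRecursion ψ
  have hU' := A.transportMap_satisfiesRecursion ψ.symm
  have hf := hU.family hψ.aut (fun n => ⟨_, fun _ => rfl⟩) (hz _)
  have hf' := hU'.family hψ'.aut (fun n => ⟨_, fun _ => rfl⟩) (hz _)
  refine ⟨derivedBrackets_isLInftyAlgebra hE, derivedBrackets_isLInftyAlgebra hE',
    hU.isLInftyMorphism hψ hf (hz _) hE.derivation hE.degree hE'.derivation hψE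
      hE'.adapted, fun n => A.transportMap ψ.symm.toLinearMap n, ?_, ?_, ?_⟩
  · have h := hU'.isLInftyMorphism hψ' hf' (hz _) hE'.derivation hE'.degree
      hE.derivation (fun z => by rw [ψ.eq_symm_apply, ← hψE, ψ.apply_symm_apply]) hE.adapted
    rwa [ψ.symm_apply_apply] at h
  · intro n d x hx
    exact hU.familyComp_symm hf (hz _) hU' hf' (hz _) hψ hψ' hx
  · intro n d x hx
    exact hU'.familyComp_symm hf' (hz _) hU hf (hz _) hψ' hψ hx

end

/-- The maps `φ t ∘ (φ s)⁻¹` preserve the kernel of the projection: for `z` in the kernel, the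
curve `τ ↦ Π (φ τ ((φ s)⁻¹ z))` solves the Cauchy problem on `a` and vanishes at `τ = s`. -/
theorem preservesKernel_of_flow {H : Type*} [AddCommGroup H] [Module ℝ H] [TopologicalSpace H]
    [IsTopologicalAddGroup H] [ContinuousSMul ℝ H] {𝓗 : ℤ → Submodule ℝ H} {A : VAlgebra 𝓗}
    (hproj : Continuous A.proj) {m : ℝ → H →ₗ[ℝ] H} {φ : ℝ → H ≃ₗ[ℝ] H}
    (hφ : ∀ t ∈ Set.Icc (0 : ℝ) 1, A.IsAutomorphism (φ t))
    (hflow : ∀ z, ∀ t ∈ Set.Icc (0 : ℝ) 1,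
      HasDerivWithinAt (fun τ => φ τ z) (m t (φ t z)) (Set.Icc 0 1) t)
    (hmproj : ∀ t ∈ Set.Icc (0 : ℝ) 1, ∀ x, A.proj (m t (A.proj x : H)) = A.proj (m t x))
    (hunique : ∀ s ∈ Set.Icc (0 : ℝ) 1, ∀ (i : ℤ) (l : ℝ → A.a),
      (∀ t ∈ Set.Icc (0 : ℝ) 1, l t ∈ A.grading i) →
      (∀ t ∈ Set.Icc (0 : ℝ) 1,
        HasDerivWithinAt l (A.proj (m t (l t : H))) (Set.Icc 0 1) t) →
      l s = 0 → ∀ t ∈ Set.Icc (0 : ℝ) 1, l t = 0)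
    {s t : ℝ} (hs : s ∈ Set.Icc (0 : ℝ) 1) (ht : t ∈ Set.Icc (0 : ℝ) 1) :
    A.PreservesKernel ((φ s).symm.trans (φ t)) := by
  have hker : ∀ s ∈ Set.Icc (0 : ℝ) 1, ∀ t ∈ Set.Icc (0 : ℝ) 1, ∀ z, A.proj z = 0 →
      A.proj (φ t ((φ s).symm z)) = 0 := by
    intro s hs t ht z hz
    refine proj_apply_eq_zero_of_homogeneous
      (F := ((φ s).symm.trans (φ t)).toLinearMap) (fun i w hw hw0 => ?_) hz
    refine hunique s hs i (fun τ => A.proj (φ τ ((φ s).symm w))) (fun τ hτ => ?_) (fun τ hτ => ?_)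
      (by simpa using hw0) t ht
    · exact A.proj_mem i _ ((hφ τ hτ).degree i _ ((hφ s hs).symm.degree i w hw))
    · rw [hmproj τ hτ]
      exact (⟨A.proj, hproj⟩ : H →L[ℝ] A.a).comp_hasDerivWithinAt (hflow _ τ hτ)
  exact ⟨(hφ s hs).symm.trans (hφ t ht), hker s hs t ht, hker t ht s hs⟩

end VAlgebra

end

theorem mainTheorem2 {H : Type*} [AddCommGroup H] [Module ℝ H] [TopologicalSpace H]
    [IsTopologicalAddGroup H] [ContinuousSMul ℝ H] (𝓗 : ℤ → Submodule ℝ H) (A : VAlgebra 𝓗)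
    (hproj : Continuous A.proj)
    (m : ℝ → H →ₗ[ℝ] H) (φ : ℝ → H ≃ₗ[ℝ] H)
    (hm : ∀ t ∈ Set.Icc (0 : ℝ) 1, A.IsDerivation 0 (m t))
    (hφ : ∀ t ∈ Set.Icc (0 : ℝ) 1, A.IsAutomorphism (φ t))
    (hφ0 : ∀ z, φ 0 z = z)
    (hflow : ∀ z, ∀ t ∈ Set.Icc (0 : ℝ) 1,
      HasDerivWithinAt (fun τ => φ τ z) (m t (φ t z)) (Set.Icc 0 1) t)
    (hmproj : ∀ t ∈ Set.Icc (0 : ℝ) 1, ∀ x, A.proj (m t (A.proj x : H)) = A.proj (m t x))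
    (hunique : ∀ s ∈ Set.Icc (0 : ℝ) 1, ∀ (i : ℤ) (l : ℝ → A.a),
      (∀ t ∈ Set.Icc (0 : ℝ) 1, l t ∈ A.grading i) →
      (∀ t ∈ Set.Icc (0 : ℝ) 1,
        HasDerivWithinAt l (A.proj (m t (l t : H))) (Set.Icc 0 1) t) →
      l s = 0 → ∀ t ∈ Set.Icc (0 : ℝ) 1, l t = 0) :
    ∃ U : ℝ → ℝ → ∀ n : ℕ, (Fin n → A.a) → A.a,
      (∀ s ∈ Set.Icc (0 : ℝ) 1, ∀ t ∈ Set.Icc (0 : ℝ) 1,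
        A.SatisfiesRecursion ((φ s).symm.trans (φ t)) (U s t)) ∧
      ∀ (Ehat : H →ₗ[ℝ] H) (P : H), A.IsAdaptedMaurerCartan Ehat P →
        (∀ s ∈ Set.Icc (0 : ℝ) 1, ∀ t ∈ Set.Icc (0 : ℝ) 1,
          IsLInftyIso A.grading A.grading (A.transportedBrackets Ehat P (φ s))
            (A.transportedBrackets Ehat P (φ t)) (U s t)) ∧
        ((A.derivedBrackets Ehat P 1 fun _ => A.derivedBrackets Ehat P 0 Fin.elim0) = 0 →
          ∀ t ∈ Set.Icc (0 : ℝ) 1,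
            (A.transportedBrackets Ehat P (φ t) 1
              fun _ => A.transportedBrackets Ehat P (φ t) 0 Fin.elim0) = 0) := by
  have hker : ∀ s ∈ Set.Icc (0 : ℝ) 1, ∀ t ∈ Set.Icc (0 : ℝ) 1,
      A.PreservesKernel ((φ s).symm.trans (φ t)) := fun s hs t ht =>
    VAlgebra.preservesKernel_of_flow hproj hφ hflow hmproj hunique hs ht
  -- The case `s = 0` of the preceding statement, as `φ 0` is the identity.
  have hkerφ : ∀ t ∈ Set.Icc (0 : ℝ) 1, A.PreservesKernel (φ t) := by
    intro t ht
    have h0 : (φ 0).symm.trans (φ t) = φ t := by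
      ext z
      rw [LinearEquiv.trans_apply, (φ 0).symm_apply_eq.2 (hφ0 z).symm]
    exact h0 ▸ hker 0 (by simp) t ht
  refine ⟨fun s t n => A.transportMap ((φ s).symm.trans (φ t)).toLinearMap n,
    fun s _ t _ => A.transportMap_satisfiesRecursion _, fun Ehat P hE => ⟨?_, ?_⟩⟩
  · intro s hs t ht
    have hP : φ t P = ((φ s).symm.trans (φ t)) (φ s P) := by simp
    have hEt := hE.conj (hkerφ t ht)
    rw [VAlgebra.transportedBrackets, VAlgebra.transportedBrackets, hP]
    rw [hP] at hEt
    exact VAlgebra.transportMap_isLInftyIso (hker s hs t ht) (hE.conj (hkerφ s hs))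
      (fun z => by simp) hEt
  · intro h t ht
    rw [VAlgebra.derivedBrackets_one_derivedBrackets_zero hE] at h
    rw [VAlgebra.transportedBrackets,
      VAlgebra.derivedBrackets_one_derivedBrackets_zero (hE.conj (hkerφ t ht))]
    have h' := (hkerφ t ht).ker _ h
    rw [map_add, map_smul, (hφ t ht).map_br] at h'
    simpa using h'
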